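/- **Setting.** Let $\Lambda=\mathbb Z^d$, $\Lambda_*=\mathbb Z^d\setminus\{0\}$. Let $\zeta\in W^{1,\infty}(\mathbb R^d;\mathbb R)$ be continuous, compactly supported, non-negative and even, with $\zeta(0)=1$, $\zeta(\xi)=0$ for $\xi\in\Lambda_*$, and $\sum_{\xi\in\Lambda}(a+b\cdot\xi)\,\zeta(x-\xi)=a+b\cdot x$ for all $a\in\mathbb R$, $b,x\in\mathbb R^d$. Let $c>0$ be such that $\operatorname{supp}\zeta$ is contained in the closed ball of radius $c$ about $0$, and put $$\chi_{\xi,\rho}(x)=\int_0^1\zeta(\xi+t\rho-x)\,dt,\qquad \nu_{\rho\varsigma}=\{y\in\mathbb R^d:\operatorname{dist}(y,\operatorname{conv}\{\pm2\rho\pm\varsigma\})\le 2c\}\qquad(\rho,\varsigma\in\Lambda_*,\ \xi\in\Lambda).$$ Let $\mathscr D$ be the space of families $g=(g_\rho)_{\rho\in\Lambda_*}$ in $\mathbb R^d$ with $\|g\|_{\mathscr D}=\sup_\rho|g_\rho|/|\rho|<\infty$, let $\kappa>0$, $\mathscr D_\kappa=\{g:\|g\|_{\mathscr D}\le\kappa\}$,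 and let $k\ge4$. Let $V:\mathscr D\to\mathbb R\cup\{\pm\infty\}$ satisfy: $V(0)=0$; $V$ is finite and of class $C^k$ (in the Fréchet sense) on $\mathscr D_\kappa$; $V((-g_{-\rho})_\rho)=V(g)$ for all $g\in\mathscr D$; $V$ is continuous on $\mathscr D_\kappa$ with respect to entrywise convergence (if $g^n,g\in\mathscr D_\kappa$ and $g^n_\rho\to g_\rho$ for every $\rho$, then $V(g^n)\to V(g)$); and, writing $V_{\boldsymbol\rho}=\partial^jV/\partial g_{\rho_1}\cdots\partial g_{\rho_j}$ and $$m(\boldsymbol\rho)=\prod_{i=1}^j|\rho_i|\ \sup_{g\in\mathscr D_\kappa}\|V_{\boldsymbol\rho}(g)\|\qquad(\boldsymbol\rho\in\Lambda_*^j),$$ $\sum_{\boldsymbol\rho\in\Lambda_*^j}m(\boldsymbol\rho)<\infty$ for $1\le j\le k$. With $|\boldsymbol\rho|=\sum_i|\rho_i|$ set $$m_d^{(\infty)}(\boldsymbol\rho)=\frac{m(\boldsymbol\rho)\,|\boldsymbol\rho|^3}{|\rho_1|},$$ which is the case $p=\infty$ of $m_d^{(p)}(\boldsymbol\rho)=\frac{m(\boldsymbol\rho)|\boldsymbol\rho|^3}{|\rho_1|}\big(\sum_{i=2}^j(|\rho_1\times\rho_i|+|\rho_1|+|\rho_i|)\big)^{1/((j-1)p)}$,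 where $|\rho_1\times\rho_i|$ is the area of the parallelogram spanned by $\rho_1,\rho_i$. For a continuous $u:\mathbb R^d\to\mathbb R^d$ in $K=\{u\in W^{1,\infty}:\|\nabla u\|_{L^\infty}\le\kappa\}$ put $Du(\xi)=(u(\xi+\rho)-u(\xi))_{\rho\in\Lambda_*}\in\mathscr D_\kappa$ and define the atomistic and the Cauchy–Born stress by $$S^a(u;x)=\sum_{\xi\in\Lambda}\sum_{\rho\in\Lambda_*}[V_\rho(Du(\xi))\otimes\rho]\,\chi_{\xi,\rho}(x),\qquad S^c_{i\alpha}(u;x)=\frac{\partial W}{\partial F_{i\alpha}}(\nabla u(x)),\qquad W(F)=V\big((F\rho)_{\rho\in\Lambda_*}\big).$$ **Lemma.** There is a constant $C$, depending only on $d$, $\zeta$ and $c$ (not on $\kappa,k,V,u,x$), such that for every (continuous representative) $u\in W^{4,\infty}_{\rm loc}(\mathbb R^d;\mathbb R^d)\cap K$ the weak divergences (in the second index) of $S^a(u;\cdot)$ and $S^c(u;\cdot)$ exist and have continuous representatives, and these satisfy, for every $x\in\mathbb R^d$, $$\begin{aligned}|\operatorname{div}S^a(u;x)-\operatorname{div}S^c(u;x)|\le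 C\Big(&\sum_{\boldsymbol\rho\in\Lambda_*^4}m_d^{(\infty)}(\boldsymbol\rho)\prod_{j=2}^4\|\nabla^2u\|_{L^\infty(x+\nu_{\rho_1\rho_j})}\\&+\sum_{\boldsymbol\rho\in\Lambda_*^3}m_d^{(\infty)}(\boldsymbol\rho)\,\|\nabla^3u\|_{L^\infty(x+\nu_{\rho_1\rho_2})}\|\nabla^2u\|_{L^\infty(x+\nu_{\rho_1\rho_3})}\\&+\sum_{\boldsymbol\rho\in\Lambda_*^2}m_d^{(\infty)}(\boldsymbol\rho)\,\|\nabla^4u\|_{L^\infty(x+\nu_{\rho_1\rho_2})}\Big),\end{aligned}$$ where the right-hand side may be $+\infty$. -/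

import Mathlib

open MeasureTheory Set Filter Topology
open scoped ENNReal NNReal ContDiff Pointwise

noncomputable section

/-- Euclidean space `ℝ^d`. -/
abbrev Eu (d : ℕ) := EuclideanSpace ℝ (Fin d)

/-- The lattice `Λ = ℤ^d`. -/
abbrev ZLat (d : ℕ) := Fin d → ℤ

/-- The lattice directions `Λ_* = ℤ^d \ {0}`. -/
abbrev LatStar (d : ℕ) := {ρ : ZLat d // ρ ≠ 0}

/-- A lattice point, regarded as a point of `ℝ^d`. -/
def latVec {d : ℕ} (ξ : ZLat d) : Eu d := WithLp.toLp 2 (fun i => (ξ i : ℝ))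

/-- A lattice direction, regarded as a vector of `ℝ^d`. -/
def dirVec {d : ℕ} (ρ : LatStar d) : Eu d := latVec ρ.1

theorem dirVec_ne_zero {d : ℕ} (ρ : LatStar d) : dirVec ρ ≠ 0 := by
  intro h
  apply ρ.2
  funext i
  have := congrArg (fun v : Eu d => v i) h
  simpa [dirVec, latVec] using this

theorem norm_dirVec_pos {d : ℕ} (ρ : LatStar d) : 0 < ‖dirVec ρ‖ :=
  norm_pos_iff.mpr (dirVec_ne_zero ρ)

/-- The direction `-ρ`. -/
def negDir {d : ℕ} (ρ : LatStar d) : LatStar d := ⟨-ρ.1, neg_ne_zero.mpr ρ.2⟩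

theorem dirVec_negDir {d : ℕ} (ρ : LatStar d) : dirVec (negDir ρ) = -dirVec ρ := by
  ext i; simp [dirVec, negDir, latVec]

/-! ### The space of finite difference stencils -/

/-- The families `(g_ρ)_{ρ ∈ Λ_*}` in `ℝ^d` with `sup_ρ |g_ρ| / |ρ| < ∞`. -/
def stencilSubmodule (d : ℕ) : Submodule ℝ (LatStar d → Eu d) where
  carrier := {g | ∃ B : ℝ, ∀ ρ, ‖g ρ‖ ≤ B * ‖dirVec ρ‖}
  zero_mem' := ⟨0, fun ρ => by simp⟩
  add_mem' := by
    rintro a b ⟨A, hA⟩ ⟨B, hB⟩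
    refine ⟨A + B, fun ρ => (norm_add_le _ _).trans ?_⟩
    rw [add_mul]
    exact add_le_add (hA ρ) (hB ρ)
  smul_mem' := by
    rintro c a ⟨A, hA⟩
    refine ⟨‖c‖ * A, fun ρ => ?_⟩
    rw [Pi.smul_apply, norm_smul, mul_assoc]
    exact mul_le_mul_of_nonneg_left (hA ρ) (norm_nonneg c)

/-- The stencil space `𝒟`; its norm, defined below, is `‖g‖ = sup_ρ |g_ρ| / |ρ|`. -/
def Stencil (d : ℕ) : Type := stencilSubmodule d

instance (d : ℕ) : AddCommGroup (Stencil d) := inferInstanceAs (AddCommGroup (stencilSubmodule d))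
instance (d : ℕ) : Module ℝ (Stencil d) := inferInstanceAs (Module ℝ (stencilSubmodule d))

/-- The entry `g_ρ` of a stencil. -/
def Stencil.entry {d : ℕ} (g : Stencil d) (ρ : LatStar d) : Eu d := g.1 ρ

/-- The linear embedding `g ↦ (g_ρ / |ρ|)_ρ` of `𝒟` into `ℓ^∞`, which induces the norm of `𝒟`. -/
def Stencil.scale (d : ℕ) : Stencil d →ₗ[ℝ] lp (fun _ : LatStar d => Eu d) ∞ where
  toFun g := ⟨fun ρ => ‖dirVec ρ‖⁻¹ • g.entry ρ, by
    obtain ⟨B, hB⟩ := g.2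
    refine memℓp_infty ⟨B, ?_⟩
    rintro _ ⟨ρ, rfl⟩
    have h := norm_dirVec_pos ρ
    simp only [norm_smul, norm_inv, norm_norm]
    rw [inv_mul_le_iff₀ h, mul_comm]
    exact hB ρ⟩
  map_add' a b := by
    ext1; funext ρ
    exact smul_add _ (a.1 ρ) (b.1 ρ)
  map_smul' c a := by
    ext1; funext ρ
    exact smul_comm _ c (a.1 ρ)

theorem Stencil.scale_injective (d : ℕ) : Function.Injective (Stencil.scale d) := by
  intro a b h
  apply Subtype.ext
  funext ρ
  have h1 : ‖dirVec ρ‖⁻¹ • a.1 ρ = ‖dirVec ρ‖⁻¹ • b.1 ρ :=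
    congrFun (congrArg Subtype.val h) ρ
  exact (smul_right_injective _ (inv_ne_zero (norm_dirVec_pos ρ).ne')) h1

instance (d : ℕ) : NormedAddCommGroup (Stencil d) :=
  NormedAddCommGroup.induced (Stencil d) _ (Stencil.scale d) (Stencil.scale_injective d)

instance (d : ℕ) : NormedSpace ℝ (Stencil d) :=
  NormedSpace.induced ℝ (Stencil d) _ (Stencil.scale d)

theorem Stencil.norm_eq {d : ℕ} (g : Stencil d) : ‖g‖ = ⨆ ρ, ‖g.entry ρ‖ / ‖dirVec ρ‖ := by
  change ‖Stencil.scale d g‖ = _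
  rw [lp.norm_eq_ciSup]
  refine iSup_congr fun ρ => ?_
  change ‖‖dirVec ρ‖⁻¹ • g.entry ρ‖ = _
  rw [norm_smul, norm_inv, norm_norm, div_eq_inv_mul]

theorem Stencil.entry_le {d : ℕ} (g : Stencil d) (ρ : LatStar d) :
    ‖g.entry ρ‖ ≤ ‖g‖ * ‖dirVec ρ‖ := by
  have h := lp.norm_apply_le_norm (p := ∞) (by simp) (Stencil.scale d g) ρ
  have h2 : ‖‖dirVec ρ‖⁻¹ • g.entry ρ‖ ≤ ‖g‖ := h
  rw [norm_smul, norm_inv, norm_norm, inv_mul_le_iff₀ (norm_dirVec_pos ρ), mul_comm] at h2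
  exact h2

theorem Stencil.norm_le {d : ℕ} (g : Stencil d) {B : ℝ} (hB : 0 ≤ B)
    (h : ∀ ρ, ‖g.entry ρ‖ ≤ B * ‖dirVec ρ‖) : ‖g‖ ≤ B := by
  rw [Stencil.norm_eq]
  exact Real.iSup_le (fun ρ => (div_le_iff₀ (norm_dirVec_pos ρ)).mpr (h ρ)) hB

/-- The ball `𝒟_κ = {g ∈ 𝒟 : ‖g‖ ≤ κ}`. -/
def stencilBall (d : ℕ) (κ : ℝ) : Set (Stencil d) := Metric.closedBall 0 κ

/-- The stencil with the single nonzero entry `v` in the direction `ρ`, as a bounded linear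
function of `v`. -/
def Stencil.single {d : ℕ} (ρ : LatStar d) : Eu d →L[ℝ] Stencil d :=
  LinearMap.mkContinuous
    { toFun := fun v => (⟨Pi.single ρ v, ‖v‖ / ‖dirVec ρ‖, fun σ => by
          by_cases hσ : σ = ρ
          · subst hσ
            rw [Pi.single_eq_same, div_mul_cancel₀ _ (norm_dirVec_pos σ).ne']
          · rw [Pi.single_eq_of_ne hσ, norm_zero]
            positivity⟩ : stencilSubmodule d)
      map_add' := fun v w => Subtype.ext (Pi.single_add (f := fun _ => Eu d) ρ v w)
      map_smul' := fun c v => Subtype.ext (Pi.single_smul (f := fun _ => Eu d) ρ c v) }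
    ‖dirVec ρ‖⁻¹ (fun v => by
      refine Stencil.norm_le _ (by positivity) fun σ => ?_
      change ‖(Pi.single ρ v : LatStar d → Eu d) σ‖ ≤ _
      by_cases hσ : σ = ρ
      · subst hσ
        rw [Pi.single_eq_same, mul_right_comm, inv_mul_cancel₀ (norm_dirVec_pos σ).ne', one_mul]
      · rw [Pi.single_eq_of_ne hσ, norm_zero]
        positivity)

/-- The point reflection `(g_ρ)_ρ ↦ (-g_{-ρ})_ρ`. -/
def Stencil.reflect {d : ℕ} (g : Stencil d) : Stencil d :=
  (⟨fun ρ => -g.entry (negDir ρ), by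
    obtain ⟨B, hB⟩ := g.2
    refine ⟨B, fun ρ => ?_⟩
    have h := hB (negDir ρ)
    rw [dirVec_negDir, norm_neg] at h
    rw [norm_neg]
    exact h⟩ : stencilSubmodule d)

/-- The homogeneous stencil `F · Λ_* = (F ρ)_ρ`. -/
def homStencil {d : ℕ} (F : Eu d →L[ℝ] Eu d) : Stencil d :=
  (⟨fun ρ => F (dirVec ρ), ‖F‖, fun ρ => F.le_opNorm _⟩ : stencilSubmodule d)

open Classical in
/-- The finite difference stencil `Du(ξ) = (u(ξ + ρ) - u(ξ))_ρ` (with value `0` if it does not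
belong to `𝒟`, which never happens for Lipschitz functions `u`). -/
def diffStencil {d : ℕ} (u : Eu d → Eu d) (ξ : ZLat d) : Stencil d :=
  if h : (fun ρ : LatStar d => u (latVec ξ + dirVec ρ) - u (latVec ξ)) ∈ stencilSubmodule d
  then (⟨_, h⟩ : stencilSubmodule d) else 0

/-! ### The site energy -/

/-- The partial derivative `V_ρ(g)`, `ρ ∈ Λ_*^j`, a `j`-linear form on `ℝ^d`; the derivative of
`V` is taken within the ball `𝒟_κ`, on which `V` is finite. -/
def partialV {d : ℕ} (V : Stencil d → EReal) (κ : ℝ) {j : ℕ} (ρ : Fin j → LatStar d)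
    (g : Stencil d) : ContinuousMultilinearMap ℝ (fun _ : Fin j => Eu d) ℝ :=
  (iteratedFDerivWithin ℝ j (fun g => (V g).toReal) (stencilBall d κ) g).compContinuousLinearMap
    (fun i => Stencil.single (ρ i))

/-- `m(ρ) = ∏ |ρ_i| · sup_{g ∈ 𝒟_κ} ‖V_ρ(g)‖`. -/
def mBound {d : ℕ} (V : Stencil d → EReal) (κ : ℝ) {j : ℕ} (ρ : Fin j → LatStar d) : ℝ≥0∞ :=
  (∏ i, ‖dirVec (ρ i)‖ₑ) * ⨆ g ∈ stencilBall d κ, ‖partialV V κ ρ g‖ₑ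

/-- `|a × b|`: the area of the parallelogram spanned by `a` and `b`. -/
def crossNorm {d : ℕ} (a b : Eu d) : ℝ := √(‖a‖ ^ 2 * ‖b‖ ^ 2 - (inner ℝ a b) ^ 2)

/-- `m_d^{(p)}(ρ) = m(ρ) |ρ|³ / |ρ_1| · (∑_{i=2}^j (|ρ_1 × ρ_i| + |ρ_1| + |ρ_i|))^{1/((j-1)p)}`
for `ρ ∈ Λ_*^j`, `j = n + 2`, where `|ρ| = ∑ |ρ_i|` (for `p = ∞` the exponent is `0`). -/
def mDyn {d : ℕ} (V : Stencil d → EReal) (κ : ℝ) (p : ℝ≥0∞) {n : ℕ}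
    (ρ : Fin (n + 2) → LatStar d) : ℝ≥0∞ :=
  mBound V κ ρ * ENNReal.ofReal
    ((∑ i, ‖dirVec (ρ i)‖) ^ 3 / ‖dirVec (ρ 0)‖ *
      (∑ i : Fin (n + 1), (crossNorm (dirVec (ρ 0)) (dirVec (ρ i.succ)) + ‖dirVec (ρ 0)‖
          + ‖dirVec (ρ i.succ)‖)) ^ (((n + 1 : ℕ) : ℝ≥0∞) * p)⁻¹.toReal)

/-- The standing assumptions on the site energy `V : 𝒟 → ℝ ∪ {±∞}`. -/
structure IsSiteEnergy {d : ℕ} (κ : ℝ) (k : ℕ) (V : Stencil d → EReal) : Prop where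
  zero : V 0 = 0
  finite : ∀ g ∈ stencilBall d κ, V g ≠ ⊤ ∧ V g ≠ ⊥
  smooth : ContDiffOn ℝ k (fun g => (V g).toReal) (stencilBall d κ)
  /-- No contribution from infinity: `V` is continuous on `𝒟_κ` under entrywise convergence. -/
  entrywise : ∀ (g : Stencil d) (G : ℕ → Stencil d), g ∈ stencilBall d κ →
    (∀ n, G n ∈ stencilBall d κ) →
    (∀ ρ, Tendsto (fun n => (G n).entry ρ) atTop (𝓝 (g.entry ρ))) →
    Tendsto (fun n => V (G n)) atTop (𝓝 (V g))
  symm : ∀ g, V g.reflect = V g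
  /-- `M^{(j)} = ∑_ρ m(ρ) < ∞`. -/
  decay : ∀ j, 1 ≤ j → j ≤ k → ∑' ρ : Fin j → LatStar d, mBound V κ ρ < ⊤

/-! ### Sobolev spaces with exponent `∞` -/

section Sobolev

variable {d : ℕ} {F : Type*} [NormedAddCommGroup F] [NormedSpace ℝ F]

/-- `G` is the `j`-th weak derivative `∇^j u`, a field of `j`-linear maps, of `u`. -/
def HasWeakDeriv (j : ℕ) (u : Eu d → F)
    (G : Eu d → ContinuousMultilinearMap ℝ (fun _ : Fin j => Eu d) F) : Prop :=
  LocallyIntegrable u ∧ LocallyIntegrable G ∧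
    ∀ φ : Eu d → ℝ, ContDiff ℝ ∞ φ → HasCompactSupport φ → ∀ v : Fin j → Eu d,
      ∫ x, (iteratedFDeriv ℝ j φ x v) • u x = (-1 : ℝ) ^ j • ∫ x, φ x • G x v

open Classical in
/-- The weak derivative `∇^j u` (unique up to null sets; `0` if there is none). -/
def weakDeriv (j : ℕ) (u : Eu d → F) :
    Eu d → ContinuousMultilinearMap ℝ (fun _ : Fin j => Eu d) F :=
  if h : ∃ G, HasWeakDeriv j u G then h.choose else 0

/-- `u ∈ W^{k,∞}(ℝ^d; F)`. -/
def MemWInfty (k : ℕ) (u : Eu d → F) : Prop :=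
  ∀ j ≤ k, HasWeakDeriv j u (weakDeriv j u) ∧ MemLp (weakDeriv j u) ∞ volume

/-- `u ∈ W^{k,∞}_loc(ℝ^d; F)`. -/
def MemWInftyLoc (k : ℕ) (u : Eu d → F) : Prop :=
  ∀ j ≤ k, HasWeakDeriv j u (weakDeriv j u) ∧
    ∀ A : Set (Eu d), IsCompact A → MemLp (weakDeriv j u) ∞ (volume.restrict A)

/-- `‖∇^j u‖_{L^∞(A)}`. -/
def linftyDeriv (j : ℕ) (u : Eu d → F) (A : Set (Eu d)) : ℝ≥0∞ :=
  eLpNorm (weakDeriv j u) ∞ (volume.restrict A)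

end Sobolev

/-- The weak gradient `∇u(x)` as a linear map. -/
def weakGrad {d : ℕ} (u : Eu d → Eu d) (x : Eu d) : Eu d →L[ℝ] Eu d :=
  continuousMultilinearCurryFin1 ℝ (Eu d) (Eu d) (weakDeriv 1 u x)

/-- `u ∈ K`: `u ∈ W^{1,∞}` and `‖∇u‖_{L^∞} ≤ κ`. -/
def MemK {d : ℕ} (κ : ℝ) (u : Eu d → Eu d) : Prop :=
  MemWInfty 1 u ∧ eLpNorm (weakGrad u) ∞ volume ≤ ENNReal.ofReal κ

/-! ### The interpolation kernel and the stresses -/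

/-- The standing assumptions on the nodal basis function `ζ`. -/
structure IsNodalBasis {d : ℕ} (ζ : Eu d → ℝ) : Prop where
  continuous : Continuous ζ
  sobolev : MemWInfty 1 ζ
  nodal_zero : ζ 0 = 1
  nodal : ∀ ρ : LatStar d, ζ (dirVec ρ) = 0
  nonneg : ∀ x, 0 ≤ ζ x
  compact : HasCompactSupport ζ
  even : ∀ x, ζ (-x) = ζ x
  affine : ∀ (a : ℝ) (b x : Eu d),
    ∑' ξ : ZLat d, (a + inner ℝ b (latVec ξ)) * ζ (x - latVec ξ) = a + inner ℝ b x

/-- `χ_{ξ,ρ}(x) = ∫_0^1 ζ(ξ + tρ - x) dt`. -/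
def chi {d : ℕ} (ζ : Eu d → ℝ) (ξ : ZLat d) (ρ : LatStar d) (x : Eu d) : ℝ :=
  ∫ t in (0 : ℝ)..1, ζ (latVec ξ + t • dirVec ρ - x)

/-- The `i`-th component of `Φ_{ξ,ρ}(u) = V_ρ(Du(ξ)) ∈ ℝ^d`. -/
def phiDeriv {d : ℕ} (V : Stencil d → EReal) (κ : ℝ) (u : Eu d → Eu d) (ξ : ZLat d)
    (ρ : LatStar d) (i : Fin d) : ℝ :=
  partialV V κ (fun _ : Fin 1 => ρ) (diffStencil u ξ) (fun _ => EuclideanSpace.single i 1)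

/-- The atomistic stress `S^a(u; x) = ∑_ξ ∑_ρ [Φ_{ξ,ρ}(u) ⊗ ρ] χ_{ξ,ρ}(x)`. -/
def atomStress {d : ℕ} (ζ : Eu d → ℝ) (V : Stencil d → EReal) (κ : ℝ) (u : Eu d → Eu d)
    (x : Eu d) : Matrix (Fin d) (Fin d) ℝ :=
  fun i α => ∑' ξ : ZLat d, ∑' ρ : LatStar d, phiDeriv V κ u ξ ρ i * dirVec ρ α * chi ζ ξ ρ x

/-- The Cauchy--Born energy density `W(F) = V(F · Λ_*)`. -/
def cbEnergy {d : ℕ} (V : Stencil d → EReal) (F : Eu d →L[ℝ] Eu d) : EReal := V (homStencil F)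

/-- The Cauchy--Born stress `S^c_{iα}(u; x) = ∂W/∂F_{iα}` at `F = ∇u(x)`; the derivative of `W`
is taken within the ball `|F| ≤ κ`, on which `W` is finite. -/
def cbStress {d : ℕ} (V : Stencil d → EReal) (κ : ℝ) (u : Eu d → Eu d)
    (x : Eu d) : Matrix (Fin d) (Fin d) ℝ :=
  fun i α => fderivWithin ℝ (fun F => (cbEnergy V F).toReal) (Metric.closedBall 0 κ) (weakGrad u x)
    ((EuclideanSpace.proj α : Eu d →L[ℝ] ℝ).smulRight (EuclideanSpace.single i 1))

/-- `f = div S` in the weak sense, where `(div S)_i = ∑_α ∂_α S_{iα}`. -/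
def IsWeakDiv {d : ℕ} (S : Eu d → Matrix (Fin d) (Fin d) ℝ) (f : Eu d → Eu d) : Prop :=
  (∀ i α, LocallyIntegrable (fun x => S x i α)) ∧ LocallyIntegrable f ∧
    ∀ φ : Eu d → ℝ, ContDiff ℝ ∞ φ → HasCompactSupport φ → ∀ i : Fin d,
      ∫ x, ∑ α, S x i α * fderiv ℝ φ x (EuclideanSpace.single α 1) = -∫ x, f x i * φ x

/-- `ν_{ρς}`: the closed `2c`-neighbourhood of the parallelogram `conv{±2ρ ± ς}`. -/
def nuSet {d : ℕ} (c : ℝ) (ρ σ : LatStar d) : Set (Eu d) :=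
  Metric.cthickening (2 * c) (convexHull ℝ
    {(2 : ℝ) • dirVec ρ + dirVec σ, (2 : ℝ) • dirVec ρ - dirVec σ,
      -(2 : ℝ) • dirVec ρ + dirVec σ, -(2 : ℝ) • dirVec ρ - dirVec σ})

end

/-!
Fix `x`, write `v = e_i`, `F = ∇u(x)`, and let all derivatives of `V` be taken at the homogeneous
stencil `(F ρ)_ρ`.

*Regularity.* A function in `W^{4,∞}_loc` has a `C^3` representative whose third derivative is
locally Lipschitz, with the Lipschitz constant on a convex set controlled by `‖∇⁴u‖_{L^∞}`; this is
`MemWInftyLoc.contDiff`, by mollification. The bound on `V_ρ` and the continuity of `V` under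
entrywise convergence allow a Taylor expansion of `V_ρ` about a stencil whose terms are sums over
bonds of partial derivatives (`IsSiteEnergy.abs_taylor_two_le`): it holds for stencils with finitely
many nonzero entries, and passes to the limit.

*The divergences.* Integrating along the bond `ρ` turns `ρ · ∇χ_{ξ,ρ}` into a difference of nodal
functions, so that `div S^a(x)` is the sum over `ρ` of the weighted means over `ξ`, with weights
`ζ(ξ - x)`, of `V_ρ(Du(ξ)) - V_ρ(Du(ξ - ρ))` (`isWeakDiv_latticeStress`). By the chain rule,
`div S^c(x)` is `∑_{ρ,ς} V_{ρς} ∇²u(x)[ρ, ς]` (`MemWInftyLoc.cbDiv_eq_tsum`).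

*Comparison.* Expand `V_ρ(Du(ξ))` and `V_ρ(Du(ξ - ρ))` to second order about `(F ρ)_ρ`.
The remainder is of third order in the deviations of the finite differences from `F ς`, each of
which is bounded by `∇²u`.
In the first-order term the mean of the second differences of `u` is `∇²u(x)[ρ, ς]`, the value
appearing in `div S^c`, plus a third derivative, plus an error bounded by `∇⁴u`. Since the nodal
weights have vanishing first moment, the third derivative is `½ ∇³u(x)[ς - ρ, ρ, ς]`, which is odd
under `(ρ, ς) ↦ (-ρ, -ς)`, whereas the second derivatives of `V` are even by point symmetry; the
two contributions of opposite bonds cancel (`MemWInftyLoc.enorm_tsum_first_le`).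
In the second-order term each finite difference is replaced by a second derivative of `u`, with an
error bounded by `∇³u`. What is left is a quadratic polynomial in `ξ - x`; the third derivatives of
`V` are odd, and pairing opposite bonds leaves a linear function of `ξ - x`, whose mean vanishes
(`quadratic_symm_diff`, `MemWInftyLoc.enorm_tsum_second_le`).
All points entering these expansions lie in `x + ν_{ρς}`, and the powers of the bond lengths that
arise are absorbed by the factor `|ρ|³ / |ρ_1|` of the weights.
-/

noncomputable section

-- The norms on nested spaces of continuous linear maps, such as the values of third derivatives,
-- need a deeper instance search than the default.
set_option maxSynthPendingDepth 3

/-! ### Weak gradients and mollification -/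

section WeakGradient

variable {d : ℕ} {F : Type*} [NormedAddCommGroup F] [NormedSpace ℝ F]

/-- The field of linear maps `g` is the weak gradient of `f`. -/
structure HasWeakGrad (f : Eu d → F) (g : Eu d → Eu d →L[ℝ] F) : Prop where
  locInt : LocallyIntegrable f
  locInt_grad : LocallyIntegrable g
  parts : ∀ φ : Eu d → ℝ, ContDiff ℝ ∞ φ → HasCompactSupport φ → ∀ w : Eu d,
    ∫ x, fderiv ℝ φ x w • f x = -∫ x, φ x • g x w

/-- A mollifier supported in the ball of radius `2 / (n + 1)`. -/
def mollBump (d n : ℕ) : ContDiffBump (0 : Eu d) where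
  rIn := 1 / (n + 1)
  rOut := 2 / (n + 1)
  rIn_pos := by positivity
  rIn_lt_rOut := by gcongr; norm_num

/-- The mollification of `f` at the scale `2 / (n + 1)`. -/
def mollify (n : ℕ) (f : Eu d → F) : Eu d → F :=
  convolution ((mollBump d n).normed volume) f (ContinuousLinearMap.lsmul ℝ ℝ) volume

theorem tendsto_mollBump_rOut : Tendsto (fun n => (mollBump d n).rOut) atTop (𝓝 0) := by
  have h := (tendsto_one_div_add_atTop_nhds_zero_nat (𝕜 := ℝ)).const_mul 2
  simpa [mollBump, div_eq_mul_inv] using h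

theorem mollify_tendsto [CompleteSpace F] {f : Eu d → F} (hf : Continuous f) (x : Eu d) :
    Tendsto (fun n => mollify n f x) atTop (𝓝 (f x)) :=
  ContDiffBump.convolution_tendsto_right_of_continuous tendsto_mollBump_rOut hf x

theorem ae_mollify_tendsto [CompleteSpace F] {f : Eu d → F} (hf : LocallyIntegrable f) :
    ∀ᵐ x, Tendsto (fun n => mollify n f x) atTop (𝓝 (f x)) :=
  ContDiffBump.ae_convolution_tendsto_right_of_locallyIntegrable (K := 2) tendsto_mollBump_rOut
    (Eventually.of_forall fun n => by simp [mollBump]; ring_nf; rfl) hf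

/-- The gradient of a mollification is an average of the weak gradient over a small ball. -/
theorem HasWeakGrad.exists_hasFDerivAt_mollify [CompleteSpace F]
    {f : Eu d → F} {g : Eu d → Eu d →L[ℝ] F}
    (h : HasWeakGrad f g) (n : ℕ) (x : Eu d) {K : ℝ} (hK : 0 ≤ K)
    (hg : ∀ᵐ y, y ∈ Metric.ball x (mollBump d n).rOut → ‖g y‖ ≤ K) :
    ∃ L : Eu d →L[ℝ] F, HasFDerivAt (mollify n f) L x ∧ ‖L‖ ≤ K := by
  set ρ : Eu d → ℝ := (mollBump d n).normed volume with hρ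
  have hρs : ContDiff ℝ ∞ ρ := (mollBump d n).contDiff_normed
  have hρc : HasCompactSupport ρ := (mollBump d n).hasCompactSupport_normed
  have hcont : Continuous (fderiv ℝ ρ) := hρs.continuous_fderiv (by simp)
  refine ⟨_, hρc.hasFDerivAt_convolution_left (ContinuousLinearMap.lsmul ℝ ℝ)
    (hρs.of_le (by exact_mod_cast le_top)) h.locInt x, ?_⟩
  refine ContinuousLinearMap.opNorm_le_bound _ hK fun w => ?_
  have hψs : ContDiff ℝ ∞ (fun y => ρ (x - y)) := hρs.comp (contDiff_const.sub contDiff_id)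
  have hψc : HasCompactSupport (fun y => ρ (x - y)) :=
    hρc.comp_homeomorph (Homeomorph.subLeft x)
  have hψd : ∀ y, fderiv ℝ (fun y => ρ (x - y)) y w = - fderiv ℝ ρ (x - y) w := by
    intro y
    have h1 : HasFDerivAt (fun y => ρ (x - y)) ((fderiv ℝ ρ (x - y)).comp
        (-(ContinuousLinearMap.id ℝ (Eu d)))) y :=
      ((hρs.differentiable (by simp)) (x - y)).hasFDerivAt.comp y
        ((hasFDerivAt_id y).const_sub x)
    rw [h1.fderiv]; simp
  have e1 : (convolution (fderiv ℝ ρ) f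
      (ContinuousLinearMap.precompL (Eu d) (ContinuousLinearMap.lsmul ℝ ℝ)) volume x) w
      = ∫ y, ρ (x - y) • g y w := by
    rw [convolution_def, ContinuousLinearMap.integral_apply]
    · have h2 := integral_sub_left_eq_self (fun t => fderiv ℝ ρ t w • f (x - t)) volume x
      simp only [sub_sub_cancel] at h2
      have h3 := h.parts _ hψs hψc w
      simp only [hψd, neg_smul, integral_neg, neg_inj] at h3
      rw [← h3, h2]
      rfl
    · have := (hρc.fderiv (𝕜 := ℝ)).convolutionExists_left
        (ContinuousLinearMap.precompL (Eu d) (ContinuousLinearMap.lsmul ℝ ℝ)) hcont h.locInt x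
      exact this
  rw [e1]
  have hint : ∫ y, ρ (x - y) = 1 := by
    rw [integral_sub_left_eq_self ρ volume x]
    exact (mollBump d n).integral_normed
  have hsupp : ∀ y, y ∉ Metric.ball x (mollBump d n).rOut → ρ (x - y) = 0 := by
    intro y hy
    by_contra h0
    have : x - y ∈ Function.support ρ := h0
    rw [hρ, (mollBump d n).support_normed_eq] at this
    apply hy
    simpa [dist_eq_norm, norm_sub_rev] using this
  have hi : Integrable (fun y => ρ (x - y)) :=
    hψs.continuous.integrable_of_hasCompactSupport hψc
  calc ‖∫ y, ρ (x - y) • g y w‖ ≤ ∫ y, ρ (x - y) * (K * ‖w‖) := by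
        refine norm_integral_le_of_norm_le (hi.mul_const _) ?_
        filter_upwards [hg] with y hy
        have h0 : 0 ≤ ρ (x - y) := (mollBump d n).nonneg_normed _
        rw [norm_smul, Real.norm_of_nonneg h0]
        by_cases hyb : y ∈ Metric.ball x (mollBump d n).rOut
        · gcongr
          exact ((g y).le_opNorm w).trans (by gcongr; exact hy hyb)
        · rw [hsupp y hyb]; simp
    _ = K * ‖w‖ := by rw [integral_mul_const, hint, one_mul]

/-- Around a compact convex subset of an open set, the mollifications are Lipschitz with the
essential bound of the weak gradient as their constant. -/
theorem HasWeakGrad.mollify_lipschitz [CompleteSpace F]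
    {f : Eu d → F} {g : Eu d → Eu d →L[ℝ] F}
    (h : HasWeakGrad f g) {U A : Set (Eu d)} {K : ℝ} (hK : 0 ≤ K) (hU : IsOpen U)
    (hg : ∀ᵐ y, y ∈ U → ‖g y‖ ≤ K) (hA : IsCompact A) (hAc : Convex ℝ A) (hAU : A ⊆ U) :
    ∀ᶠ n in atTop, ∀ x ∈ A, ∀ y ∈ A, ‖mollify n f y - mollify n f x‖ ≤ K * ‖y - x‖ := by
  obtain ⟨δ, hδ, hδU⟩ := hA.exists_thickening_subset_open hU hAU
  filter_upwards [tendsto_mollBump_rOut.eventually_lt_const hδ] with n hn x hx y hy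
  have hz : ∀ z ∈ A, ∃ L : Eu d →L[ℝ] F, HasFDerivAt (mollify n f) L z ∧ ‖L‖ ≤ K := by
    intro z hz
    refine h.exists_hasFDerivAt_mollify n z hK ?_
    filter_upwards [hg] with y hy hyz
    refine hy (hδU (Metric.mem_thickening_iff.2 ⟨z, hz, ?_⟩))
    exact (Metric.mem_ball.1 hyz).trans hn
  choose! L hL1 hL2 using hz
  exact hAc.norm_image_sub_le_of_norm_hasFDerivWithin_le
    (fun z hz => (hL1 z hz).hasFDerivWithinAt) hL2 hx hy

/-- The Lipschitz bound for a continuous function itself, by passing to the limit in its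
mollifications along a segment. -/
theorem HasWeakGrad.lipschitz_of_continuous [CompleteSpace F]
    {f : Eu d → F} {g : Eu d → Eu d →L[ℝ] F}
    (h : HasWeakGrad f g) (hf : Continuous f) {U : Set (Eu d)} {K : ℝ} (hK : 0 ≤ K)
    (hU : IsOpen U) (hUc : Convex ℝ U) (hg : ∀ᵐ y, y ∈ U → ‖g y‖ ≤ K)
    {x y : Eu d} (hx : x ∈ U) (hy : y ∈ U) : ‖f y - f x‖ ≤ K * ‖y - x‖ := by
  have hA : IsCompact (segment ℝ x y) := by
    rw [segment_eq_image_lineMap]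
    exact isCompact_Icc.image AffineMap.lineMap_continuous
  have hev := h.mollify_lipschitz hK hU hg hA (convex_segment x y) (hUc.segment_subset hx hy)
  refine le_of_tendsto ((mollify_tendsto hf y).sub (mollify_tendsto hf x)).norm ?_
  filter_upwards [hev] with n hn
  exact hn x (left_mem_segment ℝ x y) y (right_mem_segment ℝ x y)

/-- A function with locally bounded weak gradient has a continuous representative: its
mollifications are equi-Lipschitz on each ball and converge on a dense set, hence everywhere. -/
theorem HasWeakGrad.exists_continuous [CompleteSpace F]
    {f : Eu d → F} {g : Eu d → Eu d →L[ℝ] F} (h : HasWeakGrad f g)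
    (hg : ∀ r : ℝ, ∃ K : ℝ, 0 ≤ K ∧ ∀ᵐ y, y ∈ Metric.ball (0 : Eu d) r → ‖g y‖ ≤ K) :
    ∃ f' : Eu d → F, Continuous f' ∧ f =ᵐ[volume] f' := by
  have hdense : Dense {x | Tendsto (fun n => mollify n f x) atTop (𝓝 (f x))} :=
    Measure.dense_of_ae (ae_mollify_tendsto h.locInt)
  have hlip : ∀ r : ℝ, ∃ K : ℝ, 0 ≤ K ∧ ∀ᶠ n in atTop, ∀ x ∈ Metric.closedBall (0 : Eu d) r,
      ∀ y ∈ Metric.closedBall (0 : Eu d) r, ‖mollify n f y - mollify n f x‖ ≤ K * ‖y - x‖ := by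
    intro r
    obtain ⟨K, hK, hgK⟩ := hg (r + 1)
    exact ⟨K, hK, h.mollify_lipschitz hK Metric.isOpen_ball hgK (isCompact_closedBall _ _)
      (convex_closedBall _ _) (Metric.closedBall_subset_ball (by linarith))⟩
  have hconv : ∀ x, ∃ z, Tendsto (fun n => mollify n f x) atTop (𝓝 z) := by
    intro x
    apply cauchySeq_tendsto_of_complete
    rw [Metric.cauchySeq_iff']
    intro ε hε
    obtain ⟨K, hK, hev⟩ := hlip (‖x‖ + 1)
    obtain ⟨z, hz, hzx⟩ := hdense.exists_dist_lt x
      (ε := min 1 (ε / (4 * (K + 1)))) (by positivity)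
    have hzc := (Metric.tendsto_atTop.1 hz) (ε / 4) (by positivity)
    obtain ⟨N1, hN1⟩ := hzc
    obtain ⟨N2, hN2⟩ := eventually_atTop.1 hev
    have hxz : ‖x - z‖ ≤ ε / (4 * (K + 1)) := by
      rw [← dist_eq_norm]; exact (hzx.le).trans (min_le_right _ _)
    have hxz1 : ‖x - z‖ ≤ 1 := by
      rw [← dist_eq_norm]; exact (hzx.le).trans (min_le_left _ _)
    have hxm : x ∈ Metric.closedBall (0 : Eu d) (‖x‖ + 1) := by simp
    have hzm : z ∈ Metric.closedBall (0 : Eu d) (‖x‖ + 1) := by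
      have := norm_sub_le x (x - z)
      simp only [sub_sub_cancel] at this
      simpa using this.trans (by linarith)
    have key : ∀ n, N1 ⊔ N2 ≤ n → dist (mollify n f x) (f z) < ε / 2 := by
      intro n hn
      have h1 := hN2 n (le_trans le_sup_right hn) z hzm x hxm
      have h2 := hN1 n (le_trans le_sup_left hn)
      have h3 : K * ‖x - z‖ ≤ ε / 4 := by
        calc K * ‖x - z‖ ≤ (K + 1) * (ε / (4 * (K + 1))) := by gcongr; linarith
          _ = ε / 4 := by field_simp
      have h4 := dist_triangle (mollify n f x) (mollify n f z) (f z)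
      rw [dist_eq_norm (mollify n f x) (mollify n f z)] at h4
      linarith
    refine ⟨N1 ⊔ N2, fun n hn => ?_⟩
    have h1 := key n hn
    have h2 := key _ le_rfl
    have h4 := dist_triangle_right (mollify n f x) (mollify (N1 ⊔ N2) f x) (f z)
    linarith
  choose f' hf' using hconv
  refine ⟨f', ?_, ?_⟩
  · have hl : ∀ r, ∃ K : ℝ≥0, LipschitzOnWith K f' (Metric.closedBall (0 : Eu d) r) := by
      intro r
      obtain ⟨K, hK, hev⟩ := hlip r
      refine ⟨⟨K, hK⟩, LipschitzOnWith.of_dist_le_mul fun x hx y hy => ?_⟩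
      rw [dist_eq_norm, dist_eq_norm]
      refine le_of_tendsto ((hf' x).sub (hf' y)).norm ?_
      filter_upwards [hev] with n hn
      exact hn y hy x hx
    refine continuous_iff_continuousAt.2 fun x => ?_
    obtain ⟨K, hK⟩ := hl (‖x‖ + 1)
    refine hK.continuousOn.continuousAt ?_
    refine mem_of_superset (Metric.ball_mem_nhds x one_pos) fun y hy => ?_
    rw [Metric.mem_ball, dist_eq_norm] at hy
    have := norm_le_norm_add_norm_sub' y x
    simp only [Metric.mem_closedBall, dist_zero_right]
    linarith
  · filter_upwards [ae_mollify_tendsto h.locInt] with x hx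
    exact tendsto_nhds_unique hx (hf' x)

theorem HasWeakGrad.congr {f f' : Eu d → F} {g g' : Eu d → Eu d →L[ℝ] F} (h : HasWeakGrad f g)
    (hf : f =ᵐ[volume] f') (hg : g =ᵐ[volume] g') : HasWeakGrad f' g' where
  locInt := h.locInt.congr hf
  locInt_grad := h.locInt_grad.congr hg
  parts φ h1 h2 w := by
    have e1 : ∫ x, fderiv ℝ φ x w • f' x = ∫ x, fderiv ℝ φ x w • f x :=
      integral_congr_ae (by filter_upwards [hf] with x hx; rw [hx])
    have e2 : ∫ x, φ x • g' x w = ∫ x, φ x • g x w :=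
      integral_congr_ae (by filter_upwards [hg] with x hx; rw [hx])
    rw [e1, e2]; exact h.parts φ h1 h2 w

/-- A continuous function with continuous weak gradient is classically differentiable: subtract
the affine approximation, and use the Lipschitz bound on a small ball. -/
theorem HasWeakGrad.hasFDerivAt [CompleteSpace F] {f : Eu d → F} {g : Eu d → Eu d →L[ℝ] F}
    (h : HasWeakGrad f g) (hf : Continuous f) (hg : Continuous g) (x : Eu d) :
    HasFDerivAt f (g x) x := by
  have hw : HasWeakGrad (fun y => f y - g x y) (fun y => g y - g x) := by
    refine ⟨(hf.sub (g x).continuous).locallyIntegrable,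
      (hg.sub continuous_const).locallyIntegrable, fun φ h1 h2 w => ?_⟩
    have hd : Continuous (fun y => fderiv ℝ φ y w) :=
      (h1.continuous_fderiv (by simp)).clm_apply continuous_const
    have hdc : HasCompactSupport (fun y => fderiv ℝ φ y w) := h2.fderiv_apply ℝ w
    have i1 : Integrable (fun y => fderiv ℝ φ y w • f y) :=
      (hd.smul hf).integrable_of_hasCompactSupport hdc.smul_right
    have i2 : Integrable (fun y => fderiv ℝ φ y w • g x y) :=
      (hd.smul (g x).continuous).integrable_of_hasCompactSupport hdc.smul_right
    have i3 : Integrable (fun y => φ y • g y w) :=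
      (h1.continuous.smul (hg.clm_apply continuous_const)).integrable_of_hasCompactSupport
        h2.smul_right
    have i4 : Integrable (fun y => φ y • g x w) :=
      (h1.continuous.smul continuous_const).integrable_of_hasCompactSupport h2.smul_right
    have i5 : Integrable (fun y => φ y • g x y) :=
      (h1.continuous.smul (g x).continuous).integrable_of_hasCompactSupport h2.smul_right
    have hp := integral_smul_fderiv_eq_neg_fderiv_smul_of_integrable (μ := volume) (f := φ)
      (g := g x) (v := w) i2 (by simpa using i4) i5
      (fun _ _ => (h1.differentiable (by simp)) _) (fun _ _ => (g x).differentiableAt)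
    simp only [ContinuousLinearMap.fderiv] at hp
    simp only [smul_sub, sub_apply]
    rw [integral_sub i1 i2, integral_sub i3 i4, h.parts φ h1 h2 w, hp]
    abel
  rw [hasFDerivAt_iff_isLittleO, Asymptotics.isLittleO_iff]
  intro ε hε
  obtain ⟨δ, hδ, hδg⟩ := Metric.continuousAt_iff.1 hg.continuousAt ε hε
  filter_upwards [Metric.ball_mem_nhds x hδ] with y hy
  have := hw.lipschitz_of_continuous (hf.sub (g x).continuous) hε.le Metric.isOpen_ball
    (convex_ball x δ) (Eventually.of_forall fun z hz => by
      have := (hδg hz).le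
      rwa [dist_eq_norm] at this) (Metric.mem_ball_self hδ) hy
  calc ‖f y - f x - g x (y - x)‖ = ‖f y - g x y - (f x - g x x)‖ := by
        congr 1; rw [map_sub]; abel
    _ ≤ _ := this

end WeakGradient

/-! ### Symmetry of iterated derivatives -/

section Symmetry

variable {E F : Type*} [NormedAddCommGroup E] [NormedSpace ℝ E] [NormedAddCommGroup F]
  [NormedSpace ℝ F] {f : E → F} {s : Set E}

/-- Evaluating at fixed vectors commutes with differentiating a field of multilinear maps. -/
theorem iteratedFDerivWithin_succ_apply_cons {n : ℕ} {x : E} (hs : UniqueDiffOn ℝ s) (hx : x ∈ s)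
    (hd : DifferentiableWithinAt ℝ (iteratedFDerivWithin ℝ n f s) s x) (a : E) (w : Fin n → E) :
    iteratedFDerivWithin ℝ (n + 1) f s x (Fin.cons a w)
      = fderivWithin ℝ (fun y => iteratedFDerivWithin ℝ n f s y w) s x a := by
  rw [iteratedFDerivWithin_succ_apply_left]
  simp only [Fin.cons_zero, Fin.tail_cons]
  have h := ((ContinuousMultilinearMap.apply ℝ (fun _ : Fin n => E) F
    w).hasFDerivAt.comp_hasFDerivWithinAt x hd.hasFDerivWithinAt).fderivWithin (hs x hx)
  change _ = (fderivWithin ℝ ((ContinuousMultilinearMap.apply ℝ (fun _ : Fin n => E) F w) ∘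
    iteratedFDerivWithin ℝ n f s) s x) a
  rw [h]
  rfl

/-- An identity between values of the `n`-th derivative may be differentiated once more. Together
with `iteratedFDerivWithin_swap` this produces all the permutations of the arguments needed. -/
theorem iteratedFDerivWithin_cons_congr {n : ℕ} {N : ℕ∞ω} (hf : ContDiffOn ℝ N f s)
    (hN : ((n + 1 : ℕ) : ℕ∞ω) ≤ N) (hs : UniqueDiffOn ℝ s) {w w' : Fin n → E}
    (hw : ∀ y ∈ s, iteratedFDerivWithin ℝ n f s y w = iteratedFDerivWithin ℝ n f s y w')
    {x : E} (hx : x ∈ s) (a : E) :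
    iteratedFDerivWithin ℝ (n + 1) f s x (Fin.cons a w)
      = iteratedFDerivWithin ℝ (n + 1) f s x (Fin.cons a w') := by
  have hlt : (n : ℕ∞ω) < N := lt_of_lt_of_le (by exact_mod_cast Nat.lt_succ_self n) hN
  have hd := hf.differentiableOn_iteratedFDerivWithin hlt hs x hx
  rw [iteratedFDerivWithin_succ_apply_cons hs hx hd, iteratedFDerivWithin_succ_apply_cons hs hx hd,
    fderivWithin_congr hw (hw x hx)]

/-- The first two arguments of an iterated derivative may be exchanged. On a convex set with
nonempty interior this holds up to the boundary. -/
theorem iteratedFDerivWithin_swap {n : ℕ} {N : ℕ∞ω} (hf : ContDiffOn ℝ N f s)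
    (hN : ((n + 2 : ℕ) : ℕ∞ω) ≤ N) (hc : Convex ℝ s) (hi : (interior s).Nonempty)
    {x : E} (hx : x ∈ s) (a b : E) (w : Fin n → E) :
    iteratedFDerivWithin ℝ (n + 2) f s x (Fin.cons a (Fin.cons b w))
      = iteratedFDerivWithin ℝ (n + 2) f s x (Fin.cons b (Fin.cons a w)) := by
  have hs : UniqueDiffOn ℝ s := uniqueDiffOn_convex hc hi
  have hlt : ((n + 1 : ℕ) : ℕ∞ω) < N :=
    lt_of_lt_of_le (by exact_mod_cast Nat.lt_succ_self (n + 1)) hN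
  have hd : ∀ y ∈ s, DifferentiableWithinAt ℝ (iteratedFDerivWithin ℝ (n + 1) f s) s y :=
    fun y hy => hf.differentiableOn_iteratedFDerivWithin hlt hs y hy
  have hg : ContDiffWithinAt ℝ 2 (iteratedFDerivWithin ℝ n f s) s x :=
    (hf x hx).iteratedFDerivWithin_right hs (by
      refine le_trans (le_of_eq ?_) hN
      push_cast; rw [add_comm]) hx
  have hsym : IsSymmSndFDerivWithinAt ℝ (iteratedFDerivWithin ℝ n f s) s x :=
    hg.isSymmSndFDerivWithinAt (by simp) hs
      (by rw [hc.closure_interior_eq_closure_of_nonempty_interior hi]; exact subset_closure hx) hx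
  have hg' : DifferentiableWithinAt ℝ (fderivWithin ℝ (iteratedFDerivWithin ℝ n f s) s) s x :=
    (hg.fderivWithin_right (m := 1) hs (by norm_num) hx).differentiableWithinAt (by simp)
  have key : ∀ a b : E, iteratedFDerivWithin ℝ (n + 2) f s x (Fin.cons a (Fin.cons b w))
      = (fderivWithin ℝ (fderivWithin ℝ (iteratedFDerivWithin ℝ n f s) s) s x a) b w := by
    intro a b
    rw [iteratedFDerivWithin_succ_apply_cons hs hx (hd x hx)]
    have e : (fun y => iteratedFDerivWithin ℝ (n + 1) f s y (Fin.cons b w))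
        = fun y => (fderivWithin ℝ (iteratedFDerivWithin ℝ n f s) s y) b w := by
      funext y
      rw [iteratedFDerivWithin_succ_apply_left]; simp
    rw [e]
    let B : (E →L[ℝ] ContinuousMultilinearMap ℝ (fun _ : Fin n => E) F) →L[ℝ] F :=
      (ContinuousMultilinearMap.apply ℝ (fun _ : Fin n => E) F w).comp
        (ContinuousLinearMap.apply ℝ _ b)
    have h := (B.hasFDerivAt.comp_hasFDerivWithinAt
      x hg'.hasFDerivWithinAt).fderivWithin (hs x hx)
    exact congrArg (fun L => L a) h
  rw [key, key, hsym]

/-- Differentiating first in a fixed direction agrees with filling the first slot. The new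
derivative enters at the innermost place, whence the use of symmetry. -/
theorem iteratedFDeriv_fderiv_apply {f : E → F} (hf : ContDiff ℝ ∞ f) (w : E) :
    ∀ {n : ℕ} (x : E) (v : Fin n → E),
      iteratedFDeriv ℝ n (fun y => fderiv ℝ f y w) x v
        = iteratedFDeriv ℝ (n + 1) f x (Fin.cons w v)
  | 0, x, v => by
    rw [iteratedFDeriv_succ_apply_left, iteratedFDeriv_zero_apply]
    have : iteratedFDeriv ℝ 0 f = (continuousMultilinearCurryFin0 ℝ E F).symm ∘ f :=
      iteratedFDeriv_zero_eq_comp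
    rw [this, LinearIsometryEquiv.comp_fderiv]
    simp
  | n + 1, x, v => by
    have hg : ContDiff ℝ ∞ (fun y => fderiv ℝ f y w) :=
      (hf.fderiv_right (m := ∞) (by simp)).clm_apply contDiff_const
    have hsw := iteratedFDerivWithin_swap (f := f) (s := univ) (n := n) (N := ∞) hf.contDiffOn
      (WithTop.coe_le_coe.2 (le_top : ((n + 2 : ℕ) : ℕ∞) ≤ ⊤)) convex_univ
      (by simp) (mem_univ x) (v 0) w (Fin.tail v)
    have hcons := fun (g : E → F) (m : ℕ) (hg : ContDiff ℝ ∞ g) (a : E) (u : Fin m → E) =>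
      iteratedFDerivWithin_succ_apply_cons (f := g) (s := univ) (n := m) uniqueDiffOn_univ
        (mem_univ x) (hg.contDiffOn.differentiableOn_iteratedFDerivWithin
          (by exact_mod_cast ENat.natCast_lt_top m) uniqueDiffOn_univ x (mem_univ x)) a u
    simp only [iteratedFDerivWithin_univ, fderivWithin_univ] at hsw hcons
    conv_lhs => rw [← Fin.cons_self_tail v]
    conv_rhs => rw [← Fin.cons_self_tail v]
    rw [hcons _ _ hg, ← hsw, hcons _ _ hf]
    congr 2
    funext y
    exact iteratedFDeriv_fderiv_apply hf w y (Fin.tail v)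

end Symmetry

/-! ### Functions in `W^{k,∞}_loc` -/

section Regularity

variable {d : ℕ} {F : Type*} [NormedAddCommGroup F] [NormedSpace ℝ F]

/-- Each weak derivative is the weak gradient of the preceding one: test the defining identity of
`∇^j u` with `∂_w φ`. -/
theorem HasWeakDeriv.hasWeakGrad [CompleteSpace F] {j : ℕ} {u : Eu d → F}
    {G : Eu d → ContinuousMultilinearMap ℝ (fun _ : Fin j => Eu d) F}
    {G' : Eu d → ContinuousMultilinearMap ℝ (fun _ : Fin (j + 1) => Eu d) F}
    (h : HasWeakDeriv j u G) (h' : HasWeakDeriv (j + 1) u G') :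
    HasWeakGrad G (fun x => (G' x).curryLeft) := by
  obtain ⟨hu, hG, hp⟩ := h
  obtain ⟨-, hG', hp'⟩ := h'
  have hcur : LocallyIntegrable (fun x => (G' x).curryLeft) := by
    intro x
    obtain ⟨s, hs, hsi⟩ := hG' x
    exact ⟨s, hs, (continuousMultilinearCurryLeftEquiv ℝ (fun _ : Fin (j + 1) => Eu d) F
      ).toContinuousLinearEquiv.toContinuousLinearMap.integrable_comp hsi⟩
  refine ⟨hG, hcur, fun φ h1 h2 w => ?_⟩
  have hd : ContDiff ℝ ∞ (fun y => fderiv ℝ φ y w) :=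
    (h1.fderiv_right (m := ∞) (by simp)).clm_apply contDiff_const
  have hdc : HasCompactSupport (fun y => fderiv ℝ φ y w) := h2.fderiv_apply ℝ w
  have i1 : Integrable (fun x => fderiv ℝ φ x w • G x) :=
    hG.integrable_smul_left_of_hasCompactSupport hd.continuous hdc
  have i2 : Integrable (fun x => φ x • (G' x).curryLeft w) := by
    have := hcur.integrable_smul_left_of_hasCompactSupport h1.continuous h2
    exact (ContinuousLinearMap.apply ℝ _ w).integrable_comp this
  ext v
  have e1 := (ContinuousMultilinearMap.apply ℝ (fun _ : Fin j => Eu d) F v).integral_comp_comm i1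
  have e2 := (ContinuousMultilinearMap.apply ℝ (fun _ : Fin j => Eu d) F v).integral_comp_comm i2
  simp only [ContinuousMultilinearMap.apply_apply, smul_apply,
    ContinuousMultilinearMap.curryLeft_apply] at e1 e2
  rw [neg_apply, ← e1, ← e2]
  have a1 := hp _ hd hdc v
  have a2 := hp' φ h1 h2 (Fin.cons w v)
  simp only [iteratedFDeriv_fderiv_apply h1 w] at a1
  rw [a1, pow_succ, mul_neg_one, neg_smul, ← smul_neg] at a2
  exact (smul_right_injective F (pow_ne_zero j (by norm_num : (-1 : ℝ) ≠ 0))) a2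

theorem ae_norm_le_linftyDeriv {j : ℕ} {u : Eu d → F} {A U : Set (Eu d)} (hU : MeasurableSet U)
    (hUA : U ⊆ A) (hA : linftyDeriv j u A ≠ ⊤) :
    ∀ᵐ y, y ∈ U → ‖weakDeriv j u y‖ ≤ (linftyDeriv j u A).toReal := by
  have h1 : ∀ᵐ y ∂(volume.restrict A), ‖weakDeriv j u y‖ₑ ≤ linftyDeriv j u A := by
    rw [linftyDeriv, eLpNorm_exponent_top]
    exact enorm_ae_le_eLpNormEssSup _ _
  have h2 := (ae_restrict_iff' hU).1 (ae_restrict_of_ae_restrict_of_subset hUA h1)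
  filter_upwards [h2] with y hy hyU
  have := hy hyU
  rw [← toReal_enorm]
  exact ENNReal.toReal_mono hA this

theorem MemWInftyLoc.linftyDeriv_ne_top {k j : ℕ} {u : Eu d → F} (hu : MemWInftyLoc k u)
    (hj : j ≤ k) {A : Set (Eu d)} (hA : IsCompact A) : linftyDeriv j u A ≠ ⊤ :=
  ((hu j hj).2 A hA).2.ne

theorem MemWInftyLoc.exists_bound {k j : ℕ} {u : Eu d → F} (hu : MemWInftyLoc k u)
    (hj : j ≤ k) (r : ℝ) :
    ∃ K : ℝ, 0 ≤ K ∧ ∀ᵐ y, y ∈ Metric.ball (0 : Eu d) r → ‖weakDeriv j u y‖ ≤ K :=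
  ⟨_, ENNReal.toReal_nonneg, ae_norm_le_linftyDeriv Metric.isOpen_ball.measurableSet
    Metric.ball_subset_closedBall (hu.linftyDeriv_ne_top hj (isCompact_closedBall _ _))⟩

/-- The zeroth weak derivative is the function itself. -/
theorem HasWeakDeriv.zero_ae [CompleteSpace F] {u : Eu d → F}
    {G : Eu d → ContinuousMultilinearMap ℝ (fun _ : Fin 0 => Eu d) F} (h : HasWeakDeriv 0 u G) :
    (fun x => G x 0) =ᵐ[volume] u := by
  obtain ⟨hu, hG, hp⟩ := h
  have hG0 : LocallyIntegrable (fun x => G x 0) := by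
    intro x
    obtain ⟨s, hs, hsi⟩ := hG x
    exact ⟨s, hs,
      (ContinuousMultilinearMap.apply ℝ (fun _ : Fin 0 => Eu d) F 0).integrable_comp hsi⟩
  refine ae_eq_of_integral_contDiff_smul_eq hG0 hu fun g hg hgc => ?_
  have := hp g hg hgc 0
  simp only [iteratedFDeriv_zero_apply, pow_zero, one_smul] at this
  exact this.symm

theorem curryLeft_ae {j : ℕ}
    {G G' : Eu d → ContinuousMultilinearMap ℝ (fun _ : Fin (j + 1) => Eu d) F}
    (h : G =ᵐ[volume] G') :
    (fun x => (G x).curryLeft) =ᵐ[volume] fun x => (G' x).curryLeft := by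
  filter_upwards [h] with x hx; rw [hx]

/-- A continuous function in `W^{k+1,∞}_loc` is of class `C^k`, and its classical derivatives of
order up to `k` are its weak derivatives. -/
theorem MemWInftyLoc.contDiff [CompleteSpace F] {k : ℕ} {u : Eu d → F} (hu : MemWInftyLoc (k + 1) u)
    (hc : Continuous u) :
    ContDiff ℝ k u ∧ ∀ j ≤ k, weakDeriv j u =ᵐ[volume] iteratedFDeriv ℝ j u := by
  -- The continuous representatives of the weak derivatives form a Taylor series of `u`.
  have hex : ∀ j, ∃ G : Eu d → ContinuousMultilinearMap ℝ (fun _ : Fin j => Eu d) F,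
      j ≤ k → Continuous G ∧ weakDeriv j u =ᵐ[volume] G := by
    intro j
    by_cases hj : j ≤ k
    · have hw := (hu j (by omega)).1.hasWeakGrad (hu (j + 1) (by omega)).1
      obtain ⟨G, h1, h2⟩ := hw.exists_continuous (fun r => by
        obtain ⟨K, hK, h⟩ := hu.exists_bound (j := j + 1) (by omega) r
        refine ⟨K, hK, ?_⟩
        filter_upwards [h] with y hy hyr
        rw [ContinuousMultilinearMap.curryLeft_norm]
        exact hy hyr)
      exact ⟨G, fun _ => ⟨h1, h2⟩⟩
    · exact ⟨0, fun h => absurd h hj⟩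
  choose G hG using hex
  have h0 : ∀ x, G 0 x 0 = u x := by
    have hae : (fun x => G 0 x 0) =ᵐ[volume] u := by
      filter_upwards [(hu 0 (by omega)).1.zero_ae, (hG 0 (by omega)).2] with x h1 h2
      rw [← h2, h1]
    have hcG : Continuous (fun x => G 0 x 0) :=
      (ContinuousMultilinearMap.apply ℝ (fun _ : Fin 0 => Eu d) F 0).continuous.comp
        (hG 0 (by omega)).1
    exact fun x => congrFun ((hcG.ae_eq_iff_eq volume hc).1 hae) x
  have hT : HasFTaylorSeriesUpTo k u (fun x j => G j x) := by
    refine ⟨fun x => ?_, fun m hm x => ?_, fun m hm => ?_⟩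
    · rw [← h0 x]; rfl
    · have hm' : m < k := by exact_mod_cast hm
      have hw := ((hu m (by omega)).1.hasWeakGrad (hu (m + 1) (by omega)).1).congr
        (hG m (by omega)).2 (curryLeft_ae (hG (m + 1) (by omega)).2)
      exact hw.hasFDerivAt (hG m (by omega)).1
        ((continuousMultilinearCurryLeftEquiv ℝ (fun _ : Fin (m + 1) => Eu d) F).continuous.comp
          (hG (m + 1) (by omega)).1) x
    · exact (hG m (by exact_mod_cast hm)).1
  refine ⟨hT.contDiff, fun j hj => ?_⟩
  filter_upwards [(hG j hj).2] with x hx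
  rw [hx]
  exact hT.eq_iteratedFDeriv (by exact_mod_cast hj) x

/-- In the interior of a set the classical derivatives are bounded, at every point, by the
essential supremum of the weak ones. -/
theorem MemWInftyLoc.norm_iteratedFDeriv_le [CompleteSpace F] {k j : ℕ} {u : Eu d → F}
    (hu : MemWInftyLoc (k + 1) u) (hc : Continuous u) (hj : j ≤ k) {A : Set (Eu d)}
    (hA : IsCompact A) {y : Eu d} (hy : y ∈ interior A) :
    ‖iteratedFDeriv ℝ j u y‖ ≤ (linftyDeriv j u A).toReal := by
  obtain ⟨hcd, hae⟩ := hu.contDiff hc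
  have hcont : Continuous (iteratedFDeriv ℝ j u) :=
    hcd.continuous_iteratedFDeriv (by exact_mod_cast hj)
  by_contra! hlt
  set O := interior A ∩ {z | (linftyDeriv j u A).toReal < ‖iteratedFDeriv ℝ j u z‖} with hO
  have hOo : IsOpen O := isOpen_interior.inter (isOpen_lt continuous_const hcont.norm)
  have hpos : 0 < volume O := hOo.measure_pos volume ⟨y, hy, hlt⟩
  have hnull : volume O = 0 := by
    have h1 := ae_norm_le_linftyDeriv (u := u) (j := j) isOpen_interior.measurableSet
      (interior_subset (s := A)) (hu.linftyDeriv_ne_top (by omega) hA)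
    have h2 : ∀ᵐ z, z ∉ O := by
      filter_upwards [h1, hae j hj] with z h1 h2 hz
      rw [h2] at h1
      exact absurd (h1 hz.1) (not_le.2 hz.2)
    simpa [ae_iff] using h2
  exact hpos.ne' hnull

/-- The highest weak derivative need not be continuous; its essential supremum serves as a
Lipschitz constant for the preceding derivative. -/
theorem MemWInftyLoc.norm_iteratedFDeriv_sub_le [CompleteSpace F] {k : ℕ} {u : Eu d → F}
    (hu : MemWInftyLoc (k + 1) u) (hc : Continuous u) {A : Set (Eu d)}
    (hA : IsCompact A) (hAc : Convex ℝ A) {y z : Eu d} (hy : y ∈ interior A)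
    (hz : z ∈ interior A) :
    ‖iteratedFDeriv ℝ k u z - iteratedFDeriv ℝ k u y‖
      ≤ (linftyDeriv (k + 1) u A).toReal * ‖z - y‖ := by
  obtain ⟨hcd, hae⟩ := hu.contDiff hc
  have hcont : Continuous (iteratedFDeriv ℝ k u) := hcd.continuous_iteratedFDeriv le_rfl
  have hw := ((hu k (by omega)).1.hasWeakGrad (hu (k + 1) le_rfl).1).congr (hae k le_rfl)
    (ae_eq_refl _)
  refine hw.lipschitz_of_continuous hcont ENNReal.toReal_nonneg isOpen_interior hAc.interior ?_
    hy hz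
  have h1 := ae_norm_le_linftyDeriv (u := u) (j := k + 1) isOpen_interior.measurableSet
      (interior_subset (s := A)) (hu.linftyDeriv_ne_top le_rfl hA)
  filter_upwards [h1] with z h1 hz
  rw [ContinuousMultilinearMap.curryLeft_norm]
  exact h1 hz

theorem norm_fderiv_fderiv (u : Eu d → F) (x : Eu d) :
    ‖fderiv ℝ (fderiv ℝ u) x‖ = ‖iteratedFDeriv ℝ 2 u x‖ := by
  rw [← norm_iteratedFDeriv_fderiv, ← norm_iteratedFDeriv_fderiv, norm_iteratedFDeriv_zero]

theorem norm_fderiv_fderiv_fderiv (u : Eu d → F) (x : Eu d) :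
    ‖fderiv ℝ (fderiv ℝ (fderiv ℝ u)) x‖ = ‖iteratedFDeriv ℝ 3 u x‖ := by
  rw [← norm_iteratedFDeriv_fderiv, ← norm_iteratedFDeriv_fderiv, ← norm_iteratedFDeriv_fderiv,
    norm_iteratedFDeriv_zero]

theorem norm_iteratedFDeriv_fderiv_sub {G : Type*} [NormedAddCommGroup G] [NormedSpace ℝ G]
    (v : Eu d → G) (n : ℕ) (x y : Eu d) :
    ‖iteratedFDeriv ℝ n (fderiv ℝ v) x - iteratedFDeriv ℝ n (fderiv ℝ v) y‖
      = ‖iteratedFDeriv ℝ (n + 1) v x - iteratedFDeriv ℝ (n + 1) v y‖ := by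
  have e : ∀ z, iteratedFDeriv ℝ (n + 1) v z
      = (continuousMultilinearCurryRightEquiv' ℝ n (Eu d) G).symm
        (iteratedFDeriv ℝ n (fderiv ℝ v) z) :=
    fun z => iteratedFDeriv_succ_eq_comp_right
  rw [e, e, ← map_sub, LinearIsometryEquiv.norm_map]

/-- The identification of the third derivatives as nested and as multilinear maps is isometric. -/
theorem norm_fderiv_fderiv_fderiv_sub (u : Eu d → F) (x y : Eu d) :
    ‖fderiv ℝ (fderiv ℝ (fderiv ℝ u)) x - fderiv ℝ (fderiv ℝ (fderiv ℝ u)) y‖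
      = ‖iteratedFDeriv ℝ 3 u x - iteratedFDeriv ℝ 3 u y‖ := by
  rw [← norm_iteratedFDeriv_fderiv_sub, ← norm_iteratedFDeriv_fderiv_sub,
    ← norm_iteratedFDeriv_fderiv_sub, iteratedFDeriv_zero_eq_comp]
  simp only [Function.comp_apply]
  rw [← map_sub, LinearIsometryEquiv.norm_map]

end Regularity

/-! ### One-dimensional Taylor estimates -/

/-! The constants in the remainders are not the optimal ones: only their independence of the
functions matters below. -/

theorem abs_sub_le_of_hasDerivWithinAt {f f' : ℝ → ℝ} {C : ℝ}
    (h : ∀ t ∈ Icc (0 : ℝ) 1, HasDerivWithinAt f (f' t) (Icc 0 1) t)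
    (hC : ∀ t ∈ Icc (0 : ℝ) 1, |f' t| ≤ C) {t : ℝ} (ht : t ∈ Icc (0 : ℝ) 1) :
    |f t - f 0| ≤ C := by
  have h1 := norm_image_sub_le_of_norm_deriv_le_segment' h
    (fun x hx => hC x (Ico_subset_Icc_self hx)) t ht
  have hC0 : 0 ≤ C := (abs_nonneg _).trans (hC 0 (by simp))
  rw [Real.norm_eq_abs] at h1
  refine h1.trans ?_
  rw [sub_zero]
  exact mul_le_of_le_one_right hC0 ht.2

theorem abs_taylor_one {f f' f'' : ℝ → ℝ} {C : ℝ}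
    (h : ∀ t ∈ Icc (0 : ℝ) 1, HasDerivWithinAt f (f' t) (Icc 0 1) t)
    (h' : ∀ t ∈ Icc (0 : ℝ) 1, HasDerivWithinAt f' (f'' t) (Icc 0 1) t)
    (hC : ∀ t ∈ Icc (0 : ℝ) 1, |f'' t| ≤ C) {t : ℝ} (ht : t ∈ Icc (0 : ℝ) 1) :
    |f t - f 0 - t * f' 0| ≤ C := by
  have hd : ∀ t ∈ Icc (0 : ℝ) 1,
      HasDerivWithinAt (fun t => f t - t * f' 0) (f' t - f' 0) (Icc 0 1) t := by
    intro t ht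
    have := (h t ht).sub ((hasDerivWithinAt_id t (Icc 0 1)).mul_const (f' 0))
    rw [one_mul] at this
    exact this
  have := abs_sub_le_of_hasDerivWithinAt hd
    (fun t ht => abs_sub_le_of_hasDerivWithinAt h' hC ht) ht
  convert this using 2
  ring

theorem abs_taylor_two {f f' f'' f''' : ℝ → ℝ} {C : ℝ}
    (h : ∀ t ∈ Icc (0 : ℝ) 1, HasDerivWithinAt f (f' t) (Icc 0 1) t)
    (h' : ∀ t ∈ Icc (0 : ℝ) 1, HasDerivWithinAt f' (f'' t) (Icc 0 1) t)
    (h'' : ∀ t ∈ Icc (0 : ℝ) 1, HasDerivWithinAt f'' (f''' t) (Icc 0 1) t)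
    (hC : ∀ t ∈ Icc (0 : ℝ) 1, |f''' t| ≤ C) :
    |f 1 - f 0 - f' 0 - f'' 0 / 2| ≤ C := by
  have hd : ∀ t ∈ Icc (0 : ℝ) 1, HasDerivWithinAt (fun t => f t - t * f' 0 - t ^ 2 / 2 * f'' 0)
      (f' t - f' 0 - t * f'' 0) (Icc 0 1) t := by
    intro t ht
    have h2 : HasDerivWithinAt (fun t : ℝ => t ^ 2 / 2 * f'' 0) (t * f'' 0) (Icc 0 1) t := by
      have := (((hasDerivAt_pow 2 t).div_const 2).mul_const (f'' 0)).hasDerivWithinAt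
        (s := Icc (0 : ℝ) 1)
      have e : ((2 : ℕ) : ℝ) * t ^ (2 - 1) / 2 * f'' 0 = t * f'' 0 := by norm_num
      rw [e] at this
      exact this
    have := ((h t ht).sub ((hasDerivWithinAt_id t (Icc 0 1)).mul_const (f' 0))).sub h2
    rw [one_mul] at this
    exact this
  have := abs_sub_le_of_hasDerivWithinAt hd (fun t ht => abs_taylor_one h' h'' hC ht)
    (t := 1) (by simp)
  convert this using 2
  ring

/-! ### Stencils -/

section Stencils

variable {d : ℕ}

theorem one_le_norm_dirVec (ρ : LatStar d) : 1 ≤ ‖dirVec ρ‖ := by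
  obtain ⟨i, hi⟩ : ∃ i, ρ.1 i ≠ 0 := by
    by_contra! h
    exact ρ.2 (funext h)
  have h1 : ‖(dirVec ρ) i‖ ≤ ‖dirVec ρ‖ := PiLp.norm_apply_le _ _
  refine le_trans ?_ h1
  have h2 : (dirVec ρ) i = ((ρ.1 i : ℤ) : ℝ) := rfl
  rw [h2, Real.norm_eq_abs, ← Int.cast_abs]
  exact_mod_cast Int.one_le_abs hi

namespace Stencil

/-- The entry map as a linear map. -/
def entryₗ (ρ : LatStar d) : Stencil d →ₗ[ℝ] Eu d where
  toFun g := g.entry ρ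
  map_add' _ _ := rfl
  map_smul' _ _ := rfl

@[simp] theorem entry_add (g h : Stencil d) (ρ : LatStar d) :
    (g + h).entry ρ = g.entry ρ + h.entry ρ := rfl
@[simp] theorem entry_sub (g h : Stencil d) (ρ : LatStar d) :
    (g - h).entry ρ = g.entry ρ - h.entry ρ := rfl
@[simp] theorem entry_smul (c : ℝ) (g : Stencil d) (ρ : LatStar d) :
    (c • g).entry ρ = c • g.entry ρ := rfl

theorem entry_sum {ι : Type*} (s : Finset ι) (g : ι → Stencil d) (ρ : LatStar d) :
    (∑ i ∈ s, g i).entry ρ = ∑ i ∈ s, (g i).entry ρ :=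
  map_sum (entryₗ ρ) g s

theorem ext_entry {g h : Stencil d} (H : ∀ ρ, g.entry ρ = h.entry ρ) : g = h :=
  Subtype.ext (funext H)

theorem entry_single_self (ρ : LatStar d) (v : Eu d) : (single ρ v).entry ρ = v :=
  Pi.single_eq_same (M := fun _ : LatStar d => Eu d) ρ v

theorem entry_single_of_ne {ρ σ : LatStar d} (h : σ ≠ ρ) (v : Eu d) : (single ρ v).entry σ = 0 :=
  Pi.single_eq_of_ne (M := fun _ : LatStar d => Eu d) h v

/-- The stencil `g` with all entries outside the finite set `s` replaced by zero. -/
def trunc (s : Finset (LatStar d)) (g : Stencil d) : Stencil d := ∑ ς ∈ s, single ς (g.entry ς)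

theorem entry_trunc_of_mem {s : Finset (LatStar d)} {ρ : LatStar d} (h : ρ ∈ s) (g : Stencil d) :
    (trunc s g).entry ρ = g.entry ρ := by
  rw [trunc, entry_sum, Finset.sum_eq_single_of_mem ρ h
    (fun σ _ hσ => entry_single_of_ne hσ.symm _), entry_single_self]

theorem entry_trunc_of_notMem {s : Finset (LatStar d)} {ρ : LatStar d} (h : ρ ∉ s)
    (g : Stencil d) : (trunc s g).entry ρ = 0 := by
  rw [trunc, entry_sum]
  exact Finset.sum_eq_zero fun σ hσ => entry_single_of_ne (fun e => h (by rwa [e])) _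

theorem trunc_sub (s : Finset (LatStar d)) (g h : Stencil d) :
    trunc s (g - h) = trunc s g - trunc s h := by
  simp [trunc, Finset.sum_sub_distrib, map_sub]

theorem trunc_mem {κ : ℝ} {s : Finset (LatStar d)} {g : Stencil d} (hg : g ∈ stencilBall d κ) :
    trunc s g ∈ stencilBall d κ := by
  have hg' : ‖g‖ ≤ κ := mem_closedBall_zero_iff.1 hg
  refine mem_closedBall_zero_iff.2 ((norm_le _ (norm_nonneg g) fun ρ => ?_).trans hg')
  by_cases h : ρ ∈ s
  · rw [entry_trunc_of_mem h]; exact entry_le g ρ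
  · rw [entry_trunc_of_notMem h, norm_zero]; positivity

theorem tendsto_entry_trunc (g : Stencil d) (ρ : LatStar d) :
    Tendsto (fun s => (trunc s g).entry ρ) atTop (𝓝 (g.entry ρ)) := by
  refine tendsto_const_nhds.congr' ?_
  filter_upwards [eventually_ge_atTop ({ρ} : Finset (LatStar d))] with s hs
  exact (entry_trunc_of_mem (hs (by simp)) g).symm

theorem add_single_mem {κ : ℝ} (hκ : 0 < κ) {g : Stencil d} (hg : g ∈ stencilBall d κ)
    {ς : LatStar d} {y : Eu d} (hy : ‖y‖ ≤ κ * ‖dirVec ς‖) :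
    g + single ς (y - g.entry ς) ∈ stencilBall d κ := by
  have hg' : ‖g‖ ≤ κ := mem_closedBall_zero_iff.1 hg
  refine mem_closedBall_zero_iff.2 (norm_le _ hκ.le fun ρ => ?_)
  by_cases h : ρ = ς
  · subst h
    rw [entry_add, entry_single_self]
    simpa using hy
  · rw [entry_add, entry_single_of_ne h, add_zero]
    exact (entry_le g ρ).trans (by gcongr)

end Stencil

theorem convex_stencilBall (κ : ℝ) : Convex ℝ (stencilBall d κ) := convex_closedBall _ _

theorem interior_stencilBall_nonempty {κ : ℝ} (hκ : 0 < κ) :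
    (interior (stencilBall d κ)).Nonempty :=
  ⟨0, mem_interior.2 ⟨Metric.ball 0 κ, Metric.ball_subset_closedBall, Metric.isOpen_ball,
    Metric.mem_ball_self hκ⟩⟩

theorem uniqueDiffOn_stencilBall {κ : ℝ} (hκ : 0 < κ) : UniqueDiffOn ℝ (stencilBall d κ) :=
  uniqueDiffOn_convex (convex_stencilBall κ) (interior_stencilBall_nonempty hκ)

theorem add_smul_mem_stencilBall {κ : ℝ} {g h : Stencil d} (hg : g ∈ stencilBall d κ)
    (hgh : g + h ∈ stencilBall d κ) {t : ℝ} (ht : t ∈ Icc (0 : ℝ) 1) :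
    g + t • h ∈ stencilBall d κ :=
  (convex_stencilBall κ).add_smul_mem hg hgh ht

end Stencils

/-! ### Partial derivatives of the site energy -/

section SiteEnergy

variable {d : ℕ} {κ : ℝ} {k : ℕ} {V : Stencil d → EReal}

/-- The `j`-th derivative of the site energy within the ball `𝒟_κ`. -/
def siteDeriv (V : Stencil d → EReal) (κ : ℝ) (j : ℕ) (g : Stencil d) :
    ContinuousMultilinearMap ℝ (fun _ : Fin j => Stencil d) ℝ :=
  iteratedFDerivWithin ℝ j (fun g => (V g).toReal) (stencilBall d κ) g

theorem partialV_apply {j : ℕ} (ρ : Fin j → LatStar d) (g : Stencil d) (w : Fin j → Eu d) :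
    partialV V κ ρ g w = siteDeriv V κ j g (fun i => Stencil.single (ρ i) (w i)) := rfl

theorem partialV_vecCons {j : ℕ} (ς : LatStar d) (ρ : Fin j → LatStar d) (g : Stencil d) (v : Eu d)
    (w : Fin j → Eu d) :
    partialV V κ (Matrix.vecCons ς ρ) g (Matrix.vecCons v w) = siteDeriv V κ (j + 1) g
      (Matrix.vecCons (Stencil.single ς v) fun i => Stencil.single (ρ i) (w i)) := by
  rw [partialV_apply]
  congr 1
  funext i
  refine Fin.cases ?_ (fun i => ?_) i <;> simp

theorem siteDeriv_vecCons {j : ℕ} (g X : Stencil d) (W : Fin j → Stencil d) :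
    siteDeriv V κ (j + 1) g (Matrix.vecCons X W) = (siteDeriv V κ (j + 1) g).curryLeft X W := rfl

theorem siteDeriv_vecCons_trunc {j : ℕ} (g a : Stencil d) (s : Finset (LatStar d))
    (W : Fin j → Stencil d) :
    siteDeriv V κ (j + 1) g (Matrix.vecCons (a.trunc s) W) = ∑ ς ∈ s,
      siteDeriv V κ (j + 1) g (Matrix.vecCons (Stencil.single ς (a.entry ς)) W) := by
  simp only [siteDeriv_vecCons, Stencil.trunc, map_sum, sum_apply]

theorem siteDeriv_vecCons_vecCons_trunc {j : ℕ} (g X a : Stencil d) (s : Finset (LatStar d))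
    (W : Fin j → Stencil d) :
    siteDeriv V κ (j + 2) g (Matrix.vecCons X (Matrix.vecCons (a.trunc s) W)) = ∑ ς ∈ s,
      siteDeriv V κ (j + 2) g
        (Matrix.vecCons X (Matrix.vecCons (Stencil.single ς (a.entry ς)) W)) := by
  have h : ∀ Y, siteDeriv V κ (j + 2) g (Matrix.vecCons X (Matrix.vecCons Y W))
    = ((siteDeriv V κ (j + 2) g).curryLeft X).curryLeft Y W := fun _ => rfl
  simp only [h, Stencil.trunc, map_sum, sum_apply]

theorem siteDeriv_vecCons₃_trunc {j : ℕ} (g X Y a : Stencil d) (s : Finset (LatStar d))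
    (W : Fin j → Stencil d) :
    siteDeriv V κ (j + 3) g (Matrix.vecCons X (Matrix.vecCons Y (Matrix.vecCons (a.trunc s) W)))
      = ∑ ς ∈ s, siteDeriv V κ (j + 3) g
        (Matrix.vecCons X (Matrix.vecCons Y
          (Matrix.vecCons (Stencil.single ς (a.entry ς)) W))) := by
  have h : ∀ Z, siteDeriv V κ (j + 3) g (Matrix.vecCons X (Matrix.vecCons Y (Matrix.vecCons Z W)))
    = (((siteDeriv V κ (j + 3) g).curryLeft X).curryLeft Y).curryLeft Z W := fun _ => rfl
  simp only [h, Stencil.trunc, map_sum, sum_apply]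

/-- The derivative along a segment of `𝒟_κ`, whose endpoints may lie on the boundary of the ball. -/
theorem IsSiteEnergy.hasDerivWithinAt (hV : IsSiteEnergy κ k V) (hκ : 0 < κ) {j : ℕ}
    (hj : j + 1 ≤ k) {g h : Stencil d} (hg : g ∈ stencilBall d κ) (hgh : g + h ∈ stencilBall d κ)
    (W : Fin j → Stencil d) {t : ℝ} (ht : t ∈ Icc (0 : ℝ) 1) :
    HasDerivWithinAt (fun t : ℝ => siteDeriv V κ j (g + t • h) W)
      (siteDeriv V κ (j + 1) (g + t • h) (Matrix.vecCons h W)) (Icc 0 1) t := by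
  have hS := uniqueDiffOn_stencilBall (d := d) hκ
  have hmem := add_smul_mem_stencilBall hg hgh ht
  have hd : DifferentiableWithinAt ℝ (siteDeriv V κ j) (stencilBall d κ) (g + t • h) :=
    hV.smooth.differentiableOn_iteratedFDerivWithin (by exact_mod_cast hj) hS _ hmem
  have h1 : HasDerivWithinAt (fun t : ℝ => g + t • h) h (Icc 0 1) t := by
    simpa using (((hasDerivAt_id t).smul_const h).const_add g).hasDerivWithinAt
  have h2 := ((ContinuousMultilinearMap.apply ℝ (fun _ : Fin j => Stencil d) ℝ
    W).hasFDerivAt.comp_hasFDerivWithinAt _ hd.hasFDerivWithinAt).comp_hasDerivWithinAt t h1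
    (fun s hs => add_smul_mem_stencilBall hg hgh hs)
  have e : siteDeriv V κ (j + 1) (g + t • h) (Matrix.vecCons h W)
      = fderivWithin ℝ (siteDeriv V κ j) (stencilBall d κ) (g + t • h) h W := by
    unfold siteDeriv
    rw [iteratedFDerivWithin_succ_apply_left]
    rfl
  rw [e]
  exact h2

/-- The bound `sup_{g ∈ 𝒟_κ} ‖V_ρ(g)‖` as a real number. -/
def partialSup (V : Stencil d → EReal) (κ : ℝ) {j : ℕ} (ρ : Fin j → LatStar d) : ℝ :=
  (⨆ g ∈ stencilBall d κ, ‖partialV V κ ρ g‖ₑ).toReal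

theorem partialSup_nonneg {j : ℕ} (ρ : Fin j → LatStar d) : 0 ≤ partialSup V κ ρ :=
  ENNReal.toReal_nonneg

theorem IsSiteEnergy.mBound_ne_top (hV : IsSiteEnergy κ k V) {j : ℕ} (h1 : 1 ≤ j) (hj : j ≤ k)
    (ρ : Fin j → LatStar d) : mBound V κ ρ ≠ ⊤ :=
  ((ENNReal.le_tsum ρ).trans_lt (hV.decay j h1 hj)).ne

theorem prod_norm_dirVec_pos {j : ℕ} (ρ : Fin j → LatStar d) : 0 < ∏ i, ‖dirVec (ρ i)‖ :=
  Finset.prod_pos fun i _ => norm_dirVec_pos (ρ i)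

theorem prod_enorm_dirVec {j : ℕ} (ρ : Fin j → LatStar d) :
    ∏ i, ‖dirVec (ρ i)‖ₑ = ENNReal.ofReal (∏ i, ‖dirVec (ρ i)‖) := by
  rw [ENNReal.ofReal_prod_of_nonneg (fun _ _ => norm_nonneg _)]
  simp

theorem IsSiteEnergy.iSup_ne_top (hV : IsSiteEnergy κ k V) {j : ℕ} (h1 : 1 ≤ j) (hj : j ≤ k)
    (ρ : Fin j → LatStar d) : (⨆ g ∈ stencilBall d κ, ‖partialV V κ ρ g‖ₑ) ≠ ⊤ := by
  intro h
  apply hV.mBound_ne_top h1 hj ρ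
  rw [mBound, h, prod_enorm_dirVec, ENNReal.mul_top]
  simpa using prod_norm_dirVec_pos ρ

theorem IsSiteEnergy.mBound_eq (hV : IsSiteEnergy κ k V) {j : ℕ} (h1 : 1 ≤ j) (hj : j ≤ k)
    (ρ : Fin j → LatStar d) :
    mBound V κ ρ = ENNReal.ofReal (partialSup V κ ρ * ∏ i, ‖dirVec (ρ i)‖) := by
  rw [mBound, prod_enorm_dirVec, mul_comm, ENNReal.ofReal_mul (partialSup_nonneg ρ), partialSup,
    ENNReal.ofReal_toReal (hV.iSup_ne_top h1 hj ρ)]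

theorem IsSiteEnergy.norm_partialV_le (hV : IsSiteEnergy κ k V) {j : ℕ} (h1 : 1 ≤ j) (hj : j ≤ k)
    (ρ : Fin j → LatStar d) {g : Stencil d} (hg : g ∈ stencilBall d κ) :
    ‖partialV V κ ρ g‖ ≤ partialSup V κ ρ := by
  rw [partialSup, ← toReal_enorm]
  exact ENNReal.toReal_mono (hV.iSup_ne_top h1 hj ρ)
    (le_iSup₂ (f := fun g (_ : g ∈ stencilBall d κ) => ‖partialV V κ ρ g‖ₑ) g hg)

theorem IsSiteEnergy.abs_partialV_le (hV : IsSiteEnergy κ k V) {j : ℕ} (h1 : 1 ≤ j) (hj : j ≤ k)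
    (ρ : Fin j → LatStar d) {g : Stencil d} (hg : g ∈ stencilBall d κ) (w : Fin j → Eu d) :
    |partialV V κ ρ g w| ≤ partialSup V κ ρ * ∏ i, ‖w i‖ :=
  (partialV V κ ρ g).le_of_opNorm_le (hV.norm_partialV_le h1 hj ρ hg) w

theorem IsSiteEnergy.summable_partialSup (hV : IsSiteEnergy κ k V) {j : ℕ} (h1 : 1 ≤ j)
    (hj : j ≤ k) : Summable fun ρ : Fin j → LatStar d =>
      partialSup V κ ρ * ∏ i, ‖dirVec (ρ i)‖ := by
  have h := ENNReal.summable_toReal (hV.decay j h1 hj).ne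
  refine h.congr fun ρ => ?_
  rw [hV.mBound_eq h1 hj, ENNReal.toReal_ofReal]
  exact mul_nonneg (partialSup_nonneg ρ) (prod_norm_dirVec_pos ρ).le

/-- Summability against the weights, over an index set that injects into the tuples of bonds. -/
theorem IsSiteEnergy.summable_mul (hV : IsSiteEnergy κ k V) {j : ℕ} (h1 : 1 ≤ j) (hj : j ≤ k)
    {ι : Type*} {e : ι → Fin j → LatStar d} (he : Function.Injective e) {y : ι → ℝ} (A : ℝ)
    (hy0 : ∀ i, 0 ≤ y i) (hy : ∀ i, y i ≤ A * ∏ m, ‖dirVec (e i m)‖) :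
    Summable fun i => partialSup V κ (e i) * y i := by
  refine Summable.of_nonneg_of_le (fun i => mul_nonneg (partialSup_nonneg _) (hy0 i))
    (fun i => ?_) (((hV.summable_partialSup h1 hj).comp_injective he).mul_left A)
  calc partialSup V κ (e i) * y i ≤ partialSup V κ (e i) * (A * ∏ m, ‖dirVec (e i m)‖) := by
        gcongr
        · exact partialSup_nonneg _
        · exact hy i
    _ = _ := by simp only [Function.comp_apply]; ring

/-! ### Continuity under entrywise convergence -/

/-- Sequential continuity on `𝒟_κ` under entrywise convergence. -/
def EntryContinuous (κ : ℝ) (f : Stencil d → ℝ) : Prop :=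
  ∀ (g : Stencil d) (G : ℕ → Stencil d), g ∈ stencilBall d κ →
    (∀ n, G n ∈ stencilBall d κ) →
    (∀ ρ, Tendsto (fun n => (G n).entry ρ) atTop (𝓝 (g.entry ρ))) →
    Tendsto (fun n => f (G n)) atTop (𝓝 (f g))

theorem EntryContinuous.tendsto_trunc {f : Stencil d → ℝ} (hf : EntryContinuous κ f)
    {g : Stencil d} (hg : g ∈ stencilBall d κ) :
    Tendsto (fun s => f (g.trunc s)) atTop (𝓝 (f g)) := by
  refine tendsto_of_seq_tendsto fun s hs => ?_
  exact hf g _ hg (fun n => Stencil.trunc_mem hg)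
    fun ρ => (Stencil.tendsto_entry_trunc g ρ).comp hs

theorem IsSiteEnergy.entryContinuous_zero (hV : IsSiteEnergy κ k V) :
    EntryContinuous κ (fun g => (V g).toReal) := by
  intro g G hg hG h
  exact (EReal.tendsto_toReal (hV.finite g hg).1 (hV.finite g hg).2).comp
    (hV.entrywise g G hg hG h)

/-- Difference quotients in a single direction converge at a rate controlled by the second
partial derivative. -/
theorem IsSiteEnergy.abs_sub_sub_single_le (hV : IsSiteEnergy κ k V) (hκ : 0 < κ) {j : ℕ}
    (hj : j + 2 ≤ k) (ς : LatStar d) (ρ : Fin j → LatStar d) (w : Fin j → Eu d) {g : Stencil d}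
    (hg : g ∈ stencilBall d κ) {v : Eu d} (hgv : g + Stencil.single ς v ∈ stencilBall d κ)
    {t : ℝ} (ht : t ∈ Icc (0 : ℝ) 1) :
    |partialV V κ ρ (g + t • Stencil.single ς v) w - partialV V κ ρ g w
        - t * partialV V κ (Matrix.vecCons ς ρ) g (Matrix.vecCons v w)|
      ≤ t ^ 2 * (partialSup V κ (Matrix.vecCons ς (Matrix.vecCons ς ρ)) * ‖v‖ ^ 2
        * ∏ i, ‖w i‖) := by
  have hgt : g + t • Stencil.single ς v ∈ stencilBall d κ := add_smul_mem_stencilBall hg hgv ht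
  have e : t • Stencil.single ς v = Stencil.single ς (t • v) := (map_smul _ _ _).symm
  set W : Fin j → Stencil d := fun i => Stencil.single (ρ i) (w i) with hW
  have h1 := fun s hs => hV.hasDerivWithinAt hκ (j := j) (by omega) hg hgt W (t := s) hs
  have h2 := fun s hs => hV.hasDerivWithinAt hκ (j := j + 1) (by omega) hg hgt
    (Matrix.vecCons (t • Stencil.single ς v) W) (t := s) hs
  have h3 := abs_taylor_one h1 h2 (C := t ^ 2 *
    (partialSup V κ (Matrix.vecCons ς (Matrix.vecCons ς ρ)) * ‖v‖ ^ 2 * ∏ i, ‖w i‖))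
    (fun s hs => ?_) (t := 1) (by simp)
  · simp only [one_smul, zero_smul, add_zero, one_mul] at h3
    rw [siteDeriv_vecCons, map_smul, smul_apply, smul_eq_mul, ← siteDeriv_vecCons] at h3
    rw [partialV_vecCons]
    exact h3
  · have h4 := hV.abs_partialV_le (j := j + 2) (by omega) hj
      (Matrix.vecCons ς (Matrix.vecCons ς ρ))
      (add_smul_mem_stencilBall hg hgt hs) (Matrix.vecCons (t • v) (Matrix.vecCons (t • v) w))
    have e2 : (fun i => Stencil.single (Matrix.vecCons ς ρ i) (Matrix.vecCons (t • v) w i))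
        = Matrix.vecCons (Stencil.single ς (t • v)) W := by
      funext i
      refine Fin.cases ?_ (fun i => ?_) i <;> simp [hW]
    rw [partialV_vecCons, e2, ← e] at h4
    refine h4.trans (le_of_eq ?_)
    simp only [Fin.prod_univ_succ, Matrix.cons_val_zero, Matrix.cons_val_succ, norm_smul,
      Real.norm_eq_abs]
    rw [abs_of_nonneg ht.1]
    ring

theorem partialV_vecCons_eq_curryLeft {j : ℕ} (ς : LatStar d) (ρ : Fin j → LatStar d)
    (g : Stencil d) (v : Eu d) (w : Fin j → Eu d) :
    partialV V κ (Matrix.vecCons ς ρ) g (Matrix.vecCons v w)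
      = (partialV V κ (Matrix.vecCons ς ρ) g).curryLeft v w := rfl

/-- Entrywise continuity of a partial derivative, tested along an admissible change of one entry:
it is a uniform limit of difference quotients. -/
theorem IsSiteEnergy.tendsto_partialV_single (hV : IsSiteEnergy κ k V) (hκ : 0 < κ) {j : ℕ}
    (hj : j + 2 ≤ k) (ς : LatStar d) (ρ : Fin j → LatStar d) (w : Fin j → Eu d)
    (hc : EntryContinuous κ fun g => partialV V κ ρ g w)
    {g : Stencil d} {G : ℕ → Stencil d} (hg : g ∈ stencilBall d κ)
    (hG : ∀ n, G n ∈ stencilBall d κ)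
    (hGg : ∀ σ, Tendsto (fun n => (G n).entry σ) atTop (𝓝 (g.entry σ))) {y : Eu d}
    (hy : ‖y‖ ≤ κ * ‖dirVec ς‖) :
    Tendsto (fun n => partialV V κ (Matrix.vecCons ς ρ) (G n)
        (Matrix.vecCons (y - (G n).entry ς) w)) atTop
      (𝓝 (partialV V κ (Matrix.vecCons ς ρ) g (Matrix.vecCons (y - g.entry ς) w))) := by
  set R : ℝ := 2 * κ * ‖dirVec ς‖ with hR
  have hR0 : 0 ≤ R := by positivity
  have hbd : ∀ h ∈ stencilBall d κ, ‖y - h.entry ς‖ ≤ R := by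
    intro h hh
    have h1 := Stencil.entry_le h ς
    have h2 : ‖h‖ ≤ κ := mem_closedBall_zero_iff.1 hh
    have h3 : ‖h‖ * ‖dirVec ς‖ ≤ κ * ‖dirVec ς‖ := by gcongr
    have h4 := norm_sub_le y (h.entry ς)
    linarith
  set M : ℝ := partialSup V κ (Matrix.vecCons ς (Matrix.vecCons ς ρ)) * R ^ 2 * ∏ i, ‖w i‖ with hM
  have hM0 : 0 ≤ M := mul_nonneg (mul_nonneg (partialSup_nonneg _) (by positivity))
    (Finset.prod_nonneg fun _ _ => norm_nonneg _)
  have hq : ∀ h ∈ stencilBall d κ, ∀ t ∈ Ioc (0 : ℝ) 1,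
      |(partialV V κ ρ (h + t • Stencil.single ς (y - h.entry ς)) w - partialV V κ ρ h w) / t
        - partialV V κ (Matrix.vecCons ς ρ) h (Matrix.vecCons (y - h.entry ς) w)| ≤ t * M := by
    intro h hh t ht
    have h1 := hV.abs_sub_sub_single_le hκ hj ς ρ w hh (Stencil.add_single_mem hκ hh hy)
      ⟨ht.1.le, ht.2⟩
    have h2 : t ^ 2 * (partialSup V κ (Matrix.vecCons ς (Matrix.vecCons ς ρ))
        * ‖y - h.entry ς‖ ^ 2 * ∏ i, ‖w i‖) ≤ t ^ 2 * M := by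
      gcongr ?_ * ?_
      rw [hM]
      gcongr
      · exact partialSup_nonneg _
      · exact hbd h hh
    have h3 := h1.trans h2
    have e : (partialV V κ ρ (h + t • Stencil.single ς (y - h.entry ς)) w - partialV V κ ρ h w) / t
        - partialV V κ (Matrix.vecCons ς ρ) h (Matrix.vecCons (y - h.entry ς) w)
        = (partialV V κ ρ (h + t • Stencil.single ς (y - h.entry ς)) w - partialV V κ ρ h w
          - t * partialV V κ (Matrix.vecCons ς ρ) h (Matrix.vecCons (y - h.entry ς) w)) / t := by
      have := ht.1.ne'
      field_simp
    rw [e, abs_div, abs_of_pos ht.1, div_le_iff₀ ht.1]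
    refine h3.trans (le_of_eq ?_)
    ring
  rw [Metric.tendsto_atTop]
  intro ε hε
  -- With this `t` the difference quotients at `g` and at all `G n` are within `ε / 4` of the
  -- derivatives, uniformly in `n`.
  set t : ℝ := min 1 (ε / (4 * (M + 1))) with ht
  have htpos : 0 < t := by positivity
  have htI : t ∈ Ioc (0 : ℝ) 1 := ⟨htpos, min_le_left _ _⟩
  have htM : t * M ≤ ε / 4 := by
    calc t * M ≤ (ε / (4 * (M + 1))) * (M + 1) := by
          gcongr
          · exact min_le_right _ _
          · linarith
      _ = ε / 4 := by field_simp
  have hlim : Tendsto (fun n => (partialV V κ ρ (G n + t • Stencil.single ς (y - (G n).entry ς)) w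
      - partialV V κ ρ (G n) w) / t) atTop
      (𝓝 ((partialV V κ ρ (g + t • Stencil.single ς (y - g.entry ς)) w
        - partialV V κ ρ g w) / t)) := by
    refine ((hc _ _ ?_ (fun n => ?_) fun σ => ?_).sub (hc g G hg hG hGg)).div_const t
    · exact add_smul_mem_stencilBall hg (Stencil.add_single_mem hκ hg hy) ⟨htI.1.le, htI.2⟩
    · exact add_smul_mem_stencilBall (hG n) (Stencil.add_single_mem hκ (hG n) hy)
        ⟨htI.1.le, htI.2⟩
    · simp only [Stencil.entry_add, Stencil.entry_smul]
      refine (hGg σ).add (Tendsto.const_smul ?_ t)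
      by_cases h : σ = ς
      · subst h
        simp only [Stencil.entry_single_self]
        exact tendsto_const_nhds.sub (hGg σ)
      · simp only [Stencil.entry_single_of_ne h]
        exact tendsto_const_nhds
  obtain ⟨N, hN⟩ := Metric.tendsto_atTop.1 hlim (ε / 4) (by positivity)
  refine ⟨N, fun n hn => ?_⟩
  have h1 := hN n hn
  have h2 := hq (G n) (hG n) t htI
  have h3 := hq g hg t htI
  rw [Real.dist_eq] at h1 ⊢
  rw [abs_lt] at h1 ⊢
  rw [abs_le] at h2 h3
  constructor <;> linarith [h1.1, h1.2, h2.1, h2.2, h3.1, h3.2]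

/-- The partial derivatives inherit from `V` the continuity under entrywise convergence. -/
theorem IsSiteEnergy.entryContinuous (hV : IsSiteEnergy κ k V) (hκ : 0 < κ) :
    ∀ {j : ℕ}, j + 1 ≤ k → ∀ (ρ : Fin j → LatStar d) (w : Fin j → Eu d),
      EntryContinuous κ fun g => partialV V κ ρ g w
  | 0, _, _, _ => hV.entryContinuous_zero
  | j + 1, hj, ρ, w => by
    intro g G hg hG hGg
    have hc := hV.entryContinuous hκ (j := j) (by omega) (Matrix.vecTail ρ) (Matrix.vecTail w)
    rw [← Matrix.cons_head_tail ρ, ← Matrix.cons_head_tail w]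
    generalize Matrix.vecTail ρ = ρ' at *
    generalize Matrix.vecTail w = w' at *
    generalize Matrix.vecHead ρ = ς at *
    generalize Matrix.vecHead w = y at *
    have h0 := hV.tendsto_partialV_single hκ hj ς ρ' w' hc hg hG hGg (y := 0)
      (by rw [norm_zero]; positivity)
    -- `a • y` is an admissible entry at `ς`. The increments to `0` and to `a • y` differ by
    -- `a • y`, which no longer involves the entry of the varying stencil.
    set a : ℝ := κ * ‖dirVec ς‖ / (‖y‖ + 1) with ha
    have ha0 : 0 < a := by
      have := norm_dirVec_pos ς
      positivity
    have hya : ‖a • y‖ ≤ κ * ‖dirVec ς‖ := by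
      rw [norm_smul, Real.norm_of_nonneg ha0.le, ha, div_mul_eq_mul_div,
        div_le_iff₀ (by positivity)]
      gcongr
      linarith
    have h1 := hV.tendsto_partialV_single hκ hj ς ρ' w' hc hg hG hGg hya
    have h2 := (h1.sub h0).const_mul a⁻¹
    have e : ∀ h : Stencil d, a⁻¹ * (partialV V κ (Matrix.vecCons ς ρ') h
        (Matrix.vecCons (a • y - h.entry ς) w') - partialV V κ (Matrix.vecCons ς ρ') h
          (Matrix.vecCons (0 - h.entry ς) w'))
        = partialV V κ (Matrix.vecCons ς ρ') h (Matrix.vecCons y w') := by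
      intro h
      simp only [partialV_vecCons_eq_curryLeft]
      rw [← sub_apply, ← map_sub, sub_sub_sub_cancel_right, sub_zero, map_smul, smul_apply,
        smul_eq_mul, inv_mul_cancel_left₀ ha0.ne']
    simp only [e] at h2
    exact h2

end SiteEnergy

/-! ### Taylor expansion of the site energy in the entries of a stencil -/

theorem tendsto_finset_sum_of_dominated {α ι : Type*} {l : Filter α} {E : α → ι → ℝ}
    {e bound : ι → ℝ} {t : α → Finset ι} (ht : ∀ i, ∀ᶠ s in l, i ∈ t s) (hb : Summable bound)
    (hE : ∀ i, Tendsto (fun s => E s i) l (𝓝 (e i))) (hbd : ∀ s i, |E s i| ≤ bound i) :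
    Tendsto (fun s => ∑ i ∈ t s, E s i) l (𝓝 (∑' i, e i)) := by
  classical
  have h : ∀ s, ∑ i ∈ t s, E s i = ∑' i, if i ∈ t s then E s i else 0 := by
    intro s
    rw [tsum_eq_sum (s := t s) (fun i hi => if_neg hi)]
    exact Finset.sum_congr rfl fun i hi => (if_pos hi).symm
  simp only [h]
  refine tendsto_tsum_of_dominated_convergence hb (fun i => ?_) (Eventually.of_forall fun s i => ?_)
  · refine (hE i).congr' ?_
    filter_upwards [ht i] with s hs
    rw [if_pos hs]
  · split_ifs
    · exact hbd s i
    · rw [norm_zero]; exact (abs_nonneg _).trans (hbd s i)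

/-- A derivative is determined by a quadratic remainder estimate. -/
theorem eq_of_hasDerivWithinAt_of_sq_le {φ : ℝ → ℝ} {A B C : ℝ}
    (h : HasDerivWithinAt φ A (Icc 0 1) 0)
    (hC : ∀ t ∈ Icc (0 : ℝ) 1, |φ t - φ 0 - t * B| ≤ t ^ 2 * C) : A = B := by
  have h' : HasDerivWithinAt φ B (Icc 0 1) 0 := by
    rw [hasDerivWithinAt_iff_isLittleO]
    have h1 : (fun t : ℝ => φ t - φ 0 - (t - 0) • B) =O[𝓝[Icc 0 1] 0] fun t : ℝ => t ^ 2 := by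
      refine Asymptotics.IsBigO.of_bound C ?_
      filter_upwards [self_mem_nhdsWithin] with t ht
      have := hC t ht
      rw [sub_zero, smul_eq_mul, Real.norm_eq_abs, Real.norm_of_nonneg (sq_nonneg t)]
      linarith
    refine h1.trans_isLittleO ?_
    have h2 : (fun t : ℝ => t ^ 2) =o[𝓝 0] fun t : ℝ => t := by
      simpa using Asymptotics.isLittleO_pow_pow (𝕜 := ℝ) (m := 1) (n := 2) (by norm_num)
    simpa using h2.mono nhdsWithin_le_nhds
  exact ((uniqueDiffOn_Icc zero_lt_one) 0 (by simp)).eq_deriv _ h h'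

section SiteEnergy

variable {d : ℕ} {κ : ℝ} {k : ℕ} {V : Stencil d → EReal}

theorem partialV_vecCons₂ {j : ℕ} (τ ς : LatStar d) (ρ : Fin j → LatStar d) (g : Stencil d)
    (x y : Eu d) (w : Fin j → Eu d) :
    partialV V κ (Matrix.vecCons τ (Matrix.vecCons ς ρ)) g (Matrix.vecCons x (Matrix.vecCons y w))
      = siteDeriv V κ (j + 2) g (Matrix.vecCons (Stencil.single τ x)
        (Matrix.vecCons (Stencil.single ς y) fun i => Stencil.single (ρ i) (w i))) := by
  rw [partialV_vecCons]
  congr 2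
  funext i
  refine Fin.cases ?_ (fun i => ?_) i <;> simp

theorem partialV_vecCons₃ {j : ℕ} (σ τ ς : LatStar d) (ρ : Fin j → LatStar d) (g : Stencil d)
    (x y z : Eu d) (w : Fin j → Eu d) :
    partialV V κ (Matrix.vecCons σ (Matrix.vecCons τ (Matrix.vecCons ς ρ))) g
        (Matrix.vecCons x (Matrix.vecCons y (Matrix.vecCons z w)))
      = siteDeriv V κ (j + 3) g (Matrix.vecCons (Stencil.single σ x) (Matrix.vecCons
        (Stencil.single τ y) (Matrix.vecCons (Stencil.single ς z)
          fun i => Stencil.single (ρ i) (w i)))) := by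
  rw [partialV_vecCons]
  congr 2
  funext i
  refine Fin.cases ?_ (fun i => ?_) i
  · simp
  · refine Fin.cases ?_ (fun i => ?_) i <;> simp

theorem vecCons_injective {α : Type*} {j : ℕ} (ρ : Fin j → α) :
    Function.Injective fun ς => Matrix.vecCons ς ρ := fun a b h => by
  simpa using congrFun h 0

theorem vecCons₂_injective {α : Type*} {j : ℕ} (ρ : Fin j → α) :
    Function.Injective fun p : α × α => Matrix.vecCons p.1 (Matrix.vecCons p.2 ρ) :=
  fun a b h => Prod.ext (by simpa using congrFun h 0) (by simpa using congrFun h 1)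

theorem vecCons₃_injective {α : Type*} {j : ℕ} (ρ : Fin j → α) :
    Function.Injective fun p : α × α × α =>
      Matrix.vecCons p.1 (Matrix.vecCons p.2.1 (Matrix.vecCons p.2.2 ρ)) := by
  intro a b h
  refine Prod.ext (by simpa using congrFun h 0) (Prod.ext (by simpa using congrFun h 1) ?_)
  simpa using congrFun h (Fin.succ (Fin.succ 0))

variable {j : ℕ} (ρ : Fin j → LatStar d) (w : Fin j → Eu d)

/-- The remainder bound of the first-order expansion of `V_ρ` with increment `a`. -/
def remOne (V : Stencil d → EReal) (κ : ℝ) {j : ℕ} (ρ : Fin j → LatStar d) (w : Fin j → Eu d)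
    (a : Stencil d) (p : LatStar d × LatStar d) : ℝ :=
  partialSup V κ (Matrix.vecCons p.1 (Matrix.vecCons p.2 ρ)) *
    (‖a.entry p.1‖ * ‖a.entry p.2‖ * ∏ i, ‖w i‖)

/-- The remainder bound of the second-order expansion of `V_ρ` with increment `a`. -/
def remTwo (V : Stencil d → EReal) (κ : ℝ) {j : ℕ} (ρ : Fin j → LatStar d) (w : Fin j → Eu d)
    (a : Stencil d) (p : LatStar d × LatStar d × LatStar d) : ℝ :=
  partialSup V κ (Matrix.vecCons p.1 (Matrix.vecCons p.2.1 (Matrix.vecCons p.2.2 ρ))) *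
    (‖a.entry p.1‖ * ‖a.entry p.2.1‖ * ‖a.entry p.2.2‖ * ∏ i, ‖w i‖)

theorem prod_norm_nonneg {j : ℕ} (w : Fin j → Eu d) : 0 ≤ ∏ i, ‖w i‖ :=
  Finset.prod_nonneg fun _ _ => norm_nonneg _

theorem remOne_nonneg (a : Stencil d) (p : LatStar d × LatStar d) : 0 ≤ remOne V κ ρ w a p :=
  mul_nonneg (partialSup_nonneg _) (mul_nonneg (by positivity) (prod_norm_nonneg w))

theorem remTwo_nonneg (a : Stencil d) (p : LatStar d × LatStar d × LatStar d) :
    0 ≤ remTwo V κ ρ w a p :=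
  mul_nonneg (partialSup_nonneg _) (mul_nonneg (by positivity) (prod_norm_nonneg w))

theorem remOne_smul (a : Stencil d) {t : ℝ} (ht : 0 ≤ t) (p : LatStar d × LatStar d) :
    remOne V κ ρ w (t • a) p = t ^ 2 * remOne V κ ρ w a p := by
  simp only [remOne, Stencil.entry_smul, norm_smul, Real.norm_of_nonneg ht]
  ring

/-- The products of norms that occur as weights are controlled by the lattice weights. -/
theorem mul_prod_norm_le (x A B : ℝ) (hx : x ≤ A * B) (hw : 0 ≤ A * B) :
    x * ∏ i, ‖w i‖ ≤ A * (∏ i, ‖w i‖) * (B * ∏ i, ‖dirVec (ρ i)‖) := by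
  have h1 : 1 ≤ ∏ i, ‖dirVec (ρ i)‖ := by
    rw [← Finset.prod_const_one (s := (Finset.univ : Finset (Fin j)))]
    exact Finset.prod_le_prod (fun _ _ => zero_le_one) fun i _ => one_le_norm_dirVec (ρ i)
  have h2 := prod_norm_nonneg w
  calc x * ∏ i, ‖w i‖ ≤ (A * B) * (∏ i, ‖w i‖) * 1 := by rw [mul_one]; gcongr
    _ ≤ (A * B) * (∏ i, ‖w i‖) * ∏ i, ‖dirVec (ρ i)‖ := by gcongr
    _ = _ := by ring

theorem IsSiteEnergy.summable_first (hV : IsSiteEnergy κ k V) (hj : j + 1 ≤ k) (a : Stencil d) :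
    Summable fun ς => partialSup V κ (Matrix.vecCons ς ρ) * (‖a.entry ς‖ * ∏ i, ‖w i‖) := by
  refine hV.summable_mul (by omega) hj (vecCons_injective ρ) (‖a‖ * ∏ i, ‖w i‖)
    (fun ς => mul_nonneg (norm_nonneg _) (prod_norm_nonneg w)) fun ς => ?_
  simp only [Fin.prod_univ_succ, Matrix.cons_val_zero, Matrix.cons_val_succ]
  exact mul_prod_norm_le ρ w _ _ _ (Stencil.entry_le a ς) (by positivity)

theorem IsSiteEnergy.summable_remOne (hV : IsSiteEnergy κ k V) (hj : j + 2 ≤ k) (a : Stencil d) :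
    Summable (remOne V κ ρ w a) := by
  refine hV.summable_mul (by omega) hj (vecCons₂_injective ρ) (‖a‖ ^ 2 * ∏ i, ‖w i‖)
    (fun p => mul_nonneg (by positivity) (prod_norm_nonneg w)) fun p => ?_
  simp only [Fin.prod_univ_succ, Matrix.cons_val_zero, Matrix.cons_val_succ]
  rw [← mul_assoc ‖dirVec p.1‖]
  refine mul_prod_norm_le ρ w _ _ _ ?_ (by positivity)
  calc ‖a.entry p.1‖ * ‖a.entry p.2‖ ≤ (‖a‖ * ‖dirVec p.1‖) * (‖a‖ * ‖dirVec p.2‖) := by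
        gcongr <;> exact Stencil.entry_le a _
    _ = _ := by ring

theorem IsSiteEnergy.summable_remTwo (hV : IsSiteEnergy κ k V) (hj : j + 3 ≤ k) (a : Stencil d) :
    Summable (remTwo V κ ρ w a) := by
  refine hV.summable_mul (by omega) hj (vecCons₃_injective ρ) (‖a‖ ^ 3 * ∏ i, ‖w i‖)
    (fun p => mul_nonneg (by positivity) (prod_norm_nonneg w)) fun p => ?_
  simp only [Fin.prod_univ_succ, Matrix.cons_val_zero, Matrix.cons_val_succ]
  rw [← mul_assoc ‖dirVec p.2.1‖, ← mul_assoc ‖dirVec p.1‖, ← mul_assoc ‖dirVec p.1‖]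
  refine mul_prod_norm_le ρ w _ _ _ ?_ (by positivity)
  calc ‖a.entry p.1‖ * ‖a.entry p.2.1‖ * ‖a.entry p.2.2‖
      ≤ (‖a‖ * ‖dirVec p.1‖) * (‖a‖ * ‖dirVec p.2.1‖) * (‖a‖ * ‖dirVec p.2.2‖) := by
        gcongr <;> exact Stencil.entry_le a _
    _ = _ := by ring

theorem IsSiteEnergy.abs_first_le (hV : IsSiteEnergy κ k V) (hj : j + 1 ≤ k) {g : Stencil d}
    (hg : g ∈ stencilBall d κ) (a : Stencil d) (ς : LatStar d) :
    |partialV V κ (Matrix.vecCons ς ρ) g (Matrix.vecCons (a.entry ς) w)|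
      ≤ partialSup V κ (Matrix.vecCons ς ρ) * (‖a.entry ς‖ * ∏ i, ‖w i‖) := by
  refine (hV.abs_partialV_le (by omega) hj _ hg _).trans (le_of_eq ?_)
  simp only [Fin.prod_univ_succ, Matrix.cons_val_zero, Matrix.cons_val_succ]

theorem IsSiteEnergy.abs_second_le (hV : IsSiteEnergy κ k V) (hj : j + 2 ≤ k) {g : Stencil d}
    (hg : g ∈ stencilBall d κ) (a : Stencil d) (p : LatStar d × LatStar d) :
    |partialV V κ (Matrix.vecCons p.1 (Matrix.vecCons p.2 ρ)) g
        (Matrix.vecCons (a.entry p.1) (Matrix.vecCons (a.entry p.2) w))| ≤ remOne V κ ρ w a p := by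
  refine (hV.abs_partialV_le (by omega) hj _ hg _).trans (le_of_eq ?_)
  simp only [remOne, Fin.prod_univ_succ, Matrix.cons_val_zero, Matrix.cons_val_succ, mul_assoc]

theorem IsSiteEnergy.abs_third_le (hV : IsSiteEnergy κ k V) (hj : j + 3 ≤ k) {g : Stencil d}
    (hg : g ∈ stencilBall d κ) (a : Stencil d) (p : LatStar d × LatStar d × LatStar d) :
    |partialV V κ (Matrix.vecCons p.1 (Matrix.vecCons p.2.1 (Matrix.vecCons p.2.2 ρ))) g
        (Matrix.vecCons (a.entry p.1) (Matrix.vecCons (a.entry p.2.1)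
          (Matrix.vecCons (a.entry p.2.2) w)))| ≤ remTwo V κ ρ w a p := by
  refine (hV.abs_partialV_le (by omega) hj _ hg _).trans (le_of_eq ?_)
  simp only [remTwo, Fin.prod_univ_succ, Matrix.cons_val_zero, Matrix.cons_val_succ, mul_assoc]

/-- The endpoint of the segment along which truncated stencils are expanded. -/
theorem trunc_add_trunc_sub_mem {F G : Stencil d} (hG : G ∈ stencilBall d κ)
    (s : Finset (LatStar d)) : F.trunc s + (G - F).trunc s ∈ stencilBall d κ := by
  rw [Stencil.trunc_sub, add_sub_cancel]
  exact Stencil.trunc_mem hG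

/-- First-order expansion of a partial derivative. For truncated stencils it is Taylor's formula
along a segment; the truncation is removed by continuity under entrywise convergence. -/
theorem IsSiteEnergy.abs_taylor_one_le (hV : IsSiteEnergy κ k V) (hκ : 0 < κ) (hj : j + 2 ≤ k)
    {F G : Stencil d} (hF : F ∈ stencilBall d κ) (hG : G ∈ stencilBall d κ) :
    |partialV V κ ρ G w - partialV V κ ρ F w
        - ∑' ς, partialV V κ (Matrix.vecCons ς ρ) F (Matrix.vecCons ((G - F).entry ς) w)|
      ≤ ∑' p, remOne V κ ρ w (G - F) p := by
  set a := G - F with ha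
  set W : Fin j → Stencil d := fun i => Stencil.single (ρ i) (w i) with hW
  have hfin : ∀ s : Finset (LatStar d),
      |partialV V κ ρ (G.trunc s) w - partialV V κ ρ (F.trunc s) w
        - ∑ ς ∈ s, partialV V κ (Matrix.vecCons ς ρ) (F.trunc s) (Matrix.vecCons (a.entry ς) w)|
      ≤ ∑' p, remOne V κ ρ w a p := by
    intro s
    have hFs := Stencil.trunc_mem (s := s) hF
    have hGs := trunc_add_trunc_sub_mem (F := F) hG s
    have h1 := fun t ht => hV.hasDerivWithinAt hκ (j := j) (by omega) hFs hGs W (t := t) ht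
    have h2 := fun t ht => hV.hasDerivWithinAt hκ (j := j + 1) (by omega) hFs hGs
      (Matrix.vecCons (a.trunc s) W) (t := t) ht
    have h3 := abs_taylor_one h1 h2 (C := ∑' p, remOne V κ ρ w a p) (fun t ht => ?_)
      (t := 1) (by simp)
    · simp only [one_smul, zero_smul, add_zero, one_mul] at h3
      rw [Stencil.trunc_sub, add_sub_cancel, ← Stencil.trunc_sub, siteDeriv_vecCons_trunc] at h3
      simp only [partialV_vecCons]
      exact h3
    · have hmem := add_smul_mem_stencilBall hFs hGs ht
      rw [siteDeriv_vecCons_trunc]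
      simp only [siteDeriv_vecCons_vecCons_trunc]
      rw [← Finset.sum_product']
      simp only [hW, ← partialV_vecCons₂]
      refine (Finset.abs_sum_le_sum_abs _ _).trans ?_
      refine (Finset.sum_le_sum fun p _ => hV.abs_second_le ρ w hj hmem a p).trans ?_
      exact (hV.summable_remOne ρ w hj a).sum_le_tsum _ fun p _ => remOne_nonneg ρ w a p
  have hlim := (((hV.entryContinuous hκ (by omega) ρ w).tendsto_trunc hG).sub
    ((hV.entryContinuous hκ (by omega) ρ w).tendsto_trunc hF)).sub
    (tendsto_finset_sum_of_dominated (t := fun s => s)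
      (E := fun s ς => partialV V κ (Matrix.vecCons ς ρ) (F.trunc s) (Matrix.vecCons (a.entry ς) w))
      (e := fun ς => partialV V κ (Matrix.vecCons ς ρ) F (Matrix.vecCons (a.entry ς) w))
      (fun ς => by
        filter_upwards [eventually_ge_atTop ({ς} : Finset (LatStar d))] with s hs
        exact hs (by simp))
      (hV.summable_first ρ w (by omega) a)
      (fun ς => (hV.entryContinuous hκ (by omega) _ _).tendsto_trunc hF)
      (fun s ς => hV.abs_first_le ρ w (by omega) (Stencil.trunc_mem hF) a ς))
  exact le_of_tendsto hlim.abs (Eventually.of_forall hfin)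

/-- Second-order expansion of a partial derivative, by the same truncation argument. -/
theorem IsSiteEnergy.abs_taylor_two_le (hV : IsSiteEnergy κ k V) (hκ : 0 < κ) (hj : j + 3 ≤ k)
    {F G : Stencil d} (hF : F ∈ stencilBall d κ) (hG : G ∈ stencilBall d κ) :
    |partialV V κ ρ G w - partialV V κ ρ F w
        - ∑' ς, partialV V κ (Matrix.vecCons ς ρ) F (Matrix.vecCons ((G - F).entry ς) w)
        - (∑' p : LatStar d × LatStar d, partialV V κ (Matrix.vecCons p.1 (Matrix.vecCons p.2 ρ)) F
            (Matrix.vecCons ((G - F).entry p.1) (Matrix.vecCons ((G - F).entry p.2) w))) / 2|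
      ≤ ∑' p, remTwo V κ ρ w (G - F) p := by
  set a := G - F with ha
  set W : Fin j → Stencil d := fun i => Stencil.single (ρ i) (w i) with hW
  have hfin : ∀ s : Finset (LatStar d),
      |partialV V κ ρ (G.trunc s) w - partialV V κ ρ (F.trunc s) w
        - ∑ ς ∈ s, partialV V κ (Matrix.vecCons ς ρ) (F.trunc s) (Matrix.vecCons (a.entry ς) w)
        - (∑ p ∈ s ×ˢ s, partialV V κ (Matrix.vecCons p.1 (Matrix.vecCons p.2 ρ)) (F.trunc s)
            (Matrix.vecCons (a.entry p.1) (Matrix.vecCons (a.entry p.2) w))) / 2|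
      ≤ ∑' p, remTwo V κ ρ w a p := by
    intro s
    have hFs := Stencil.trunc_mem (s := s) hF
    have hGs := trunc_add_trunc_sub_mem (F := F) hG s
    have h1 := fun t ht => hV.hasDerivWithinAt hκ (j := j) (by omega) hFs hGs W (t := t) ht
    have h2 := fun t ht => hV.hasDerivWithinAt hκ (j := j + 1) (by omega) hFs hGs
      (Matrix.vecCons (a.trunc s) W) (t := t) ht
    have h3 := fun t ht => hV.hasDerivWithinAt hκ (j := j + 2) (by omega) hFs hGs
      (Matrix.vecCons (a.trunc s) (Matrix.vecCons (a.trunc s) W)) (t := t) ht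
    have h4 := abs_taylor_two h1 h2 h3 (C := ∑' p, remTwo V κ ρ w a p) (fun t ht => ?_)
    · simp only [one_smul, zero_smul, add_zero] at h4
      rw [Stencil.trunc_sub, add_sub_cancel, ← Stencil.trunc_sub, siteDeriv_vecCons_trunc,
        siteDeriv_vecCons_trunc] at h4
      simp only [siteDeriv_vecCons_vecCons_trunc] at h4
      rw [← Finset.sum_product'] at h4
      simp only [partialV_vecCons₂]
      simp only [partialV_vecCons]
      exact h4
    · have hmem := add_smul_mem_stencilBall hFs hGs ht
      rw [siteDeriv_vecCons_trunc]
      simp only [siteDeriv_vecCons_vecCons_trunc]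
      simp only [siteDeriv_vecCons₃_trunc]
      simp only [← Finset.sum_product']
      simp only [hW, ← partialV_vecCons₃]
      refine (Finset.abs_sum_le_sum_abs _ _).trans ?_
      refine (Finset.sum_le_sum fun p _ => hV.abs_third_le ρ w hj hmem a p).trans ?_
      exact (hV.summable_remTwo ρ w hj a).sum_le_tsum _ fun p _ => remTwo_nonneg ρ w a p
  have hmem : ∀ ς : LatStar d, ∀ᶠ s : Finset (LatStar d) in atTop, ς ∈ s := fun ς => by
    filter_upwards [eventually_ge_atTop ({ς} : Finset (LatStar d))] with s hs
    exact hs (by simp)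
  have hlim := ((((hV.entryContinuous hκ (by omega) ρ w).tendsto_trunc hG).sub
    ((hV.entryContinuous hκ (by omega) ρ w).tendsto_trunc hF)).sub
    (tendsto_finset_sum_of_dominated (t := fun s => s)
      (E := fun s ς => partialV V κ (Matrix.vecCons ς ρ) (F.trunc s) (Matrix.vecCons (a.entry ς) w))
      (e := fun ς => partialV V κ (Matrix.vecCons ς ρ) F (Matrix.vecCons (a.entry ς) w))
      hmem
      (hV.summable_first ρ w (by omega) a)
      (fun ς => (hV.entryContinuous hκ (by omega) _ _).tendsto_trunc hF)
      (fun s ς => hV.abs_first_le ρ w (by omega) (Stencil.trunc_mem hF) a ς))).sub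
    ((tendsto_finset_sum_of_dominated (t := fun s => s ×ˢ s)
      (E := fun s (p : LatStar d × LatStar d) =>
        partialV V κ (Matrix.vecCons p.1 (Matrix.vecCons p.2 ρ)) (F.trunc s)
          (Matrix.vecCons (a.entry p.1) (Matrix.vecCons (a.entry p.2) w)))
      (e := fun p => partialV V κ (Matrix.vecCons p.1 (Matrix.vecCons p.2 ρ)) F
          (Matrix.vecCons (a.entry p.1) (Matrix.vecCons (a.entry p.2) w)))
      (fun p => by
        filter_upwards [hmem p.1, hmem p.2] with s h1 h2
        exact Finset.mem_product.2 ⟨h1, h2⟩)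
      (hV.summable_remOne ρ w (by omega) a)
      (fun p => (hV.entryContinuous hκ (by omega) _ _).tendsto_trunc hF)
      (fun s p => hV.abs_second_le ρ w (by omega) (Stencil.trunc_mem hF) a p)).div_const 2)
  exact le_of_tendsto hlim.abs (Eventually.of_forall hfin)

/-- Linear functionals that agree on the increments between two points of `𝒟_κ` are equal. -/
theorem eq_of_eq_on_increments (hκ : 0 < κ) {L R : Stencil d →ₗ[ℝ] ℝ} {F : Stencil d}
    (h : ∀ G ∈ stencilBall d κ, L (G - F) = R (G - F)) : L = R := by
  have h0 := h 0 (by simp [stencilBall, hκ.le])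
  have hS : ∀ G ∈ stencilBall d κ, L G = R G := by
    intro G hG
    have := h G hG
    simp only [map_sub, map_zero] at this h0
    linarith
  ext g
  set c : ℝ := κ / (‖g‖ + 1) with hc
  have hc0 : 0 < c := by positivity
  have := hS (c • g) (mem_closedBall_zero_iff.2 (by
    rw [norm_smul, Real.norm_of_nonneg hc0.le, hc, div_mul_eq_mul_div, div_le_iff₀ (by positivity)]
    gcongr
    linarith))
  simp only [map_smul, smul_eq_mul] at this
  exact mul_left_cancel₀ hc0.ne' this

/-- A directional derivative of a partial derivative is the sum of its entrywise contributions: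
there is no contribution from infinity. -/
theorem IsSiteEnergy.siteDeriv_vecCons_eq_tsum (hV : IsSiteEnergy κ k V) (hκ : 0 < κ)
    (hj : j + 2 ≤ k) {F : Stencil d} (hF : F ∈ stencilBall d κ) (h : Stencil d) :
    siteDeriv V κ (j + 1) F (Matrix.vecCons h fun i => Stencil.single (ρ i) (w i))
      = ∑' ς, partialV V κ (Matrix.vecCons ς ρ) F (Matrix.vecCons (h.entry ς) w) := by
  set W : Fin j → Stencil d := fun i => Stencil.single (ρ i) (w i) with hW
  have hsum : ∀ h : Stencil d, Summable fun ς =>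
      partialV V κ (Matrix.vecCons ς ρ) F (Matrix.vecCons (h.entry ς) w) := fun h =>
    Summable.of_norm_bounded (hV.summable_first ρ w (by omega) h)
      fun ς => hV.abs_first_le ρ w (by omega) hF h ς
  let L : Stencil d →ₗ[ℝ] ℝ :=
    { toFun := fun h => siteDeriv V κ (j + 1) F (Matrix.vecCons h W)
      map_add' := fun x y => by simp [siteDeriv_vecCons]
      map_smul' := fun c x => by simp [siteDeriv_vecCons] }
  let R : Stencil d →ₗ[ℝ] ℝ :=
    { toFun := fun h => ∑' ς, partialV V κ (Matrix.vecCons ς ρ) F (Matrix.vecCons (h.entry ς) w)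
      map_add' := fun x y => by
        rw [← (hsum x).tsum_add (hsum y)]
        refine tsum_congr fun ς => ?_
        simp [partialV_vecCons_eq_curryLeft]
      map_smul' := fun c x => by
        rw [RingHom.id_apply, smul_eq_mul, ← tsum_mul_left]
        refine tsum_congr fun ς => ?_
        simp [partialV_vecCons_eq_curryLeft] }
  have hLR : L = R := by
    refine eq_of_eq_on_increments (F := F) hκ fun G hG => ?_
    have hFG : F + (G - F) ∈ stencilBall d κ := by rwa [add_sub_cancel]
    have h1 := hV.hasDerivWithinAt hκ (j := j) (by omega) hF hFG W (t := 0) (by simp)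
    simp only [zero_smul, add_zero] at h1
    refine eq_of_hasDerivWithinAt_of_sq_le h1 (C := ∑' p, remOne V κ ρ w (G - F) p)
      fun t ht => ?_
    have h2 := hV.abs_taylor_one_le ρ w hκ hj hF (add_smul_mem_stencilBall hF hFG ht)
    simp only [add_sub_cancel_left, remOne_smul ρ w _ ht.1, tsum_mul_left] at h2
    simp only [zero_smul, add_zero]
    have e : ∑' ς, partialV V κ (Matrix.vecCons ς ρ) F
        (Matrix.vecCons ((t • (G - F)).entry ς) w) = t * R (G - F) := map_smul R t (G - F)
    rw [e] at h2
    exact h2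
  exact congrArg (fun L => L h) hLR

end SiteEnergy

/-! ### First and second derivatives as sums over bonds -/

section SiteEnergy

variable {d : ℕ} {κ : ℝ} {k : ℕ} {V : Stencil d → EReal}

theorem siteDeriv_two_apply (g h h' : Stencil d) :
    siteDeriv V κ 2 g ![h', h] = (siteDeriv V κ 2 g).curryLeft h' ![h] := rfl

theorem IsSiteEnergy.siteDeriv_one_eq_tsum (hV : IsSiteEnergy κ k V) (hκ : 0 < κ)
    (hk : 4 ≤ k) {F : Stencil d} (hF : F ∈ stencilBall d κ) (h : Stencil d) :
    siteDeriv V κ 1 F ![h] = ∑' ς, partialV V κ ![ς] F ![h.entry ς] := by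
  have := hV.siteDeriv_vecCons_eq_tsum (j := 0) ![] ![] hκ (by omega) hF h
  rw [← this]
  congr 2
  exact Subsingleton.elim _ _

theorem IsSiteEnergy.summable_one (hV : IsSiteEnergy κ k V) (hk : 4 ≤ k) {F : Stencil d}
    (hF : F ∈ stencilBall d κ) (h : Stencil d) :
    Summable fun ς => partialV V κ ![ς] F ![h.entry ς] :=
  Summable.of_norm_bounded (hV.summable_first ![] ![] (by omega) h)
      fun ς => hV.abs_first_le ![] ![] (by omega) hF h ς

theorem IsSiteEnergy.summable_two (hV : IsSiteEnergy κ k V) (hk : 4 ≤ k) {F : Stencil d}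
    (hF : F ∈ stencilBall d κ) (h' h : Stencil d) :
    Summable fun p : LatStar d × LatStar d =>
      partialV V κ ![p.2, p.1] F ![h'.entry p.2, h.entry p.1] := by
  have hs := hV.summable_mul (j := 2) (by omega) (by omega)
    (e := fun p : LatStar d × LatStar d => ![p.2, p.1])
    (fun a b h => Prod.ext (by simpa using congrFun h 1) (by simpa using congrFun h 0))
    (y := fun p => ‖h'.entry p.2‖ * ‖h.entry p.1‖) (‖h'‖ * ‖h‖) (fun p => by positivity)
    (fun p => by
      simp only [Fin.prod_univ_two, Matrix.cons_val_zero, Matrix.cons_val_one]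
      calc ‖h'.entry p.2‖ * ‖h.entry p.1‖ ≤ (‖h'‖ * ‖dirVec p.2‖) * (‖h‖ * ‖dirVec p.1‖) := by
            gcongr <;> exact Stencil.entry_le _ _
        _ = _ := by ring)
  refine Summable.of_norm_bounded hs fun p => ?_
  have := hV.abs_partialV_le (j := 2) (by omega) (by omega) ![p.2, p.1] hF
    ![h'.entry p.2, h.entry p.1]
  simpa [Fin.prod_univ_two] using this

theorem IsSiteEnergy.summable_rem_entry (hV : IsSiteEnergy κ k V) (hk : 4 ≤ k) (a h : Stencil d) :
    Summable fun q : LatStar d × LatStar d × LatStar d =>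
      remOne V κ ![q.1] ![h.entry q.1] a q.2 := by
  have hs := hV.summable_mul (j := 3) (by omega) (by omega)
    (e := fun q : LatStar d × LatStar d × LatStar d => ![q.2.1, q.2.2, q.1])
    (fun a b h => Prod.ext (by simpa using congrFun h 2)
      (Prod.ext (by simpa using congrFun h 0) (by simpa using congrFun h 1)))
    (y := fun q => ‖a.entry q.2.1‖ * ‖a.entry q.2.2‖ * ‖h.entry q.1‖) (‖a‖ * ‖a‖ * ‖h‖)
    (fun p => by positivity)
    (fun q => by
      simp only [Fin.prod_univ_three, Matrix.cons_val_zero, Matrix.cons_val_one,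
        Matrix.cons_val_two, Matrix.tail_cons, Matrix.head_cons]
      calc ‖a.entry q.2.1‖ * ‖a.entry q.2.2‖ * ‖h.entry q.1‖
          ≤ (‖a‖ * ‖dirVec q.2.1‖) * (‖a‖ * ‖dirVec q.2.2‖) * (‖h‖ * ‖dirVec q.1‖) := by
            gcongr <;> exact Stencil.entry_le _ _
        _ = _ := by ring)
  refine hs.congr fun q => ?_
  simp [remOne]

/-- The second derivative along two stencils, neither of them finitely supported, is the double sum
of its entries. This is applied to the homogeneous stencils occurring in `div S^c`. -/
theorem IsSiteEnergy.siteDeriv_two_eq_tsum (hV : IsSiteEnergy κ k V) (hκ : 0 < κ)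
    (hk : 4 ≤ k) {F : Stencil d} (hF : F ∈ stencilBall d κ) (h' h : Stencil d) :
    siteDeriv V κ 2 F ![h', h] = ∑' p : LatStar d × LatStar d,
      partialV V κ ![p.2, p.1] F ![h'.entry p.2, h.entry p.1] := by
  let L : Stencil d →ₗ[ℝ] ℝ :=
    { toFun := fun h' => siteDeriv V κ 2 F ![h', h]
      map_add' := fun x y => by simp only [siteDeriv_two_apply, map_add, add_apply]
      map_smul' := fun c x => by
        simp only [siteDeriv_two_apply, map_smul, smul_apply, RingHom.id_apply] }
  have hcur : ∀ (p : LatStar d × LatStar d) (x y : Eu d), partialV V κ ![p.2, p.1] F ![x, y]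
      = (partialV V κ ![p.2, p.1] F).curryLeft x ![y] := fun _ _ _ => rfl
  let R : Stencil d →ₗ[ℝ] ℝ :=
    { toFun := fun h' => ∑' p : LatStar d × LatStar d,
        partialV V κ ![p.2, p.1] F ![h'.entry p.2, h.entry p.1]
      map_add' := fun x y => by
        rw [← (hV.summable_two hk hF x h).tsum_add (hV.summable_two hk hF y h)]
        refine tsum_congr fun p => ?_
        simp only [hcur, Stencil.entry_add, map_add, add_apply]
      map_smul' := fun c x => by
        rw [RingHom.id_apply, smul_eq_mul, ← tsum_mul_left]
        refine tsum_congr fun p => ?_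
        simp only [hcur, Stencil.entry_smul, map_smul, smul_apply, smul_eq_mul] }
  have hLR : L = R := by
    refine eq_of_eq_on_increments (F := F) hκ fun G hG => ?_
    have hFG : F + (G - F) ∈ stencilBall d κ := by rwa [add_sub_cancel]
    have h1 := hV.hasDerivWithinAt hκ (j := 1) (by omega) hF hFG ![h] (t := 0) (by simp)
    simp only [zero_smul, add_zero] at h1
    have hrem := hV.summable_rem_entry hk (G - F) h
    refine eq_of_hasDerivWithinAt_of_sq_le h1
      (C := ∑' q : LatStar d × LatStar d × LatStar d,
        remOne V κ ![q.1] ![h.entry q.1] (G - F) q.2) fun t ht => ?_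
    have hm := add_smul_mem_stencilBall hF hFG ht
    have h2 : ∀ ρ, |partialV V κ ![ρ] (F + t • (G - F)) ![h.entry ρ]
        - partialV V κ ![ρ] F ![h.entry ρ] - ∑' ς, partialV V κ ![ς, ρ] F
          ![(t • (G - F)).entry ς, h.entry ρ]|
        ≤ t ^ 2 * ∑' p, remOne V κ ![ρ] ![h.entry ρ] (G - F) p := by
      intro ρ
      have h2 := hV.abs_taylor_one_le ![ρ] ![h.entry ρ] hκ (by omega) hF hm
      simp only [add_sub_cancel_left, remOne_smul _ _ _ ht.1, tsum_mul_left] at h2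
      exact h2
    have hR : t * R (G - F) = ∑' ρ, ∑' ς, partialV V κ ![ς, ρ] F
          ![(t • (G - F)).entry ς, h.entry ρ] := by
      rw [← smul_eq_mul, ← map_smul]
      exact (hV.summable_two hk hF (t • (G - F)) h).tsum_prod
    have hRs := (hV.summable_two hk hF (t • (G - F)) h).prod
    have hs1 := hV.summable_one hk hm h
    have hs0 := hV.summable_one hk hF h
    simp only [zero_smul, add_zero]
    rw [hV.siteDeriv_one_eq_tsum hκ hk hm, hV.siteDeriv_one_eq_tsum hκ hk hF, hR,
      ← hs1.tsum_sub hs0, ← (hs1.sub hs0).tsum_sub hRs, hrem.tsum_prod, ← tsum_mul_left,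
      ← Real.norm_eq_abs]
    exact tsum_of_norm_bounded (hrem.prod.mul_left (t ^ 2)).hasSum h2
  exact congrArg (fun L => L h') hLR

/-! ### Symmetries of the partial derivatives -/

theorem IsSiteEnergy.partialV_swap (hV : IsSiteEnergy κ k V) (hκ : 0 < κ) {j : ℕ} (hj : j + 2 ≤ k)
    (σ τ : LatStar d) (ρ : Fin j → LatStar d) {g : Stencil d} (hg : g ∈ stencilBall d κ)
    (x y : Eu d) (w : Fin j → Eu d) :
    partialV V κ (Matrix.vecCons σ (Matrix.vecCons τ ρ)) g (Matrix.vecCons x (Matrix.vecCons y w))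
      = partialV V κ (Matrix.vecCons τ (Matrix.vecCons σ ρ)) g
        (Matrix.vecCons y (Matrix.vecCons x w)) := by
  rw [partialV_vecCons₂, partialV_vecCons₂]
  exact iteratedFDerivWithin_swap hV.smooth (by exact_mod_cast hj) (convex_stencilBall κ)
    (interior_stencilBall_nonempty hκ) hg _ _ _

/-- The partial derivatives in the directions `ρ` agree with those in the directions `ρ'` after
rearranging the arguments. -/
def PartialRel (V : Stencil d → EReal) (κ : ℝ) {j : ℕ} (ρ ρ' : Fin j → LatStar d) : Prop :=
  ∀ w : Fin j → Eu d, ∃ w' : Fin j → Eu d, ∏ i, ‖w' i‖ = ∏ i, ‖w i‖ ∧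
    ∀ g ∈ stencilBall d κ, partialV V κ ρ g w = partialV V κ ρ' g w'

theorem PartialRel.trans {j : ℕ} {ρ ρ' ρ'' : Fin j → LatStar d} (h : PartialRel V κ ρ ρ')
    (h' : PartialRel V κ ρ' ρ'') : PartialRel V κ ρ ρ'' := by
  intro w
  obtain ⟨w', h1, h2⟩ := h w
  obtain ⟨w'', h3, h4⟩ := h' w'
  exact ⟨w'', h3.trans h1, fun g hg => (h2 g hg).trans (h4 g hg)⟩

theorem IsSiteEnergy.partialRel_swap (hV : IsSiteEnergy κ k V) (hκ : 0 < κ) {j : ℕ}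
    (hj : j + 2 ≤ k) (σ τ : LatStar d) (ρ : Fin j → LatStar d) :
    PartialRel V κ (Matrix.vecCons σ (Matrix.vecCons τ ρ))
      (Matrix.vecCons τ (Matrix.vecCons σ ρ)) := by
  intro w
  refine ⟨Matrix.vecCons (w 1) (Matrix.vecCons (w 0) (fun i => w i.succ.succ)), ?_, fun g hg => ?_⟩
  · simp only [Fin.prod_univ_succ, Matrix.cons_val_zero, Matrix.cons_val_succ, Fin.succ_zero_eq_one]
    ring
  · rw [← hV.partialV_swap hκ hj σ τ ρ hg]
    congr 1
    funext i
    refine Fin.cases (by simp) (fun i => ?_) i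
    refine Fin.cases (by simp) (fun i => by simp) i

theorem IsSiteEnergy.partialRel_cons (hV : IsSiteEnergy κ k V) (hκ : 0 < κ) {j : ℕ}
    (hj : j + 1 ≤ k) (σ : LatStar d) {ρ ρ' : Fin j → LatStar d} (h : PartialRel V κ ρ ρ') :
    PartialRel V κ (Matrix.vecCons σ ρ) (Matrix.vecCons σ ρ') := by
  intro w
  obtain ⟨w', h1, h2⟩ := h (fun i => w i.succ)
  refine ⟨Matrix.vecCons (w 0) w', ?_, fun g hg => ?_⟩
  · simp only [Fin.prod_univ_succ, Matrix.cons_val_zero, Matrix.cons_val_succ, h1]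
  · have e : w = Matrix.vecCons (w 0) (fun i => w i.succ) := (Fin.cons_self_tail w).symm
    conv_lhs => rw [e]
    rw [partialV_vecCons, partialV_vecCons]
    exact iteratedFDerivWithin_cons_congr hV.smooth (by exact_mod_cast hj)
      (uniqueDiffOn_stencilBall hκ) (fun y hy => h2 y hy) hg _

theorem IsSiteEnergy.partialSup_le_of_rel (hV : IsSiteEnergy κ k V) {j : ℕ} (h1 : 1 ≤ j)
    (hj : j ≤ k) {ρ ρ' : Fin j → LatStar d} (h : PartialRel V κ ρ ρ') :
    partialSup V κ ρ ≤ partialSup V κ ρ' := by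
  refine ENNReal.toReal_mono (hV.iSup_ne_top h1 hj ρ') (iSup₂_le fun g hg => ?_)
  refine le_trans ?_ (le_iSup₂ (f := fun g (_ : g ∈ stencilBall d κ) => ‖partialV V κ ρ' g‖ₑ) g hg)
  rw [enorm_le_iff_norm_le]
  refine ContinuousMultilinearMap.opNorm_le_bound (norm_nonneg _) fun w => ?_
  obtain ⟨w', h2, h3⟩ := h w
  rw [h3 g hg, ← h2]
  exact (partialV V κ ρ' g).le_opNorm w'

/-- The expansion of `V_ρ` produces derivatives whose last direction is `ρ`, whereas the weights
`m_d` single out the first direction. This lemma and the following ones move `ρ` to the front. -/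
theorem IsSiteEnergy.partialSup_two_le (hV : IsSiteEnergy κ k V) (hκ : 0 < κ) (hk : 4 ≤ k)
    (ς ρ : LatStar d) : partialSup V κ ![ς, ρ] ≤ partialSup V κ ![ρ, ς] :=
  hV.partialSup_le_of_rel (by omega) (by omega) (hV.partialRel_swap hκ (by omega) ς ρ ![])

theorem IsSiteEnergy.partialSup_three_le (hV : IsSiteEnergy κ k V) (hκ : 0 < κ) (hk : 4 ≤ k)
    (τ ς ρ : LatStar d) : partialSup V κ ![τ, ς, ρ] ≤ partialSup V κ ![ρ, τ, ς] :=
  hV.partialSup_le_of_rel (by omega) (by omega)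
    ((hV.partialRel_cons hκ (by omega) τ (hV.partialRel_swap hκ (by omega) ς ρ ![])).trans
      (hV.partialRel_swap hκ (by omega) τ ρ ![ς]))

theorem IsSiteEnergy.partialSup_three_le' (hV : IsSiteEnergy κ k V) (hκ : 0 < κ) (hk : 4 ≤ k)
    (τ ς ρ : LatStar d) : partialSup V κ ![τ, ς, ρ] ≤ partialSup V κ ![ρ, ς, τ] :=
  (hV.partialSup_le_of_rel (by omega) (by omega)
    (hV.partialRel_swap hκ (by omega) τ ς ![ρ])).trans (hV.partialSup_three_le hκ hk ς τ ρ)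

theorem IsSiteEnergy.partialSup_four_le (hV : IsSiteEnergy κ k V) (hκ : 0 < κ) (hk : 4 ≤ k)
    (σ τ ς ρ : LatStar d) : partialSup V κ ![σ, τ, ς, ρ] ≤ partialSup V κ ![ρ, σ, τ, ς] :=
  hV.partialSup_le_of_rel (by omega) (by omega)
    ((hV.partialRel_cons hκ (by omega) σ
      ((hV.partialRel_cons hκ (by omega) τ (hV.partialRel_swap hκ (by omega) ς ρ ![])).trans
        (hV.partialRel_swap hκ (by omega) τ ρ ![ς]))).trans
      (hV.partialRel_swap hκ (by omega) σ ρ ![τ, ς]))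

/-- The point reflection as a bounded linear map. -/
def Stencil.reflectL (d : ℕ) : Stencil d →L[ℝ] Stencil d :=
  LinearMap.mkContinuous
    { toFun := fun g => g.reflect
      map_add' := fun g h => Stencil.ext_entry fun ρ => by
        change -(g.entry _ + h.entry _) = -g.entry _ + -h.entry _
        abel
      map_smul' := fun c g => Stencil.ext_entry fun ρ => by
        change -(c • g.entry _) = c • -g.entry _
        rw [smul_neg] } 1 (fun g => by
      refine Stencil.norm_le _ (by positivity) fun ρ => ?_
      change ‖-g.entry (negDir ρ)‖ ≤ _
      rw [norm_neg, one_mul]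
      have := Stencil.entry_le g (negDir ρ)
      rwa [dirVec_negDir, norm_neg] at this)

theorem negDir_negDir (ρ : LatStar d) : negDir (negDir ρ) = ρ := Subtype.ext (neg_neg _)

theorem Stencil.entry_reflectL (g : Stencil d) (ρ : LatStar d) :
    (reflectL d g).entry ρ = -g.entry (negDir ρ) := rfl

theorem Stencil.reflectL_reflectL (g : Stencil d) : reflectL d (reflectL d g) = g :=
  ext_entry fun ρ => by simp only [entry_reflectL, neg_neg, negDir_negDir]

theorem Stencil.norm_reflectL (g : Stencil d) : ‖reflectL d g‖ = ‖g‖ := by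
  have h : ∀ g : Stencil d, ‖reflectL d g‖ ≤ ‖g‖ := fun g => by
    refine norm_le _ (norm_nonneg g) fun ρ => ?_
    rw [entry_reflectL, norm_neg]
    have := Stencil.entry_le g (negDir ρ)
    rwa [dirVec_negDir, norm_neg] at this
  refine le_antisymm (h g) ?_
  have := h (reflectL d g)
  rwa [reflectL_reflectL] at this

theorem Stencil.reflectL_single (ρ : LatStar d) (v : Eu d) :
    reflectL d (single ρ v) = -single (negDir ρ) v := by
  rw [← map_neg]
  refine ext_entry fun σ => ?_
  rw [entry_reflectL]
  by_cases h : σ = negDir ρ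
  · subst h; rw [negDir_negDir, entry_single_self, entry_single_self]
  · rw [entry_single_of_ne h, entry_single_of_ne (fun e => h (by rw [← e, negDir_negDir])),
      neg_zero]

theorem entry_homStencil (A : Eu d →L[ℝ] Eu d) (ρ : LatStar d) :
    (homStencil A).entry ρ = A (dirVec ρ) := rfl

theorem reflectL_homStencil (A : Eu d →L[ℝ] Eu d) :
    Stencil.reflectL d (homStencil A) = homStencil A :=
  Stencil.ext_entry fun ρ => by
    rw [Stencil.entry_reflectL, entry_homStencil, entry_homStencil, dirVec_negDir, map_neg, neg_neg]

/-- At a homogeneous stencil, the partial derivatives of odd order are odd and those of even order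
are even under point reflection of the directions. -/
theorem IsSiteEnergy.partialV_negDir (hV : IsSiteEnergy κ k V) (hκ : 0 < κ) {j : ℕ} (hj : j ≤ k)
    (ρ : Fin j → LatStar d) {A : Eu d →L[ℝ] Eu d} (hA : homStencil A ∈ stencilBall d κ)
    (w : Fin j → Eu d) :
    partialV V κ (fun i => negDir (ρ i)) (homStencil A) w
      = (-1) ^ j * partialV V κ ρ (homStencil A) w := by
  have hpre : Stencil.reflectL d ⁻¹' stencilBall d κ = stencilBall d κ := by
    ext g
    simp [stencilBall, Stencil.norm_reflectL]
  have hcomp : (fun g => (V g).toReal) ∘ Stencil.reflectL d = fun g => (V g).toReal := by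
    funext g
    exact congrArg EReal.toReal (hV.symm g)
  have h := (Stencil.reflectL d).iteratedFDerivWithin_comp_right (i := j) hV.smooth
    (uniqueDiffOn_stencilBall hκ) (by rw [hpre]; exact uniqueDiffOn_stencilBall hκ)
    (x := homStencil A) (by rwa [reflectL_homStencil]) (by exact_mod_cast hj)
  rw [hpre, hcomp, reflectL_homStencil] at h
  rw [partialV_apply, partialV_apply]
  unfold siteDeriv
  conv_rhs => rw [h]
  simp only [ContinuousMultilinearMap.compContinuousLinearMap_apply, Stencil.reflectL_single]
  have h2 := (iteratedFDerivWithin ℝ j (fun g => (V g).toReal) (stencilBall d κ)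
    (homStencil A)).map_smul_univ (fun _ => -1) (fun i => Stencil.single (negDir (ρ i)) (w i))
  simp only [neg_smul, one_smul, Finset.prod_const, Finset.card_univ, Fintype.card_fin,
    smul_eq_mul] at h2
  rw [h2, ← mul_assoc, ← mul_pow]
  simp

end SiteEnergy

/-! ### Lattice sums against the nodal basis function -/

section LatticeSums

variable {d : ℕ} {ζ : Eu d → ℝ} {c : ℝ}

theorem finite_setOf_norm_latVec_sub_le (x : Eu d) (r : ℝ) :
    {ξ : ZLat d | ‖latVec ξ - x‖ ≤ r}.Finite := by
  refine (finite_Icc (fun i => ⌈x i - r⌉) (fun i => ⌊x i + r⌋)).subset fun ξ hξ => ?_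
  have h : ∀ i, |(ξ i : ℝ) - x i| ≤ r := fun i =>
    (PiLp.norm_apply_le (latVec ξ - x) i).trans hξ
  exact ⟨fun i => Int.ceil_le.2 (by linarith [(abs_le.1 (h i)).1]),
    fun i => Int.le_floor.2 (by linarith [(abs_le.1 (h i)).2])⟩

/-- The lattice points at distance at most `r` from `x`. -/
def latNear (x : Eu d) (r : ℝ) : Finset (ZLat d) := (finite_setOf_norm_latVec_sub_le x r).toFinset

theorem mem_latNear {x : Eu d} {r : ℝ} {ξ : ZLat d} : ξ ∈ latNear x r ↔ ‖latVec ξ - x‖ ≤ r := by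
  simp [latNear]

theorem eq_zero_of_notMem_latNear (hsupp : Function.support ζ ⊆ Metric.closedBall 0 c)
    {x : Eu d} {ξ : ZLat d} (h : ξ ∉ latNear x c) : ζ (latVec ξ - x) = 0 := by
  by_contra h0
  exact h (mem_latNear.2 (mem_closedBall_zero_iff.1 (hsupp h0)))

/-- The superposition `∑_ξ a_ξ ζ(ξ - z)` of translated nodal basis functions. -/
def latSum (ζ : Eu d → ℝ) (a : ZLat d → ℝ) (z : Eu d) : ℝ := ∑' ξ, a ξ * ζ (latVec ξ - z)

theorem latSum_eq_sum (hsupp : Function.support ζ ⊆ Metric.closedBall 0 c) (a : ZLat d → ℝ)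
    (z : Eu d) : latSum ζ a z = ∑ ξ ∈ latNear z c, a ξ * ζ (latVec ξ - z) :=
  tsum_eq_sum fun ξ hξ => by rw [eq_zero_of_notMem_latNear hsupp hξ, mul_zero]

theorem latSum_eq_sum_of_subset (hsupp : Function.support ζ ⊆ Metric.closedBall 0 c)
    (a : ZLat d → ℝ) (z : Eu d) {s : Finset (ZLat d)} (hs : latNear z c ⊆ s) :
    latSum ζ a z = ∑ ξ ∈ s, a ξ * ζ (latVec ξ - z) :=
  tsum_eq_sum fun ξ hξ => by
    rw [eq_zero_of_notMem_latNear hsupp (fun h => hξ (hs h)), mul_zero]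

theorem continuous_latSum (hζ : Continuous ζ)
    (hsupp : Function.support ζ ⊆ Metric.closedBall 0 c) (a : ZLat d → ℝ) :
    Continuous (latSum ζ a) := by
  have h : latSum ζ a = fun z => ∑ᶠ ξ, a ξ * ζ (latVec ξ - z) := by
    funext z
    refine tsum_eq_finsum ((latNear z c).finite_toSet.subset fun ξ hξ => ?_)
    by_contra h
    exact hξ (by simp only [eq_zero_of_notMem_latNear hsupp h, mul_zero])
  rw [h]
  refine continuous_finsum (fun ξ => by fun_prop) fun x => ⟨Metric.ball x 1,
    Metric.ball_mem_nhds x one_pos, ?_⟩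
  refine (latNear x (c + 1)).finite_toSet.subset ?_
  rintro ξ ⟨z, hz, hzx⟩
  have h1 : ξ ∈ latNear z c := by
    by_contra h
    exact hz (by simp only [eq_zero_of_notMem_latNear hsupp h, mul_zero])
  rw [mem_latNear] at h1
  rw [Metric.mem_ball, dist_eq_norm] at hzx
  refine Finset.mem_coe.2 (mem_latNear.2 ?_)
  have := norm_add_le (latVec ξ - z) (z - x)
  rw [sub_add_sub_cancel] at this
  linarith

theorem IsNodalBasis.sum_affine (hζ : IsNodalBasis ζ)
    (hsupp : Function.support ζ ⊆ Metric.closedBall 0 c) (a : ℝ) (b x : Eu d) :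
    ∑ ξ ∈ latNear x c, (a + inner ℝ b (latVec ξ)) * ζ (latVec ξ - x) = a + inner ℝ b x := by
  rw [← hζ.affine a b x]
  have e : ∀ ξ, ζ (x - latVec ξ) = ζ (latVec ξ - x) := fun ξ => by
    rw [← hζ.even, neg_sub]
  simp only [e]
  exact (tsum_eq_sum fun ξ hξ => by rw [eq_zero_of_notMem_latNear hsupp hξ, mul_zero]).symm

theorem IsNodalBasis.sum_eq_one (hζ : IsNodalBasis ζ)
    (hsupp : Function.support ζ ⊆ Metric.closedBall 0 c) (x : Eu d) :
    ∑ ξ ∈ latNear x c, ζ (latVec ξ - x) = 1 := by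
  simpa using hζ.sum_affine hsupp 1 0 x

theorem IsNodalBasis.latSum_one (hζ : IsNodalBasis ζ)
    (hsupp : Function.support ζ ⊆ Metric.closedBall 0 c) (x : Eu d) :
    latSum ζ (fun _ => 1) x = 1 := by
  rw [latSum_eq_sum hsupp]
  simpa using hζ.sum_eq_one hsupp x

/-- The first moment of the nodal weights vanishes. -/
theorem IsNodalBasis.sum_linear (hζ : IsNodalBasis ζ)
    (hsupp : Function.support ζ ⊆ Metric.closedBall 0 c) (x : Eu d) (L : Eu d →ₗ[ℝ] ℝ) :
    ∑ ξ ∈ latNear x c, ζ (latVec ξ - x) * L (latVec ξ - x) = 0 := by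
  obtain ⟨b, hb⟩ : ∃ b : Eu d, ∀ y, inner ℝ b y = L y :=
    ⟨(InnerProductSpace.toDual ℝ (Eu d)).symm (LinearMap.toContinuousLinearMap L),
      fun y => by rw [InnerProductSpace.toDual_symm_apply]; rfl⟩
  have h := hζ.sum_affine hsupp (-inner ℝ b x) b x
  rw [neg_add_cancel] at h
  rw [← h]
  refine Finset.sum_congr rfl fun ξ _ => ?_
  rw [← hb, inner_sub_right]
  ring

theorem IsNodalBasis.abs_latSum_le (hζ : IsNodalBasis ζ)
    (hsupp : Function.support ζ ⊆ Metric.closedBall 0 c) {a : ZLat d → ℝ} {A : ℝ}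
    (ha : ∀ ξ, |a ξ| ≤ A) (z : Eu d) : |latSum ζ a z| ≤ A := by
  rw [latSum_eq_sum hsupp]
  refine (Finset.abs_sum_le_sum_abs _ _).trans ?_
  calc ∑ ξ ∈ latNear z c, |a ξ * ζ (latVec ξ - z)|
      ≤ ∑ ξ ∈ latNear z c, A * ζ (latVec ξ - z) := by
        refine Finset.sum_le_sum fun ξ _ => ?_
        rw [abs_mul, abs_of_nonneg (hζ.nonneg _)]
        exact mul_le_mul_of_nonneg_right (ha ξ) (hζ.nonneg _)
    _ = A := by rw [← Finset.mul_sum, hζ.sum_eq_one hsupp, mul_one]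

theorem latVec_sub (ξ η : ZLat d) : latVec (ξ - η) = latVec ξ - latVec η := by
  ext i; simp [latVec]

theorem latSum_sub_dirVec (a : ZLat d → ℝ) (ρ : LatStar d) (x : Eu d) :
    latSum ζ a (x - dirVec ρ) = latSum ζ (fun ξ => a (ξ - ρ.1)) x := by
  unfold latSum
  rw [← (Equiv.subRight ρ.1).tsum_eq fun ξ => a ξ * ζ (latVec ξ - (x - dirVec ρ))]
  refine tsum_congr fun ξ => ?_
  rw [Equiv.subRight_apply, latVec_sub]
  congr 2
  change latVec ξ - dirVec ρ - (x - dirVec ρ) = _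
  abel

/-- Against the kernels `χ_{ξ,ρ}`, nodal values sum to the average of their nodal interpolant over
the bond. -/
theorem hasSum_chi (hζ : Continuous ζ)
    (hsupp : Function.support ζ ⊆ Metric.closedBall 0 c) (a : ZLat d → ℝ) (ρ : LatStar d)
    (x : Eu d) :
    HasSum (fun ξ => a ξ * chi ζ ξ ρ x) (∫ t in (0 : ℝ)..1, latSum ζ a (x - t • dirVec ρ)) := by
  set s := latNear x (c + ‖dirVec ρ‖) with hs
  have hsub : ∀ t ∈ Icc (0 : ℝ) 1, latNear (x - t • dirVec ρ) c ⊆ s := by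
    intro t ht ξ hξ
    rw [mem_latNear] at hξ
    rw [hs, mem_latNear]
    have h1 := norm_sub_le (latVec ξ - (x - t • dirVec ρ)) (t • dirVec ρ)
    have h2 : ‖t • dirVec ρ‖ ≤ ‖dirVec ρ‖ := by
      rw [norm_smul, Real.norm_of_nonneg ht.1]
      exact mul_le_of_le_one_left (norm_nonneg _) ht.2
    have e : latVec ξ - (x - t • dirVec ρ) - t • dirVec ρ = latVec ξ - x := by abel
    rw [e] at h1
    linarith
  have harg : ∀ ξ (t : ℝ), latVec ξ + t • dirVec ρ - x = latVec ξ - (x - t • dirVec ρ) :=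
    fun ξ t => by abel
  have h0 : ∀ ξ ∉ s, a ξ * chi ζ ξ ρ x = 0 := by
    intro ξ hξ
    have : chi ζ ξ ρ x = 0 := by
      unfold chi
      rw [intervalIntegral.integral_congr (g := fun _ => 0)]
      · simp
      · intro t ht
        rw [uIcc_of_le zero_le_one] at ht
        simp only [harg]
        exact eq_zero_of_notMem_latNear hsupp fun h => hξ (hsub t ht h)
    rw [this, mul_zero]
  have h1 : ∫ t in (0 : ℝ)..1, latSum ζ a (x - t • dirVec ρ) = ∑ ξ ∈ s, a ξ * chi ζ ξ ρ x := by
    rw [intervalIntegral.integral_congr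
      (g := fun t => ∑ ξ ∈ s, a ξ * ζ (latVec ξ + t • dirVec ρ - x))]
    · rw [intervalIntegral.integral_finsetSum]
      · refine Finset.sum_congr rfl fun ξ _ => ?_
        rw [intervalIntegral.integral_const_mul]
        rfl
      · intro ξ _
        exact Continuous.intervalIntegrable (by fun_prop) _ _
    · intro t ht
      rw [uIcc_of_le zero_le_one] at ht
      simp only [harg]
      exact latSum_eq_sum_of_subset hsupp a _ (hsub t ht)
  rw [h1]
  exact hasSum_sum_of_ne_finset_zero h0

theorem integrable_prod_of_eq_zero {f : Eu d × ℝ → ℝ} (hf : Continuous f) {R : ℝ}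
    (h0 : ∀ x t, t ∈ Icc (0 : ℝ) 1 → R < ‖x‖ → f (x, t) = 0) :
    Integrable f ((volume : Measure (Eu d)).prod (volume.restrict (Ioc (0 : ℝ) 1))) := by
  have hK : IsCompact ((Metric.closedBall (0 : Eu d) R) ×ˢ Icc (0 : ℝ) 1) :=
    (isCompact_closedBall _ _).prod isCompact_Icc
  have h1 : IntegrableOn f ((Metric.closedBall (0 : Eu d) R) ×ˢ Icc (0 : ℝ) 1)
      (volume.prod volume) := hf.continuousOn.integrableOn_compact hK
  have h2 : IntegrableOn f (univ ×ˢ Icc (0 : ℝ) 1) (volume.prod volume) := by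
    refine h1.of_forall_sdiff_eq_zero (MeasurableSet.univ.prod measurableSet_Icc) ?_
    rintro ⟨x, t⟩ ⟨⟨-, ht⟩, hn⟩
    refine h0 x t ht ?_
    by_contra hle
    exact hn ⟨by simpa using hle, ht⟩
  have h3 : IntegrableOn f (univ ×ˢ Ioc (0 : ℝ) 1) (volume.prod volume) :=
    h2.mono_set (prod_mono_right Ioc_subset_Icc_self)
  rw [IntegrableOn, ← Measure.prod_restrict, Measure.restrict_univ] at h3
  exact h3

/-- The average of `q` over the segments `[x - r, x]` has the distributional derivative
`q(x) - q(x - r)` in the direction `r`. -/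
theorem integral_segmentAverage_mul_fderiv {q φ : Eu d → ℝ} (hq : Continuous q)
    (hφ : ContDiff ℝ ∞ φ) (hφc : HasCompactSupport φ) (r : Eu d) :
    ∫ x, (∫ t in (0 : ℝ)..1, q (x - t • r)) * fderiv ℝ φ x r
      = -∫ x, (q x - q (x - r)) * φ x := by
  have hd : Continuous (fun x => fderiv ℝ φ x r) :=
    (hφ.continuous_fderiv (by simp)).clm_apply continuous_const
  have hdc : HasCompactSupport (fun x => fderiv ℝ φ x r) := hφc.fderiv_apply ℝ r
  obtain ⟨R, hR⟩ := hdc.isCompact.isBounded.exists_norm_le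
  have hz : ∀ x, R < ‖x‖ → fderiv ℝ φ x r = 0 := fun x hx => by
    by_contra h
    exact absurd (hR x (subset_tsupport _ h)) (not_le.2 hx)
  have i1 := integrable_prod_of_eq_zero (d := d) (R := R)
    (f := fun p => q (p.1 - p.2 • r) * fderiv ℝ φ p.1 r)
    ((hq.comp (by fun_prop)).mul (hd.comp continuous_fst))
    (fun x t _ hx => by simp only [hz x hx, mul_zero])
  have i2 := integrable_prod_of_eq_zero (d := d) (R := R + ‖r‖)
    (f := fun p => q p.1 * fderiv ℝ φ (p.1 + p.2 • r) r)
    ((hq.comp continuous_fst).mul (hd.comp (by fun_prop)))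
    (fun x t ht hx => by
      have h1 := norm_sub_le (x + t • r) (t • r)
      rw [add_sub_cancel_right] at h1
      have h2 : ‖t • r‖ ≤ ‖r‖ := by
        rw [norm_smul, Real.norm_of_nonneg ht.1]
        exact mul_le_of_le_one_left (norm_nonneg _) ht.2
      simp only [hz (x + t • r) (by linarith), mul_zero])
  have e0 : ∀ t : ℝ, ∫ x, q (x - t • r) * fderiv ℝ φ x r
      = ∫ z, q z * fderiv ℝ φ (z + t • r) r := by
    intro t
    rw [← integral_add_right_eq_self (fun x => q (x - t • r) * fderiv ℝ φ x r) (t • r)]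
    simp only [add_sub_cancel_right]
  have e1 : ∫ x, (∫ t in (0 : ℝ)..1, q (x - t • r)) * fderiv ℝ φ x r
      = ∫ z, q z * (φ (z + r) - φ z) := by
    simp only [intervalIntegral.integral_of_le zero_le_one, ← integral_mul_const]
    rw [integral_integral_swap i1]
    simp only [e0]
    rw [← integral_integral_swap i2]
    refine integral_congr_ae (Eventually.of_forall fun z => ?_)
    simp only
    rw [integral_const_mul, ← intervalIntegral.integral_of_le zero_le_one]
    congr 1
    have hder : ∀ t ∈ uIcc (0 : ℝ) 1, HasDerivAt (fun t : ℝ => φ (z + t • r))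
        (fderiv ℝ φ (z + t • r) r) t := by
      intro t _
      have h1 : HasDerivAt (fun t : ℝ => z + t • r) r t := by
        simpa using ((hasDerivAt_id t).smul_const r).const_add z
      exact ((hφ.differentiable (by simp)) (z + t • r)).hasFDerivAt.comp_hasDerivAt t h1
    rw [intervalIntegral.integral_eq_sub_of_hasDerivAt hder
      (Continuous.intervalIntegrable (hd.comp (by fun_prop)) _ _)]
    simp
  rw [e1]
  have hsh : HasCompactSupport (fun z => φ (z + r)) :=
    hφc.comp_homeomorph (Homeomorph.addRight r)
  have i3 : Integrable (fun z => q z * φ (z + r)) :=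
    (hq.mul (hφ.continuous.comp (by fun_prop))).integrable_of_hasCompactSupport hsh.mul_left
  have i4 : Integrable (fun z => q z * φ z) :=
    (hq.mul hφ.continuous).integrable_of_hasCompactSupport hφc.mul_left
  have i5 : Integrable (fun z => q (z - r) * φ z) :=
    ((hq.comp (by fun_prop)).mul hφ.continuous).integrable_of_hasCompactSupport hφc.mul_left
  have e2 : ∫ z, q z * φ (z + r) = ∫ z, q (z - r) * φ z := by
    rw [← integral_add_right_eq_self (fun x => q (x - r) * φ x) r]
    simp only [add_sub_cancel_right]
  simp only [mul_sub, sub_mul]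
  rw [integral_sub i3 i4, integral_sub i4 i5, e2]
  ring

end LatticeSums

/-! ### The divergence of the atomistic stress -/

section AtomisticStress

variable {d : ℕ} {ζ : Eu d → ℝ} {c : ℝ} {a : LatStar d → ZLat d → ℝ} {b : LatStar d → ℝ}

/-- The average over a bond of the lattice sum, i.e. `∑_ξ a_{ρ,ξ} χ_{ξ,ρ}`. -/
def bondAverage (ζ : Eu d → ℝ) (a : LatStar d → ZLat d → ℝ) (ρ : LatStar d) (x : Eu d) : ℝ :=
  ∫ t in (0 : ℝ)..1, latSum ζ (a ρ) (x - t • dirVec ρ)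

theorem continuous_bondAverage (hζ : IsNodalBasis ζ)
    (hsupp : Function.support ζ ⊆ Metric.closedBall 0 c) (ρ : LatStar d) :
    Continuous (bondAverage ζ a ρ) := by
  have := continuous_latSum hζ.continuous hsupp (a ρ)
  exact intervalIntegral.continuous_parametric_intervalIntegral_of_continuous'
    (f := fun x t => latSum ζ (a ρ) (x - t • dirVec ρ)) (this.comp (by fun_prop)) 0 1

theorem abs_bondAverage_le (hζ : IsNodalBasis ζ)
    (hsupp : Function.support ζ ⊆ Metric.closedBall 0 c) (ha : ∀ ρ ξ, |a ρ ξ| ≤ b ρ)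
    (ρ : LatStar d) (x : Eu d) : |bondAverage ζ a ρ x| ≤ b ρ := by
  have := intervalIntegral.norm_integral_le_of_norm_le_const (a := (0 : ℝ)) (b := 1)
    (f := fun t => latSum ζ (a ρ) (x - t • dirVec ρ)) (C := b ρ)
    (fun t _ => hζ.abs_latSum_le hsupp (ha ρ) _)
  rwa [sub_zero, abs_one, mul_one] at this

theorem abs_dirVec_apply_le (ρ : LatStar d) (α : Fin d) : |dirVec ρ α| ≤ ‖dirVec ρ‖ :=
  PiLp.norm_apply_le (dirVec ρ) α

theorem IsNodalBasis.chi_nonneg (hζ : IsNodalBasis ζ) (ξ : ZLat d) (ρ : LatStar d) (x : Eu d) :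
    0 ≤ chi ζ ξ ρ x :=
  intervalIntegral.integral_nonneg zero_le_one fun _ _ => hζ.nonneg _

theorem IsNodalBasis.hasSum_chi_one (hζ : IsNodalBasis ζ)
    (hsupp : Function.support ζ ⊆ Metric.closedBall 0 c) (ρ : LatStar d) (x : Eu d) :
    HasSum (fun ξ => chi ζ ξ ρ x) 1 := by
  have := hasSum_chi hζ.continuous hsupp (fun _ => 1) ρ x
  simpa [hζ.latSum_one hsupp] using this

/-- The double series defining the stress may be summed over the lattice points first. -/
theorem tsum_tsum_mul_chi (hζ : IsNodalBasis ζ)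
    (hsupp : Function.support ζ ⊆ Metric.closedBall 0 c) (ha : ∀ ρ ξ, |a ρ ξ| ≤ b ρ)
    (hb : Summable fun ρ => b ρ * ‖dirVec ρ‖) (x : Eu d) (α : Fin d) :
    ∑' ξ, ∑' ρ, a ρ ξ * dirVec ρ α * chi ζ ξ ρ x = ∑' ρ, dirVec ρ α * bondAverage ζ a ρ x := by
  have hbnn : ∀ ρ, 0 ≤ b ρ := fun ρ => (abs_nonneg _).trans (ha ρ 0)
  have hs : Summable fun p : LatStar d × ZLat d => b p.1 * ‖dirVec p.1‖ * chi ζ p.2 p.1 x := by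
    have hnn : ∀ p : LatStar d × ZLat d, 0 ≤ b p.1 * ‖dirVec p.1‖ * chi ζ p.2 p.1 x := fun p =>
      mul_nonneg (mul_nonneg (hbnn _) (norm_nonneg _)) (hζ.chi_nonneg _ _ _)
    have h1 : ∀ ρ, HasSum (fun ξ => b ρ * ‖dirVec ρ‖ * chi ζ ξ ρ x) (b ρ * ‖dirVec ρ‖) := by
      intro ρ
      have := (hζ.hasSum_chi_one hsupp ρ x).mul_left (b ρ * ‖dirVec ρ‖)
      rwa [mul_one] at this
    rw [summable_prod_of_nonneg hnn]
    refine ⟨fun ρ => (h1 ρ).summable, ?_⟩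
    refine hb.congr fun ρ => ?_
    exact (h1 ρ).tsum_eq.symm
  have hs' : Summable fun p : LatStar d × ZLat d =>
      a p.1 p.2 * dirVec p.1 α * chi ζ p.2 p.1 x := by
    refine Summable.of_norm_bounded hs fun p => ?_
    rw [norm_mul, norm_mul, Real.norm_of_nonneg (hζ.chi_nonneg _ _ _)]
    gcongr
    · exact hζ.chi_nonneg _ _ _
    · exact hbnn _
    · exact ha _ _
    · exact abs_dirVec_apply_le _ _
  rw [Summable.tsum_comm (f := fun ρ ξ => a ρ ξ * dirVec ρ α * chi ζ ξ ρ x) hs']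
  refine tsum_congr fun ρ => ?_
  have h := ((hasSum_chi hζ.continuous hsupp (a ρ) ρ x).mul_left (dirVec ρ α)).tsum_eq
  rw [bondAverage, ← h]
  exact tsum_congr fun ξ => by ring

theorem fderiv_apply_eq_sum (φ : Eu d → ℝ) (x v : Eu d) :
    fderiv ℝ φ x v = ∑ α, v α * fderiv ℝ φ x (EuclideanSpace.single α 1) := by
  conv_lhs => rw [← (EuclideanSpace.basisFun (Fin d) ℝ).sum_repr v]
  simp [map_sum]

/-- A stress assembled from bond forces `a_{ρ,ξ}` is continuous, and its weak divergence is the sum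
over the bonds of the differences of the nodal interpolants of the forces. The bound `b` makes
all the series converge uniformly. -/
theorem isWeakDiv_latticeStress (hζ : IsNodalBasis ζ)
    (hsupp : Function.support ζ ⊆ Metric.closedBall 0 c) {S : Eu d → Fin d → ℝ} {f : Eu d → ℝ}
    (ha : ∀ ρ ξ, |a ρ ξ| ≤ b ρ) (hb : Summable fun ρ => b ρ * ‖dirVec ρ‖)
    (hS : ∀ x α, S x α = ∑' ξ, ∑' ρ, a ρ ξ * dirVec ρ α * chi ζ ξ ρ x)
    (hf : ∀ x, f x = ∑' ρ, (latSum ζ (a ρ) x - latSum ζ (a ρ) (x - dirVec ρ))) :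
    (∀ α, Continuous fun x => S x α) ∧ Continuous f ∧
      ∀ φ : Eu d → ℝ, ContDiff ℝ ∞ φ → HasCompactSupport φ →
        ∫ x, ∑ α, S x α * fderiv ℝ φ x (EuclideanSpace.single α 1) = -∫ x, f x * φ x := by
  have hbnn : ∀ ρ, 0 ≤ b ρ := fun ρ => (abs_nonneg _).trans (ha ρ 0)
  have hb1 : Summable b := Summable.of_nonneg_of_le hbnn
    (fun ρ => le_mul_of_one_le_right (hbnn ρ) (one_le_norm_dirVec ρ)) hb
  have hS' : ∀ x α, S x α = ∑' ρ, dirVec ρ α * bondAverage ζ a ρ x := fun x α => by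
    rw [hS, tsum_tsum_mul_chi hζ hsupp ha hb]
  have hqc := fun ρ => continuous_latSum hζ.continuous hsupp (a ρ)
  have hqb := fun ρ x => hζ.abs_latSum_le hsupp (ha ρ) x
  have hbdS : ∀ ρ x (α : Fin d), ‖dirVec ρ α * bondAverage ζ a ρ x‖ ≤ b ρ * ‖dirVec ρ‖ :=
    fun ρ x α => by
      rw [norm_mul, mul_comm]
      gcongr
      · exact hbnn ρ
      · exact abs_bondAverage_le hζ hsupp ha ρ x
      · exact abs_dirVec_apply_le _ _
  have hbdf : ∀ ρ x, ‖latSum ζ (a ρ) x - latSum ζ (a ρ) (x - dirVec ρ)‖ ≤ 2 * b ρ := fun ρ x => by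
    refine (norm_sub_le _ _).trans ?_
    have h1 := hqb ρ x
    have h2 := hqb ρ (x - dirVec ρ)
    rw [Real.norm_eq_abs, Real.norm_eq_abs]
    linarith
  have hcD : ∀ ρ, Continuous fun x => latSum ζ (a ρ) x - latSum ζ (a ρ) (x - dirVec ρ) :=
    fun ρ => (hqc ρ).sub ((hqc ρ).comp (by fun_prop))
  refine ⟨fun α => ?_, ?_, fun φ hφ hφc => ?_⟩
  · simp only [hS']
    exact continuous_tsum (fun ρ => (continuous_bondAverage hζ hsupp ρ).const_mul _) hb
      fun ρ x => hbdS ρ x α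
  · rw [funext hf]
    exact continuous_tsum hcD (hb1.mul_left 2) hbdf
  · have hdφ : Continuous (fderiv ℝ φ) := hφ.continuous_fderiv (by simp)
    have e1 : ∀ x, ∑ α, S x α * fderiv ℝ φ x (EuclideanSpace.single α 1)
        = ∑' ρ, bondAverage ζ a ρ x * fderiv ℝ φ x (dirVec ρ) := by
      intro x
      simp only [hS', ← tsum_mul_right]
      rw [← Summable.tsum_finsetSum]
      · refine tsum_congr fun ρ => ?_
        rw [fderiv_apply_eq_sum φ x (dirVec ρ), Finset.mul_sum]
        exact Finset.sum_congr rfl fun α _ => by ring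
      · exact fun α _ => (Summable.of_norm_bounded hb fun ρ => hbdS ρ x α).mul_right _
    have e2 : ∀ x, f x * φ x
        = ∑' ρ, (latSum ζ (a ρ) x - latSum ζ (a ρ) (x - dirVec ρ)) * φ x := by
      intro x
      rw [hf, tsum_mul_right]
    simp only [e1, e2]
    have iφ : Integrable fun x => ‖φ x‖ :=
      (hφ.continuous.integrable_of_hasCompactSupport hφc).norm
    have idφ : Integrable fun x => ‖fderiv ℝ φ x‖ :=
      (hdφ.integrable_of_hasCompactSupport (hφc.fderiv (𝕜 := ℝ))).norm
    have i1 : ∀ ρ, Integrable fun x => bondAverage ζ a ρ x * fderiv ℝ φ x (dirVec ρ) := fun ρ =>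
      ((continuous_bondAverage hζ hsupp ρ).mul
        (hdφ.clm_apply continuous_const)).integrable_of_hasCompactSupport
        (hφc.fderiv_apply ℝ (dirVec ρ)).mul_left
    have i2 : ∀ ρ, Integrable fun x =>
        (latSum ζ (a ρ) x - latSum ζ (a ρ) (x - dirVec ρ)) * φ x := fun ρ =>
      ((hcD ρ).mul hφ.continuous).integrable_of_hasCompactSupport hφc.mul_left
    rw [← integral_tsum_of_summable_integral_norm i1, ← integral_tsum_of_summable_integral_norm i2,
      ← tsum_neg]
    · exact tsum_congr fun ρ => integral_segmentAverage_mul_fderiv (hqc ρ) hφ hφc (dirVec ρ)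
    · refine Summable.of_nonneg_of_le (fun ρ => integral_nonneg fun x => norm_nonneg _)
        (fun ρ => ?_) (hb1.mul_right (2 * ∫ x, ‖φ x‖))
      rw [← mul_assoc, ← integral_const_mul]
      refine integral_mono (i2 ρ).norm (iφ.const_mul _) fun x => ?_
      simp only [norm_mul]
      rw [mul_comm (b ρ) 2]
      exact mul_le_mul_of_nonneg_right (hbdf ρ x) (norm_nonneg _)
    · refine Summable.of_nonneg_of_le (fun ρ => integral_nonneg fun x => norm_nonneg _)
        (fun ρ => ?_) (hb.mul_right (∫ x, ‖fderiv ℝ φ x‖))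
      rw [← integral_const_mul]
      refine integral_mono (i1 ρ).norm (idφ.const_mul _) fun x => ?_
      simp only [norm_mul]
      rw [mul_assoc, mul_comm ‖dirVec ρ‖]
      gcongr
      · exact hbnn ρ
      · exact abs_bondAverage_le hζ hsupp ha ρ x
      · exact (fderiv ℝ φ x).le_opNorm _

end AtomisticStress

/-! ### Deformations of class `W^{4,∞}_loc` and the divergence of the Cauchy–Born stress -/

section CauchyBorn

variable {d : ℕ} {κ : ℝ} {k : ℕ} {V : Stencil d → EReal} {u : Eu d → Eu d}

theorem MemWInftyLoc.weakGrad_ae (hu : MemWInftyLoc 4 u) (hc : Continuous u) :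
    weakGrad u =ᵐ[volume] fderiv ℝ u := by
  filter_upwards [(hu.contDiff (k := 3) hc).2 1 (by norm_num)] with x hx
  unfold weakGrad
  rw [hx]
  ext v
  rw [continuousMultilinearCurryFin1_apply, iteratedFDeriv_one_apply]
  rfl

/-- The gradient is continuous, so the bound defining `K` holds at every point. -/
theorem MemWInftyLoc.norm_fderiv_le (hu : MemWInftyLoc 4 u) (hc : Continuous u) (hκ : 0 < κ)
    (hK : MemK κ u) (x : Eu d) : ‖fderiv ℝ u x‖ ≤ κ := by
  have hcd := (hu.contDiff (k := 3) hc).1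
  have hcont : Continuous (fderiv ℝ u) := hcd.continuous_fderiv (by norm_num)
  have h1 : ∀ᵐ y, ‖weakGrad u y‖ₑ ≤ ENNReal.ofReal κ := by
    have h := hK.2
    rw [eLpNorm_exponent_top] at h
    filter_upwards [enorm_ae_le_eLpNormEssSup (weakGrad u) volume] with y hy
    exact hy.trans h
  have h2 : ∀ᵐ y, ‖fderiv ℝ u y‖ ≤ κ := by
    filter_upwards [h1, hu.weakGrad_ae hc] with y hy hy'
    rw [hy', ← ofReal_norm] at hy
    exact (ENNReal.ofReal_le_ofReal_iff hκ.le).1 hy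
  have hd : Dense {y | ‖fderiv ℝ u y‖ ≤ κ} := Measure.dense_of_ae h2
  have hcl : IsClosed {y | ‖fderiv ℝ u y‖ ≤ κ} := isClosed_le hcont.norm continuous_const
  have := hcl.closure_eq ▸ hd.closure_eq
  exact (this ▸ mem_univ x : x ∈ {y | ‖fderiv ℝ u y‖ ≤ κ})

theorem MemWInftyLoc.norm_sub_le (hu : MemWInftyLoc 4 u) (hc : Continuous u) (hκ : 0 < κ)
    (hK : MemK κ u) (x y : Eu d) : ‖u y - u x‖ ≤ κ * ‖y - x‖ :=
  convex_univ.norm_image_sub_le_of_norm_fderiv_le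
    (fun z _ => ((hu.contDiff (k := 3) hc).1.differentiable (by norm_num)) z)
    (fun z _ => hu.norm_fderiv_le hc hκ hK z) (mem_univ x) (mem_univ y)

theorem MemWInftyLoc.entry_diffStencil (hu : MemWInftyLoc 4 u) (hc : Continuous u) (hκ : 0 < κ)
    (hK : MemK κ u) (ξ : ZLat d) (ρ : LatStar d) :
    (diffStencil u ξ).entry ρ = u (latVec ξ + dirVec ρ) - u (latVec ξ) := by
  have h : (fun ρ : LatStar d => u (latVec ξ + dirVec ρ) - u (latVec ξ)) ∈ stencilSubmodule d :=
    ⟨κ, fun ρ => by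
      have := hu.norm_sub_le hc hκ hK (latVec ξ) (latVec ξ + dirVec ρ)
      rwa [add_sub_cancel_left] at this⟩
  have e : diffStencil u ξ = (⟨_, h⟩ : stencilSubmodule d) := dif_pos h
  rw [e]
  rfl

theorem MemWInftyLoc.diffStencil_mem (hu : MemWInftyLoc 4 u) (hc : Continuous u) (hκ : 0 < κ)
    (hK : MemK κ u) (ξ : ZLat d) : diffStencil u ξ ∈ stencilBall d κ := by
  refine mem_closedBall_zero_iff.2 (Stencil.norm_le _ hκ.le fun ρ => ?_)
  rw [hu.entry_diffStencil hc hκ hK]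
  have := hu.norm_sub_le hc hκ hK (latVec ξ) (latVec ξ + dirVec ρ)
  rwa [add_sub_cancel_left] at this

/-- The map `F ↦ (F ρ)_ρ` as a bounded linear map. -/
def homStencilL (d : ℕ) : (Eu d →L[ℝ] Eu d) →L[ℝ] Stencil d :=
  LinearMap.mkContinuous
    { toFun := homStencil
      map_add' := fun _ _ => rfl
      map_smul' := fun _ _ => rfl } 1 (fun F => by
      rw [one_mul]
      exact Stencil.norm_le _ (norm_nonneg F) fun ρ => F.le_opNorm _)

theorem homStencil_mem {F : Eu d →L[ℝ] Eu d} (hF : ‖F‖ ≤ κ) : homStencil F ∈ stencilBall d κ :=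
  mem_closedBall_zero_iff.2 (Stencil.norm_le _ ((norm_nonneg F).trans hF) fun ρ =>
    (F.le_opNorm _).trans (by gcongr))

theorem IsSiteEnergy.hasFDerivWithinAt_siteDeriv_one (hV : IsSiteEnergy κ k V) (hκ : 0 < κ)
    (hk : 4 ≤ k) {g : Stencil d} (hg : g ∈ stencilBall d κ) :
    HasFDerivWithinAt (siteDeriv V κ 1) (siteDeriv V κ 2 g).curryLeft (stencilBall d κ) g := by
  have hd : DifferentiableWithinAt ℝ (siteDeriv V κ 1) (stencilBall d κ) g :=
    hV.smooth.differentiableOn_iteratedFDerivWithin (by exact_mod_cast (by omega : 1 < k))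
      (uniqueDiffOn_stencilBall hκ) _ hg
  have e : (siteDeriv V κ 2 g).curryLeft
      = fderivWithin ℝ (siteDeriv V κ 1) (stencilBall d κ) g := by
    ext h W
    rw [ContinuousMultilinearMap.curryLeft_apply]
    unfold siteDeriv
    rw [iteratedFDerivWithin_succ_apply_left, Fin.cons_zero, Fin.tail_cons]
  rw [e]
  exact hd.hasFDerivWithinAt

theorem IsSiteEnergy.fderivWithin_cbEnergy (hV : IsSiteEnergy κ k V) (hκ : 0 < κ)
    (hk : 4 ≤ k) {F : Eu d →L[ℝ] Eu d} (hF : ‖F‖ ≤ κ) (E : Eu d →L[ℝ] Eu d) :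
    fderivWithin ℝ (fun F => (cbEnergy V F).toReal) (Metric.closedBall 0 κ) F E
      = siteDeriv V κ 1 (homStencil F) ![homStencil E] := by
  have hS := uniqueDiffOn_stencilBall (d := d) hκ
  have hFm : F ∈ Metric.closedBall (0 : Eu d →L[ℝ] Eu d) κ := mem_closedBall_zero_iff.2 hF
  have hu : UniqueDiffWithinAt ℝ (Metric.closedBall (0 : Eu d →L[ℝ] Eu d) κ) F :=
    uniqueDiffOn_convex (convex_closedBall _ _) ⟨0, mem_interior.2 ⟨Metric.ball 0 κ,
      Metric.ball_subset_closedBall, Metric.isOpen_ball, Metric.mem_ball_self hκ⟩⟩ F hFm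
  have hd : DifferentiableWithinAt ℝ (fun g => (V g).toReal) (stencilBall d κ) (homStencilL d F) :=
    hV.smooth.differentiableOn (by exact_mod_cast (by omega : k ≠ 0)) _ (homStencil_mem hF)
  have h := (hd.hasFDerivWithinAt.comp F (homStencilL d).hasFDerivWithinAt
    (fun G hG => homStencil_mem (mem_closedBall_zero_iff.1 hG))).fderivWithin hu
  have h2 := congrArg (fun L => L E) h
  refine h2.trans ?_
  unfold siteDeriv
  rw [iteratedFDerivWithin_one_apply (hS _ (homStencil_mem hF))]
  rfl

/-- The matrix with the single nonzero entry `1` at the position `(i, α)`. -/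
def matUnit (i α : Fin d) : Eu d →L[ℝ] Eu d :=
  (EuclideanSpace.proj α : Eu d →L[ℝ] ℝ).smulRight (EuclideanSpace.single i 1)

/-- The Cauchy–Born stress, written with the continuous gradient. -/
def cbStressC (V : Stencil d → EReal) (κ : ℝ) (u : Eu d → Eu d) (i α : Fin d) (x : Eu d) : ℝ :=
  siteDeriv V κ 1 (homStencil (fderiv ℝ u x)) ![homStencil (matUnit i α)]

/-- The divergence of the Cauchy–Born stress. -/
def cbDiv (V : Stencil d → EReal) (κ : ℝ) (u : Eu d → Eu d) (i : Fin d) (x : Eu d) : ℝ :=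
  ∑ α, siteDeriv V κ 2 (homStencil (fderiv ℝ u x))
    ![homStencil (fderiv ℝ (fderiv ℝ u) x (EuclideanSpace.single α 1)), homStencil (matUnit i α)]

theorem MemWInftyLoc.cbStress_ae (hu : MemWInftyLoc 4 u) (hc : Continuous u)
    (hV : IsSiteEnergy κ k V) (hκ : 0 < κ) (hk : 4 ≤ k) (hK : MemK κ u) (i α : Fin d) :
    (fun x => cbStress V κ u x i α) =ᵐ[volume] cbStressC V κ u i α := by
  filter_upwards [hu.weakGrad_ae hc] with x hx
  rw [cbStress, hx, cbStressC, ← hV.fderivWithin_cbEnergy hκ hk (hu.norm_fderiv_le hc hκ hK x)]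
  rfl

/-- The chain rule for `S^c`. It remains valid where `‖∇u(x)‖ = κ`, because `∇u` takes all its
values in the ball in which `V` is differentiable. -/
theorem MemWInftyLoc.hasFDerivAt_cbStressC (hu : MemWInftyLoc 4 u) (hc : Continuous u)
    (hV : IsSiteEnergy κ k V) (hκ : 0 < κ) (hk : 4 ≤ k) (hK : MemK κ u) (i α : Fin d)
    (x : Eu d) : ∃ L : Eu d →L[ℝ] ℝ, HasFDerivAt (cbStressC V κ u i α) L x ∧
      ∀ y, L y = siteDeriv V κ 2 (homStencil (fderiv ℝ u x))
        ![homStencil (fderiv ℝ (fderiv ℝ u) x y), homStencil (matUnit i α)] := by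
  have hcd := (hu.contDiff (k := 3) hc).1
  have hmem := fun x => homStencil_mem (hu.norm_fderiv_le hc hκ hK x)
  have h1 : HasFDerivAt (fderiv ℝ u) (fderiv ℝ (fderiv ℝ u) x) x :=
    (((hcd.fderiv_right (m := 2) (by norm_num)).differentiable (by norm_num)) x).hasFDerivAt
  have h2 : HasFDerivAt (fun y => homStencil (fderiv ℝ u y))
      ((homStencilL d).comp (fderiv ℝ (fderiv ℝ u) x)) x := (homStencilL d).hasFDerivAt.comp x h1
  have h3 := (hV.hasFDerivWithinAt_siteDeriv_one hκ hk (hmem x)).comp x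
    h2.hasFDerivWithinAt (fun y (_ : y ∈ univ) => hmem y)
  rw [hasFDerivWithinAt_univ] at h3
  have h4 := (ContinuousMultilinearMap.apply ℝ (fun _ : Fin 1 => Stencil d) ℝ
    ![homStencil (matUnit i α)]).hasFDerivAt.comp x h3
  exact ⟨_, h4, fun y => rfl⟩

theorem MemWInftyLoc.continuous_cbDiv_term (hu : MemWInftyLoc 4 u) (hc : Continuous u)
    (hV : IsSiteEnergy κ k V) (hκ : 0 < κ) (hk : 4 ≤ k) (hK : MemK κ u) (y : Eu d)
    (h : Stencil d) : Continuous fun x => siteDeriv V κ 2 (homStencil (fderiv ℝ u x))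
        ![homStencil (fderiv ℝ (fderiv ℝ u) x y), h] := by
  have hcd := (hu.contDiff (k := 3) hc).1
  have hcd2 : ContDiff ℝ 2 (fderiv ℝ u) := hcd.fderiv_right (by norm_num)
  have hc1 : Continuous fun x => homStencilL d (fderiv ℝ u x) :=
    (homStencilL d).continuous.comp hcd2.continuous
  have hc2 : Continuous fun x => homStencilL d (fderiv ℝ (fderiv ℝ u) x y) :=
    (homStencilL d).continuous.comp
      ((hcd2.continuous_fderiv (by norm_num)).clm_apply continuous_const)
  have hs : ContinuousOn (siteDeriv V κ 2) (stencilBall d κ) :=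
    hV.smooth.continuousOn_iteratedFDerivWithin (by exact_mod_cast (by omega : 2 ≤ k))
      (uniqueDiffOn_stencilBall hκ)
  have hs' : Continuous fun x => siteDeriv V κ 2 (homStencilL d (fderiv ℝ u x)) :=
    hs.comp_continuous hc1 fun x => homStencil_mem (hu.norm_fderiv_le hc hκ hK x)
  have hs'' : Continuous fun x => (siteDeriv V κ 2 (homStencilL d (fderiv ℝ u x))).curryLeft :=
    (continuousMultilinearCurryLeftEquiv ℝ (fun _ : Fin 2 => Stencil d) ℝ).continuous.comp hs'
  exact (ContinuousMultilinearMap.apply ℝ (fun _ : Fin 1 => Stencil d) ℝ ![h]).continuous.comp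
    (hs''.clm_apply hc2)

theorem MemWInftyLoc.continuous_cbDiv (hu : MemWInftyLoc 4 u) (hc : Continuous u)
    (hV : IsSiteEnergy κ k V) (hκ : 0 < κ) (hk : 4 ≤ k) (hK : MemK κ u) (i : Fin d) :
    Continuous (cbDiv V κ u i) :=
  continuous_finsetSum _ fun _ _ => hu.continuous_cbDiv_term hc hV hκ hk hK _ _

theorem MemWInftyLoc.integral_cbStress (hu : MemWInftyLoc 4 u) (hc : Continuous u)
    (hV : IsSiteEnergy κ k V) (hκ : 0 < κ) (hk : 4 ≤ k) (hK : MemK κ u) {φ : Eu d → ℝ}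
    (hφ : ContDiff ℝ ∞ φ) (hφc : HasCompactSupport φ) (i : Fin d) :
    ∫ x, ∑ α, cbStress V κ u x i α * fderiv ℝ φ x (EuclideanSpace.single α 1)
      = -∫ x, cbDiv V κ u i x * φ x := by
  have hae : (fun x => ∑ α, cbStress V κ u x i α * fderiv ℝ φ x (EuclideanSpace.single α 1))
      =ᵐ[volume] fun x => ∑ α, cbStressC V κ u i α x *
        fderiv ℝ φ x (EuclideanSpace.single α 1) := by
    filter_upwards [ae_all_iff.2 fun α => hu.cbStress_ae hc hV hκ hk hK i α] with x hx
    exact Finset.sum_congr rfl fun α _ => by rw [hx α]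
  rw [integral_congr_ae hae]
  have hd := fun α x => hu.hasFDerivAt_cbStressC hc hV hκ hk hK i α x
  have hdiff : ∀ α, Differentiable ℝ (cbStressC V κ u i α) := fun α x => by
    obtain ⟨L, hL, -⟩ := hd α x
    exact hL.differentiableAt
  have hval : ∀ α x y, fderiv ℝ (cbStressC V κ u i α) x y
      = siteDeriv V κ 2 (homStencil (fderiv ℝ u x))
        ![homStencil (fderiv ℝ (fderiv ℝ u) x y), homStencil (matUnit i α)] := fun α x y => by
    obtain ⟨L, hL, hLy⟩ := hd α x
    rw [hL.fderiv, hLy]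
  have hcφ : ∀ v, Continuous fun x => fderiv ℝ φ x v := fun v =>
    (hφ.continuous_fderiv (by simp)).clm_apply continuous_const
  have i1 : ∀ α, Integrable fun x => cbStressC V κ u i α x *
      fderiv ℝ φ x (EuclideanSpace.single α 1) := fun α =>
    ((hdiff α).continuous.mul (hcφ _)).integrable_of_hasCompactSupport
      (hφc.fderiv_apply ℝ _).mul_left
  have i2 : ∀ α, Integrable fun x => fderiv ℝ (cbStressC V κ u i α) x
      (EuclideanSpace.single α 1) * φ x := fun α => by
    simp only [hval]
    exact ((hu.continuous_cbDiv_term hc hV hκ hk hK _ _).mul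
      hφ.continuous).integrable_of_hasCompactSupport hφc.mul_left
  have i3 : ∀ α, Integrable fun x => cbStressC V κ u i α x * φ x := fun α =>
    ((hdiff α).continuous.mul hφ.continuous).integrable_of_hasCompactSupport hφc.mul_left
  have e : ∀ x, cbDiv V κ u i x * φ x
      = ∑ α, fderiv ℝ (cbStressC V κ u i α) x (EuclideanSpace.single α 1) * φ x := fun x => by
    simp only [hval, cbDiv, Finset.sum_mul]
  simp only [e]
  rw [integral_finsetSum _ fun α _ => i1 α, integral_finsetSum _ fun α _ => i2 α,
    ← Finset.sum_neg_distrib]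
  exact Finset.sum_congr rfl fun α _ => integral_mul_fderiv_eq_neg_fderiv_mul_of_integrable
    (i2 α) (i1 α) (i3 α) (fun _ _ => hdiff α _) (fun _ _ => (hφ.differentiable (by simp)) _)

theorem eq_sum_smul_single (v : Eu d) : v = ∑ α, v α • EuclideanSpace.single α (1 : ℝ) := by
  conv_lhs => rw [← (EuclideanSpace.basisFun (Fin d) ℝ).sum_repr v]
  simp

/-- The divergence of the Cauchy–Born stress as a sum over pairs of bonds. -/
theorem MemWInftyLoc.cbDiv_eq_tsum (hu : MemWInftyLoc 4 u) (hc : Continuous u)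
    (hV : IsSiteEnergy κ k V) (hκ : 0 < κ) (hk : 4 ≤ k) (hK : MemK κ u) (i : Fin d) (x : Eu d) :
    cbDiv V κ u i x = ∑' p : LatStar d × LatStar d,
      partialV V κ ![p.2, p.1] (homStencil (fderiv ℝ u x))
        ![fderiv ℝ (fderiv ℝ u) x (dirVec p.1) (dirVec p.2), EuclideanSpace.single i 1] := by
  have hmem := homStencil_mem (hu.norm_fderiv_le hc hκ hK x)
  unfold cbDiv
  have h1 : ∀ α, siteDeriv V κ 2 (homStencil (fderiv ℝ u x))
    ![homStencil (fderiv ℝ (fderiv ℝ u) x (EuclideanSpace.single α 1)), homStencil (matUnit i α)]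
    = ∑' p : LatStar d × LatStar d, _ := fun α => hV.siteDeriv_two_eq_tsum hκ hk hmem _ _
  simp only [h1]
  rw [← Summable.tsum_finsetSum fun α _ => hV.summable_two hk hmem _ _]
  refine tsum_congr fun p => ?_
  set P := partialV V κ ![p.2, p.1] (homStencil (fderiv ℝ u x)) with hP
  have hcur : ∀ X Y : Eu d, P ![X, Y] = (P.curryLeft X).curryLeft Y ![] := fun X Y => by
    rw [ContinuousMultilinearMap.curryLeft_apply, ContinuousMultilinearMap.curryLeft_apply]
    congr 1
  simp only [entry_homStencil, hcur]
  have h2 : fderiv ℝ (fderiv ℝ u) x (dirVec p.1) (dirVec p.2) = ∑ α, dirVec p.1 α •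
      fderiv ℝ (fderiv ℝ u) x (EuclideanSpace.single α 1) (dirVec p.2) := by
    conv_lhs => rw [eq_sum_smul_single (dirVec p.1)]
    simp only [map_sum, map_smul, sum_apply, smul_apply]
  have h3 : (((P.curryLeft (∑ α, dirVec p.1 α • fderiv ℝ (fderiv ℝ u) x
      (EuclideanSpace.single α 1) (dirVec p.2))).curryLeft) (EuclideanSpace.single i 1)) ![]
      = ∑ α, dirVec p.1 α • ((P.curryLeft (fderiv ℝ (fderiv ℝ u) x
      (EuclideanSpace.single α 1) (dirVec p.2))).curryLeft) (EuclideanSpace.single i 1) ![] := by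
    rw [ContinuousMultilinearMap.curryLeft_apply]
    simp only [map_sum, map_smul, sum_apply, smul_apply]
    rfl
  rw [h2, h3]
  refine Finset.sum_congr rfl fun α _ => ?_
  have h4 : matUnit i α (dirVec p.1) = dirVec p.1 α • EuclideanSpace.single i (1 : ℝ) := rfl
  rw [h4, map_smul]
  rfl

end CauchyBorn

/-! ### Local Taylor expansions of finite differences -/

section LocalTaylor

theorem norm_sub_le_of_hasDerivAt {E : Type*} [NormedAddCommGroup E] [NormedSpace ℝ E]
    {f f' : ℝ → E} {C : ℝ} (h : ∀ t, HasDerivAt f (f' t) t)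
    (hC : ∀ t ∈ Icc (0 : ℝ) 1, ‖f' t‖ ≤ C) : ‖f 1 - f 0‖ ≤ C :=
  norm_image_sub_le_of_norm_deriv_le_segment_01' (fun t _ => (h t).hasDerivWithinAt)
    fun t ht => hC t (Ico_subset_Icc_self ht)

variable {E F : Type*} [NormedAddCommGroup E] [NormedSpace ℝ E] [NormedAddCommGroup F]
  [NormedSpace ℝ F]

theorem norm_taylor_le {f : E → F} {U : Set E} (hU : Convex ℝ U) (hf : Differentiable ℝ f) {K : ℝ}
    {x : E} (hx : x ∈ U) (hK : ∀ y ∈ U, ‖fderiv ℝ f y - fderiv ℝ f x‖ ≤ K * ‖y - x‖) (hK0 : 0 ≤ K)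
    {r : E} (hr : x + r ∈ U) : ‖f (x + r) - f x - fderiv ℝ f x r‖ ≤ K * ‖r‖ ^ 2 := by
  have hseg : segment ℝ x (x + r) ⊆ U := hU.segment_subset hx hr
  have h := (convex_segment x (x + r)).norm_image_sub_le_of_norm_hasFDerivWithin_le'
    (f := f) (f' := fderiv ℝ f) (φ := fderiv ℝ f x) (C := K * ‖r‖)
    (fun y _ => (hf y).hasFDerivAt.hasFDerivWithinAt) (fun y hy => by
      refine (hK y (hseg hy)).trans ?_
      gcongr
      have := norm_sub_le_of_mem_segment hy
      rwa [add_sub_cancel_left] at this)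
    (left_mem_segment ℝ x (x + r)) (right_mem_segment ℝ x (x + r))
  rw [add_sub_cancel_left] at h
  refine h.trans (le_of_eq ?_)
  ring

theorem hasDerivAt_comp_line {f : E → F} (hf : Differentiable ℝ f) (z v : E) (t : ℝ) :
    HasDerivAt (fun t : ℝ => f (z + t • v)) (fderiv ℝ f (z + t • v) v) t := by
  have h1 : HasDerivAt (fun t : ℝ => z + t • v) v t := by
    simpa using ((hasDerivAt_id t).smul_const v).const_add z
  exact (hf (z + t • v)).hasFDerivAt.comp_hasDerivAt t h1

theorem hasDerivAt_quadratic (p v : E) (t : ℝ) :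
    HasDerivAt (fun t : ℝ => t • p + (t ^ 2 / 2) • v) (p + t • v) t := by
  have h1 : HasDerivAt (fun t : ℝ => t ^ 2 / 2) t t := by
    have := (hasDerivAt_pow 2 t).div_const 2
    have e : ((2 : ℕ) : ℝ) * t ^ (2 - 1) / 2 = t := by norm_num
    rwa [e] at this
  have h2 := ((hasDerivAt_id t).smul_const p).add (h1.smul_const v)
  rw [one_smul] at h2
  exact h2

theorem hasDerivAt_clm_quadratic (L : E →L[ℝ] F) (p v : E) (t : ℝ) :
    HasDerivAt (fun t : ℝ => L (t • p + (t ^ 2 / 2) • v)) (L (p + t • v)) t :=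
  L.hasFDerivAt.comp_hasDerivAt t (hasDerivAt_quadratic p v t)

theorem norm_add_smul_le (p v : E) {t : ℝ} (ht : t ∈ Icc (0 : ℝ) 1) : ‖p + t • v‖ ≤ ‖p‖ + ‖v‖ := by
  refine (norm_add_le _ _).trans ?_
  rw [norm_smul, Real.norm_of_nonneg ht.1]
  gcongr
  exact mul_le_of_le_one_left (norm_nonneg _) ht.2

variable {u : E → F} {U : Set E} {x : E} {K : ℝ}

/-- The deviation of a finite difference from the gradient. -/
theorem norm_diff_sub_fderiv_le (hu : ContDiff ℝ 3 u) (hU : Convex ℝ U) (hx : x ∈ U) (hK0 : 0 ≤ K)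
    (hK : ∀ y ∈ U, ‖fderiv ℝ (fderiv ℝ u) y‖ ≤ K) {p v : E}
    (hp : ∀ s ∈ Icc (0 : ℝ) 1, x + (p + s • v) ∈ U) :
    ‖u (x + p + v) - u (x + p) - fderiv ℝ u x v‖ ≤ K * ((‖p‖ + ‖v‖) * ‖v‖) := by
  have hu1 : ContDiff ℝ 2 (fderiv ℝ u) := hu.fderiv_right (by norm_num)
  have hd0 : Differentiable ℝ u := hu.differentiable (by norm_num)
  have hd1 : Differentiable ℝ (fderiv ℝ u) := hu1.differentiable (by norm_num)
  have h := norm_sub_le_of_hasDerivAt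
    (f := fun s : ℝ => u (x + p + s • v) - s • fderiv ℝ u x v)
    (f' := fun s => fderiv ℝ u (x + p + s • v) v - fderiv ℝ u x v)
    (fun s => by
      have h1 := (hasDerivAt_comp_line hd0 (x + p) v s).sub
        ((hasDerivAt_id s).smul_const (fderiv ℝ u x v))
      rwa [one_smul] at h1) (C := K * ((‖p‖ + ‖v‖) * ‖v‖)) (fun s hs => by
      have h1 := hU.norm_image_sub_le_of_norm_fderiv_le (fun y _ => hd1 y) hK hx (hp s hs)
      rw [add_sub_cancel_left, ← add_assoc] at h1
      rw [← sub_apply]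
      refine ((fderiv ℝ u (x + p + s • v) - fderiv ℝ u x).le_opNorm v).trans ?_
      rw [← mul_assoc]
      gcongr
      exact h1.trans (by gcongr; exact norm_add_smul_le p v hs))
  simp only [one_smul, zero_smul, add_zero, sub_zero] at h
  convert h using 2
  abel

/-- The deviation of a finite difference from its second-order expansion. -/
theorem norm_diff_sub_second_le (hu : ContDiff ℝ 3 u) (hU : Convex ℝ U) (hx : x ∈ U) (hK0 : 0 ≤ K)
    (hK : ∀ y ∈ U, ‖fderiv ℝ (fderiv ℝ (fderiv ℝ u)) y‖ ≤ K) {p v : E}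
    (hp : ∀ s ∈ Icc (0 : ℝ) 1, x + (p + s • v) ∈ U) :
    ‖u (x + p + v) - u (x + p) - fderiv ℝ u x v
        - fderiv ℝ (fderiv ℝ u) x (p + (1 / 2 : ℝ) • v) v‖ ≤ K * ((‖p‖ + ‖v‖) ^ 2 * ‖v‖) := by
  have hu1 : ContDiff ℝ 2 (fderiv ℝ u) := hu.fderiv_right (by norm_num)
  have hu2 : ContDiff ℝ 1 (fderiv ℝ (fderiv ℝ u)) := hu1.fderiv_right (by norm_num)
  have hd0 : Differentiable ℝ u := hu.differentiable (by norm_num)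
  have hd1 : Differentiable ℝ (fderiv ℝ u) := hu1.differentiable (by norm_num)
  have hd2 : Differentiable ℝ (fderiv ℝ (fderiv ℝ u)) := hu2.differentiable (by norm_num)
  have h := norm_sub_le_of_hasDerivAt
    (f := fun s : ℝ => u (x + p + s • v) - s • fderiv ℝ u x v
      - (fderiv ℝ (fderiv ℝ u) x).flip v (s • p + (s ^ 2 / 2) • v))
    (f' := fun s => fderiv ℝ u (x + p + s • v) v - fderiv ℝ u x v
      - (fderiv ℝ (fderiv ℝ u) x).flip v (p + s • v))
    (fun s => by
      have h1 := ((hasDerivAt_comp_line hd0 (x + p) v s).sub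
        ((hasDerivAt_id s).smul_const (fderiv ℝ u x v))).sub
        (hasDerivAt_clm_quadratic ((fderiv ℝ (fderiv ℝ u) x).flip v) p v s)
      rwa [one_smul] at h1) (C := K * ((‖p‖ + ‖v‖) ^ 2 * ‖v‖)) (fun s hs => by
      have h1 := norm_taylor_le hU hd1 hx (fun y hy =>
        hU.norm_image_sub_le_of_norm_fderiv_le (fun y _ => hd2 y) hK hx hy) hK0 (hp s hs)
      rw [← add_assoc] at h1
      rw [ContinuousLinearMap.flip_apply, ← sub_apply, ← sub_apply]
      refine (ContinuousLinearMap.le_opNorm _ v).trans ?_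
      rw [← mul_assoc]
      gcongr
      exact h1.trans (by gcongr; exact norm_add_smul_le p v hs))
  simp only [one_smul, zero_smul, add_zero, sub_zero, ContinuousLinearMap.flip_apply, one_pow,
    ne_eq, OfNat.ofNat_ne_zero, not_false_eq_true, zero_pow, zero_div, map_zero] at h
  convert h using 2
  abel

/-- First-order expansion of a difference of gradients, with the derivative of second order of
`∇u` frozen at `x`. Only a Lipschitz bound on the third derivative of `u` is available. -/
theorem norm_fderiv_diff_le (hu : ContDiff ℝ 3 u) (hU : Convex ℝ U) (hx : x ∈ U) (hK0 : 0 ≤ K)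
    (hK : ∀ y ∈ U, ‖fderiv ℝ (fderiv ℝ (fderiv ℝ u)) y - fderiv ℝ (fderiv ℝ (fderiv ℝ u)) x‖
      ≤ K * ‖y - x‖) {q r : E} (v : E)
    (hq : ∀ t ∈ Icc (0 : ℝ) 1, x + (q + t • -r) ∈ U) :
    ‖fderiv ℝ u (x + q) v - fderiv ℝ u (x + q - r) v - fderiv ℝ (fderiv ℝ u) x r v
        - fderiv ℝ (fderiv ℝ (fderiv ℝ u)) x (q - (1 / 2 : ℝ) • r) r v‖
      ≤ K * ((‖q‖ + ‖r‖) ^ 2 * ‖r‖ * ‖v‖) := by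
  have hu1 : ContDiff ℝ 2 (fderiv ℝ u) := hu.fderiv_right (by norm_num)
  have hu2 : ContDiff ℝ 1 (fderiv ℝ (fderiv ℝ u)) := hu1.fderiv_right (by norm_num)
  have hd1 : Differentiable ℝ (fderiv ℝ u) := hu1.differentiable (by norm_num)
  have hd2 : Differentiable ℝ (fderiv ℝ (fderiv ℝ u)) := hu2.differentiable (by norm_num)
  set D2 := fderiv ℝ (fderiv ℝ u) with hD2
  set D3 := fderiv ℝ D2 x with hD3
  let L : E →L[ℝ] F := (ContinuousLinearMap.apply ℝ F v).comp (D3.flip r)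
  have hL : ∀ z, L z = D3 z r v := fun z => rfl
  have h := norm_sub_le_of_hasDerivAt
    (f := fun t : ℝ => fderiv ℝ u (x + q + t • -r) v + t • D2 x r v
      + L (t • q + (t ^ 2 / 2) • -r))
    (f' := fun t => D2 (x + q + t • -r) (-r) v + D2 x r v + L (q + t • -r))
    (fun t => by
      have h0 := (ContinuousLinearMap.apply ℝ F v).hasFDerivAt.comp_hasDerivAt t
        (hasDerivAt_comp_line hd1 (x + q) (-r) t)
      have h1 := (h0.add ((hasDerivAt_id t).smul_const (D2 x r v))).add
        (hasDerivAt_clm_quadratic L q (-r) t)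
      rw [one_smul] at h1
      exact h1) (C := K * ((‖q‖ + ‖r‖) ^ 2 * ‖r‖ * ‖v‖)) (fun t ht => by
      have h1 := norm_taylor_le hU hd2 hx hK hK0 (hq t ht)
      rw [← add_assoc] at h1
      have e : D2 (x + q + t • -r) (-r) v + D2 x r v + L (q + t • -r)
          = -((D2 (x + q + t • -r) - D2 x - D3 (q + t • -r)) r v) := by
        simp only [hL, sub_apply, map_neg, neg_apply]
        abel
      rw [e, norm_neg]
      refine (ContinuousLinearMap.le_opNorm₂ _ r v).trans ?_
      rw [← mul_assoc, ← mul_assoc]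
      gcongr
      refine h1.trans ?_
      gcongr
      have := norm_add_smul_le q (-r) ht
      rwa [norm_neg] at this)
  simp only [one_smul, zero_smul, add_zero, one_pow, ne_eq, OfNat.ofNat_ne_zero, not_false_eq_true,
    zero_pow, zero_div, map_zero] at h
  have e : fderiv ℝ u (x + q) v - fderiv ℝ u (x + q - r) v - D2 x r v
        - D3 (q - (1 / 2 : ℝ) • r) r v
      = -(fderiv ℝ u (x + q + -r) v + D2 x r v + L (q + (1 / 2 : ℝ) • -r)
        - fderiv ℝ u (x + q) v) := by
    rw [hL, smul_neg, ← sub_eq_add_neg, ← sub_eq_add_neg]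
    abel
  rw [e, norm_neg]
  exact h

/-- The deviation of a second difference from its expansion to third order. -/
theorem norm_second_diff_le (hu : ContDiff ℝ 3 u) (hU : Convex ℝ U) (hx : x ∈ U) (hK0 : 0 ≤ K)
    (hK : ∀ y ∈ U, ‖fderiv ℝ (fderiv ℝ (fderiv ℝ u)) y - fderiv ℝ (fderiv ℝ (fderiv ℝ u)) x‖
      ≤ K * ‖y - x‖) {p r v : E}
    (hp : ∀ s ∈ Icc (0 : ℝ) 1, ∀ t ∈ Icc (0 : ℝ) 1, x + (p + s • v + t • -r) ∈ U) :
    ‖(u (x + p + v) - u (x + p)) - (u (x + (p - r) + v) - u (x + (p - r)))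
        - fderiv ℝ (fderiv ℝ u) x r v
        - fderiv ℝ (fderiv ℝ (fderiv ℝ u)) x (p + (1 / 2 : ℝ) • v - (1 / 2 : ℝ) • r) r v‖
      ≤ K * ((‖p‖ + ‖v‖ + ‖r‖) ^ 2 * ‖r‖ * ‖v‖) := by
  have hd0 : Differentiable ℝ u := hu.differentiable (by norm_num)
  set D2 := fderiv ℝ (fderiv ℝ u) with hD2
  set D3 := fderiv ℝ D2 x with hD3
  let L : E →L[ℝ] F := (ContinuousLinearMap.apply ℝ F v).comp (D3.flip r)
  have hL : ∀ z, L z = D3 z r v := fun z => rfl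
  have h := norm_sub_le_of_hasDerivAt
    (f := fun s : ℝ => u (x + p + s • v) - u (x + (p - r) + s • v) - s • D2 x r v
      - L (s • (p - (1 / 2 : ℝ) • r) + (s ^ 2 / 2) • v))
    (f' := fun s => fderiv ℝ u (x + p + s • v) v - fderiv ℝ u (x + (p - r) + s • v) v - D2 x r v
      - L (p - (1 / 2 : ℝ) • r + s • v))
    (fun s => by
      have h1 := (((hasDerivAt_comp_line hd0 (x + p) v s).sub
        (hasDerivAt_comp_line hd0 (x + (p - r)) v s)).sub
        ((hasDerivAt_id s).smul_const (D2 x r v))).sub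
        (hasDerivAt_clm_quadratic L (p - (1 / 2 : ℝ) • r) v s)
      rw [one_smul] at h1
      exact h1) (C := K * ((‖p‖ + ‖v‖ + ‖r‖) ^ 2 * ‖r‖ * ‖v‖)) (fun s hs => by
      have h1 := norm_fderiv_diff_le hu hU hx hK0 hK (q := p + s • v) (r := r) v (hp s hs)
      have e1 : x + (p + s • v) = x + p + s • v := by abel
      have e2 : x + p + s • v - r = x + (p - r) + s • v := by abel
      have e3 : p + s • v - (1 / 2 : ℝ) • r = p - (1 / 2 : ℝ) • r + s • v := by abel
      rw [e1, e2, e3] at h1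
      refine h1.trans ?_
      gcongr
      exact norm_add_smul_le p v hs)
  simp only [one_smul, zero_smul, add_zero, one_pow, ne_eq, OfNat.ofNat_ne_zero, not_false_eq_true,
    zero_pow, zero_div, map_zero, sub_zero] at h
  convert h using 2
  rw [hL, sub_add_eq_add_sub]
  abel

end LocalTaylor

/-! ### The neighbourhoods of bonds -/

section Neighbourhoods

variable {d : ℕ} {c : ℝ}

theorem nuSet_negDir (ρ ς : LatStar d) : nuSet c (negDir ρ) (negDir ς) = nuSet c ρ ς := by
  unfold nuSet
  congr 2
  simp only [dirVec_negDir, smul_neg, neg_smul, neg_neg, sub_neg_eq_add]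
  ext z
  simp only [mem_insert_iff, mem_singleton_iff, ← sub_eq_add_neg]
  tauto

theorem isCompact_vadd_nuSet (x : Eu d) (ρ ς : LatStar d) : IsCompact (x +ᵥ nuSet c ρ ς) := by
  have h : IsCompact (nuSet c ρ ς) :=
    ((Set.toFinite _).isCompact_convexHull ℝ).cthickening
  exact h.vadd x

theorem convex_vadd_nuSet (x : Eu d) (ρ ς : LatStar d) : Convex ℝ (x +ᵥ nuSet c ρ ς) :=
  ((convex_convexHull ℝ _).cthickening _).vadd x

theorem smul_add_smul_mem_convexHull {ρ ς : LatStar d} {α β : ℝ} (hα : α ∈ Icc (-1 : ℝ) 1)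
    (hβ : β ∈ Icc (-1 : ℝ) 1) :
    (2 * α) • dirVec ρ + β • dirVec ς ∈ convexHull ℝ
      {(2 : ℝ) • dirVec ρ + dirVec ς, (2 : ℝ) • dirVec ρ - dirVec ς,
        -(2 : ℝ) • dirVec ρ + dirVec ς, -(2 : ℝ) • dirVec ρ - dirVec ς} := by
  set S : Set (Eu d) := {(2 : ℝ) • dirVec ρ + dirVec ς, (2 : ℝ) • dirVec ρ - dirVec ς,
        -(2 : ℝ) • dirVec ρ + dirVec ς, -(2 : ℝ) • dirVec ρ - dirVec ς} with hS
  have hC := convex_convexHull ℝ S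
  have h1 : (2 : ℝ) • dirVec ρ + dirVec ς ∈ convexHull ℝ S := subset_convexHull ℝ S (by simp [hS])
  have h2 : (2 : ℝ) • dirVec ρ - dirVec ς ∈ convexHull ℝ S := subset_convexHull ℝ S (by simp [hS])
  have h3 : -(2 : ℝ) • dirVec ρ + dirVec ς ∈ convexHull ℝ S := subset_convexHull ℝ S (by simp [hS])
  have h4 : -(2 : ℝ) • dirVec ρ - dirVec ς ∈ convexHull ℝ S := subset_convexHull ℝ S (by simp [hS])
  have hα1 : 0 ≤ (1 + α) / 2 := by linarith [hα.1]
  have hα2 : 0 ≤ (1 - α) / 2 := by linarith [hα.2]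
  have hβ1 : 0 ≤ (1 + β) / 2 := by linarith [hβ.1]
  have hβ2 : 0 ≤ (1 - β) / 2 := by linarith [hβ.2]
  have h5 := hC h1 h3 hα1 hα2 (by ring)
  have h6 := hC h2 h4 hα1 hα2 (by ring)
  have h7 := hC h5 h6 hβ1 hβ2 (by ring)
  convert h7 using 1
  module

/-- All the points at which `u` is evaluated in the expansions, `ξ + sς - tρ` with `|ξ - x| ≤ c`,
lie in the interior of `x + ν_{ρς}`: they are within `c` of the hull, which leaves a margin `c`. -/
theorem mem_interior_vadd_nuSet (hc : 0 < c) (x : Eu d) {ρ ς : LatStar d} {y : Eu d} (hy : ‖y‖ ≤ c)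
    {s t : ℝ} (hs : s ∈ Icc (0 : ℝ) 1) (ht : t ∈ Icc (0 : ℝ) 1) :
    x + (y + s • dirVec ς + t • -dirVec ρ) ∈ interior (x +ᵥ nuSet c ρ ς) := by
  refine mem_interior.2 ⟨Metric.ball (x + (y + s • dirVec ς + t • -dirVec ρ)) c, ?_,
    Metric.isOpen_ball, Metric.mem_ball_self hc⟩
  intro w hw
  rw [Metric.mem_ball, dist_eq_norm] at hw
  refine mem_vadd_set.2 ⟨w - x, ?_, by simp⟩
  refine Metric.mem_cthickening_of_dist_le _ ((2 * (-t / 2)) • dirVec ρ + s • dirVec ς) _ _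
    (smul_add_smul_mem_convexHull ⟨by linarith [ht.2], by linarith [ht.1]⟩
      ⟨by linarith [hs.1], hs.2⟩) ?_
  rw [dist_eq_norm]
  have e : w - x - ((2 * (-t / 2)) • dirVec ρ + s • dirVec ς)
      = (w - (x + (y + s • dirVec ς + t • -dirVec ρ))) + y := by module
  rw [e]
  refine (norm_add_le _ _).trans ?_
  linarith

theorem self_mem_interior_vadd_nuSet (hc : 0 < c) (x : Eu d) (ρ ς : LatStar d) :
    x ∈ interior (x +ᵥ nuSet c ρ ς) := by
  have := mem_interior_vadd_nuSet hc x (ρ := ρ) (ς := ς) (y := 0) (s := 0) (t := 0)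
    (by rw [norm_zero]; exact hc.le) (by simp) (by simp)
  simpa using this

end Neighbourhoods

/-! ### The stencil of a deformation near a point -/

section StencilEstimates

variable {d : ℕ} {c : ℝ} {u : Eu d → Eu d}

/-- `‖∇^j u‖` on the neighbourhood `x + ν_{ρς}`, as a real number. -/
def locNorm (c : ℝ) (u : Eu d → Eu d) (x : Eu d) (j : ℕ) (ρ ς : LatStar d) : ℝ :=
  (linftyDeriv j u (x +ᵥ nuSet c ρ ς)).toReal

theorem locNorm_nonneg (x : Eu d) (j : ℕ) (ρ ς : LatStar d) : 0 ≤ locNorm c u x j ρ ς :=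
  ENNReal.toReal_nonneg

theorem locNorm_negDir (x : Eu d) (j : ℕ) (ρ ς : LatStar d) :
    locNorm c u x j (negDir ρ) (negDir ς) = locNorm c u x j ρ ς := by
  rw [locNorm, nuSet_negDir, locNorm]

/-- The deviation of the finite difference `D_ς u(x + p)` from `∇u(x) ς`. -/
def stencilDev (u : Eu d → Eu d) (x p : Eu d) (ς : LatStar d) : Eu d :=
  u (x + p + dirVec ς) - u (x + p) - fderiv ℝ u x (dirVec ς)

/-- The length scale entering the estimates for the bonds `ρ` and `ς`. -/
def bondScale (c : ℝ) (ρ ς : LatStar d) : ℝ := c + ‖dirVec ρ‖ + ‖dirVec ς‖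

theorem norm_sub_smul_dirVec_le {y : Eu d} (hy : ‖y‖ ≤ c) {t : ℝ} (ht : t ∈ Icc (0 : ℝ) 1)
    (ρ : LatStar d) : ‖y + t • -dirVec ρ‖ ≤ c + ‖dirVec ρ‖ := by
  have := norm_add_smul_le y (-dirVec ρ) ht
  rw [norm_neg] at this
  linarith

/-- The deviation at `x + y - tρ`. In this and the next lemmas `y = ξ - x`, and `t = 0` and `t = 1`
correspond to the sites `ξ` and `ξ - ρ` of the bond. -/
theorem MemWInftyLoc.norm_stencilDev_le (hu : MemWInftyLoc 4 u) (hcu : Continuous u) (hc : 0 < c)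
    (x : Eu d) {y : Eu d} (hy : ‖y‖ ≤ c) {t : ℝ} (ht : t ∈ Icc (0 : ℝ) 1) (ρ ς : LatStar d) :
    ‖stencilDev u x (y + t • -dirVec ρ) ς‖
      ≤ locNorm c u x 2 ρ ς * (bondScale c ρ ς * ‖dirVec ς‖) := by
  have h := norm_diff_sub_fderiv_le (K := locNorm c u x 2 ρ ς) (p := y + t • -dirVec ρ)
    (v := dirVec ς) (hu.contDiff (k := 3) hcu).1
    (convex_vadd_nuSet (c := c) x ρ ς).interior (self_mem_interior_vadd_nuSet hc x ρ ς)
    (locNorm_nonneg _ _ _ _) (fun z hz => by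
      rw [norm_fderiv_fderiv]
      exact hu.norm_iteratedFDeriv_le (k := 3) hcu (by norm_num) (isCompact_vadd_nuSet x ρ ς) hz)
    (fun s hs => by
      have := mem_interior_vadd_nuSet hc x (ρ := ρ) (ς := ς) hy hs ht
      rwa [add_right_comm] at this)
  refine h.trans ?_
  have h0 := locNorm_nonneg (c := c) (u := u) x 2 ρ ς
  gcongr
  unfold bondScale
  gcongr
  exact norm_sub_smul_dirVec_le hy ht ρ

/-- The deviation differs from a second derivative of `u` by a bound on `∇³u`. -/
theorem MemWInftyLoc.norm_stencilDev_sub_le (hu : MemWInftyLoc 4 u) (hcu : Continuous u)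
    (hc : 0 < c) (x : Eu d) {y : Eu d} (hy : ‖y‖ ≤ c) {t : ℝ} (ht : t ∈ Icc (0 : ℝ) 1)
    (ρ ς : LatStar d) :
    ‖stencilDev u x (y + t • -dirVec ρ) ς - fderiv ℝ (fderiv ℝ u) x
        (y + t • -dirVec ρ + (1 / 2 : ℝ) • dirVec ς) (dirVec ς)‖
      ≤ locNorm c u x 3 ρ ς * (bondScale c ρ ς ^ 2 * ‖dirVec ς‖) := by
  have h := norm_diff_sub_second_le (K := locNorm c u x 3 ρ ς) (p := y + t • -dirVec ρ)
    (v := dirVec ς) (hu.contDiff (k := 3) hcu).1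
    (convex_vadd_nuSet (c := c) x ρ ς).interior (self_mem_interior_vadd_nuSet hc x ρ ς)
    (locNorm_nonneg _ _ _ _) (fun z hz => by
      rw [norm_fderiv_fderiv_fderiv]
      exact hu.norm_iteratedFDeriv_le (k := 3) hcu (by norm_num) (isCompact_vadd_nuSet x ρ ς) hz)
    (fun s hs => by
      have := mem_interior_vadd_nuSet hc x (ρ := ρ) (ς := ς) hy hs ht
      rwa [add_right_comm] at this)
  refine h.trans ?_
  have h0 := locNorm_nonneg (c := c) (u := u) x 3 ρ ς
  gcongr
  unfold bondScale
  gcongr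
  exact norm_sub_smul_dirVec_le hy ht ρ

theorem MemWInftyLoc.norm_second_term_le (hu : MemWInftyLoc 4 u) (hcu : Continuous u)
    (hc : 0 < c) (x : Eu d) {y : Eu d} (hy : ‖y‖ ≤ c) {t : ℝ} (ht : t ∈ Icc (0 : ℝ) 1)
    (ρ ς : LatStar d) :
    ‖fderiv ℝ (fderiv ℝ u) x (y + t • -dirVec ρ + (1 / 2 : ℝ) • dirVec ς) (dirVec ς)‖
      ≤ locNorm c u x 2 ρ ς * (bondScale c ρ ς * ‖dirVec ς‖) := by
  refine (ContinuousLinearMap.le_opNorm₂ _ _ _).trans ?_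
  rw [← mul_assoc]
  have h0 := locNorm_nonneg (c := c) (u := u) x 2 ρ ς
  gcongr
  · rw [norm_fderiv_fderiv]
    exact hu.norm_iteratedFDeriv_le (k := 3) hcu (by norm_num) (isCompact_vadd_nuSet x ρ ς)
      (self_mem_interior_vadd_nuSet hc x ρ ς)
  · refine (norm_add_smul_le _ _ (by norm_num)).trans ?_
    unfold bondScale
    gcongr
    exact norm_sub_smul_dirVec_le hy ht ρ

theorem MemWInftyLoc.norm_second_diff_le (hu : MemWInftyLoc 4 u) (hcu : Continuous u)
    (hc : 0 < c) (x : Eu d) {y : Eu d} (hy : ‖y‖ ≤ c) (ρ ς : LatStar d) :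
    ‖stencilDev u x y ς - stencilDev u x (y - dirVec ρ) ς
        - fderiv ℝ (fderiv ℝ u) x (dirVec ρ) (dirVec ς)
        - fderiv ℝ (fderiv ℝ (fderiv ℝ u)) x
          (y + (1 / 2 : ℝ) • dirVec ς - (1 / 2 : ℝ) • dirVec ρ) (dirVec ρ) (dirVec ς)‖
      ≤ locNorm c u x 4 ρ ς * (bondScale c ρ ς ^ 2 * ‖dirVec ρ‖ * ‖dirVec ς‖) := by
  have h := _root_.norm_second_diff_le (K := locNorm c u x 4 ρ ς) (p := y) (r := dirVec ρ)
    (v := dirVec ς) (hu.contDiff (k := 3) hcu).1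
    (convex_vadd_nuSet (c := c) x ρ ς).interior (self_mem_interior_vadd_nuSet hc x ρ ς)
    (locNorm_nonneg _ _ _ _) (fun z hz => by
      rw [norm_fderiv_fderiv_fderiv_sub]
      exact hu.norm_iteratedFDeriv_sub_le (k := 3) hcu (isCompact_vadd_nuSet x ρ ς)
        (convex_vadd_nuSet x ρ ς) (self_mem_interior_vadd_nuSet hc x ρ ς) hz)
    (fun s hs t ht => mem_interior_vadd_nuSet hc x (ρ := ρ) (ς := ς) hy hs ht)
  have e : stencilDev u x y ς - stencilDev u x (y - dirVec ρ) ς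
      = (u (x + y + dirVec ς) - u (x + y))
        - (u (x + (y - dirVec ρ) + dirVec ς) - u (x + (y - dirVec ρ))) := by
    unfold stencilDev
    abel
  rw [e]
  refine h.trans ?_
  have h0 := locNorm_nonneg (c := c) (u := u) x 4 ρ ς
  gcongr
  unfold bondScale
  linarith

end StencilEstimates

/-! ### Averages with the nodal weights -/

section SiteMean

variable {d : ℕ} {ζ : Eu d → ℝ} {c : ℝ} {E F : Type*} [NormedAddCommGroup E] [NormedSpace ℝ E]
  [NormedAddCommGroup F] [NormedSpace ℝ F]

/-- The average `∑_ξ ζ(ξ - x) f(ξ)` over the lattice sites near `x`. -/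
def siteMean (ζ : Eu d → ℝ) (c : ℝ) (x : Eu d) (f : ZLat d → E) : E :=
  ∑ ξ ∈ latNear x c, ζ (latVec ξ - x) • f ξ

theorem siteMean_add (x : Eu d) (f g : ZLat d → E) :
    siteMean ζ c x (fun ξ => f ξ + g ξ) = siteMean ζ c x f + siteMean ζ c x g := by
  simp only [siteMean, smul_add, Finset.sum_add_distrib]

theorem siteMean_sub (x : Eu d) (f g : ZLat d → E) :
    siteMean ζ c x (fun ξ => f ξ - g ξ) = siteMean ζ c x f - siteMean ζ c x g := by
  simp only [siteMean, smul_sub, Finset.sum_sub_distrib]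

theorem map_siteMean (L : E →ₗ[ℝ] F) (x : Eu d) (f : ZLat d → E) :
    L (siteMean ζ c x f) = siteMean ζ c x fun ξ => L (f ξ) := by
  simp only [siteMean, map_sum, map_smul]

theorem siteMean_tsum {ι : Type*} (x : Eu d) {f : ZLat d → ι → ℝ} (hf : ∀ ξ, Summable (f ξ)) :
    siteMean ζ c x (fun ξ => ∑' p, f ξ p) = ∑' p, siteMean ζ c x fun ξ => f ξ p := by
  simp only [siteMean, smul_eq_mul, ← tsum_mul_left]
  exact (Summable.tsum_finsetSum fun ξ _ => (hf ξ).mul_left _).symm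

theorem IsNodalBasis.siteMean_const (hζ : IsNodalBasis ζ)
    (hsupp : Function.support ζ ⊆ Metric.closedBall 0 c) (x : Eu d) (a : E) :
    siteMean ζ c x (fun _ => a) = a := by
  rw [siteMean, ← Finset.sum_smul, hζ.sum_eq_one hsupp, one_smul]

/-- Linear functions of `ξ - x` average to zero. -/
theorem IsNodalBasis.siteMean_linear (hζ : IsNodalBasis ζ)
    (hsupp : Function.support ζ ⊆ Metric.closedBall 0 c) (x : Eu d) (L : Eu d →ₗ[ℝ] E) :
    siteMean ζ c x (fun ξ => L (latVec ξ - x)) = 0 := by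
  have h0 : siteMean ζ c x (fun ξ => latVec ξ - x) = 0 := by
    ext i
    have := hζ.sum_linear hsupp x (EuclideanSpace.proj i : Eu d →L[ℝ] ℝ).toLinearMap
    have h2 := map_siteMean (ζ := ζ) (c := c) (EuclideanSpace.proj i : Eu d →L[ℝ] ℝ).toLinearMap x
      (fun ξ => latVec ξ - x)
    exact h2.trans this
  rw [← map_siteMean, h0, map_zero]

theorem IsNodalBasis.norm_siteMean_le (hζ : IsNodalBasis ζ)
    (hsupp : Function.support ζ ⊆ Metric.closedBall 0 c) (x : Eu d) {f : ZLat d → E} {A : ℝ}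
    (hf : ∀ ξ, ‖latVec ξ - x‖ ≤ c → ‖f ξ‖ ≤ A) : ‖siteMean ζ c x f‖ ≤ A := by
  refine (norm_sum_le _ _).trans ?_
  calc ∑ ξ ∈ latNear x c, ‖ζ (latVec ξ - x) • f ξ‖
      ≤ ∑ ξ ∈ latNear x c, ζ (latVec ξ - x) * A := by
        refine Finset.sum_le_sum fun ξ hξ => ?_
        rw [norm_smul, Real.norm_of_nonneg (hζ.nonneg _)]
        exact mul_le_mul_of_nonneg_left (hf ξ (mem_latNear.1 hξ)) (hζ.nonneg _)
    _ = A := by rw [← Finset.sum_mul, hζ.sum_eq_one hsupp, one_mul]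

theorem IsNodalBasis.enorm_siteMean_le (hζ : IsNodalBasis ζ)
    (hsupp : Function.support ζ ⊆ Metric.closedBall 0 c) (x : Eu d) {f : ZLat d → E} {A : ℝ≥0∞}
    (hf : ∀ ξ, ‖latVec ξ - x‖ ≤ c → ‖f ξ‖ₑ ≤ A) : ‖siteMean ζ c x f‖ₑ ≤ A := by
  rcases eq_or_ne A ⊤ with rfl | hA
  · exact le_top
  rw [← ofReal_norm]
  refine ENNReal.ofReal_le_of_le_toReal (hζ.norm_siteMean_le hsupp x fun ξ hξ => ?_)
  rw [← toReal_enorm]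
  exact ENNReal.toReal_mono hA (hf ξ hξ)

end SiteMean

/-! ### Symmetrised sums -/

/-- A sum is controlled by the symmetrised terms under an involution of the index set. -/
theorem enorm_tsum_le_of_symm {ι : Type*} {f : ι → ℝ} (hf : Summable f) (σ : ι ≃ ι) {g : ι → ℝ}
    (h : ∀ q, |f q + f (σ q)| ≤ 2 * g q) : ‖∑' q, f q‖ₑ ≤ ∑' q, ENNReal.ofReal (g q) := by
  have h1 : ∑' q, f q = ∑' q, (f q + f (σ q)) / 2 := by
    rw [tsum_div_const, hf.tsum_add (show Summable fun q => f (σ q) from σ.summable_iff.2 hf),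
      σ.tsum_eq f]
    ring
  rw [h1]
  refine enorm_tsum_le_tsum_enorm.trans (ENNReal.tsum_le_tsum fun q => ?_)
  rw [← ofReal_norm]
  refine ENNReal.ofReal_le_ofReal ?_
  rw [Real.norm_eq_abs, abs_div, abs_two]
  linarith [h q]

/-- The reflection `ρ ↦ -ρ` of the lattice directions. -/
def negDirEquiv (d : ℕ) : LatStar d ≃ LatStar d :=
  ⟨negDir, negDir, negDir_negDir, negDir_negDir⟩

/-! ### The term of first order -/

section FirstOrder

variable {d : ℕ} {ζ : Eu d → ℝ} {c κ : ℝ} {k : ℕ} {V : Stencil d → EReal} {u : Eu d → Eu d}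

theorem norm_dirVec_negDir (ρ : LatStar d) : ‖dirVec (negDir ρ)‖ = ‖dirVec ρ‖ := by
  rw [dirVec_negDir, norm_neg]

theorem bondScale_negDir (ρ ς : LatStar d) :
    bondScale c (negDir ρ) (negDir ς) = bondScale c ρ ς := by
  rw [bondScale, norm_dirVec_negDir, norm_dirVec_negDir, bondScale]

/-- The average over the sites `ξ` of the second difference `D_ς u(ξ) - D_ς u(ξ - ρ)`; the gradient
terms of the two deviations cancel. -/
def meanDiff (ζ : Eu d → ℝ) (c : ℝ) (u : Eu d → Eu d) (x : Eu d) (ρ ς : LatStar d) : Eu d :=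
  siteMean ζ c x fun ξ => stencilDev u x (latVec ξ - x) ς
    - stencilDev u x (latVec ξ - x - dirVec ρ) ς

/-- The averaged second difference, less its Cauchy--Born value `∇²u(x)[ρ, ς]`. -/
def meanDefect (ζ : Eu d → ℝ) (c : ℝ) (u : Eu d → Eu d) (x : Eu d) (ρ ς : LatStar d) : Eu d :=
  meanDiff ζ c u x ρ ς - fderiv ℝ (fderiv ℝ u) x (dirVec ρ) (dirVec ς)

/-- The leading part of `meanDefect` is a third derivative, odd under reflection of the bonds. -/
theorem MemWInftyLoc.norm_meanDefect_sub_le (hu : MemWInftyLoc 4 u) (hcu : Continuous u)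
    (hc : 0 < c) (hζ : IsNodalBasis ζ) (hsupp : Function.support ζ ⊆ Metric.closedBall 0 c)
    (x : Eu d) (ρ ς : LatStar d) :
    ‖meanDefect ζ c u x ρ ς - fderiv ℝ (fderiv ℝ (fderiv ℝ u)) x
        ((1 / 2 : ℝ) • dirVec ς - (1 / 2 : ℝ) • dirVec ρ) (dirVec ρ) (dirVec ς)‖
      ≤ locNorm c u x 4 ρ ς * (bondScale c ρ ς ^ 2 * ‖dirVec ρ‖ * ‖dirVec ς‖) := by
  set U3 := fderiv ℝ (fderiv ℝ (fderiv ℝ u)) x with hU3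
  set U2 := fderiv ℝ (fderiv ℝ u) x (dirVec ρ) (dirVec ς) with hU2
  let L : Eu d →L[ℝ] Eu d :=
    (ContinuousLinearMap.apply ℝ (Eu d) (dirVec ς)).comp (U3.flip (dirVec ρ))
  have hL : ∀ z, U3 z (dirVec ρ) (dirVec ς) = L z := fun z => rfl
  have key : siteMean ζ c x (fun ξ => stencilDev u x (latVec ξ - x) ς
        - stencilDev u x (latVec ξ - x - dirVec ρ) ς - U2
        - U3 (latVec ξ - x + (1 / 2 : ℝ) • dirVec ς - (1 / 2 : ℝ) • dirVec ρ)
          (dirVec ρ) (dirVec ς))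
      = meanDefect ζ c u x ρ ς
        - U3 ((1 / 2 : ℝ) • dirVec ς - (1 / 2 : ℝ) • dirVec ρ) (dirVec ρ) (dirVec ς) := by
    have e : ∀ ξ : ZLat d, U3 (latVec ξ - x + (1 / 2 : ℝ) • dirVec ς - (1 / 2 : ℝ) • dirVec ρ)
          (dirVec ρ) (dirVec ς)
        = L (latVec ξ - x) + L ((1 / 2 : ℝ) • dirVec ς - (1 / 2 : ℝ) • dirVec ρ) := fun ξ => by
      rw [hL, ← map_add, add_sub_assoc]
    simp only [e]
    have h0 := hζ.siteMean_linear hsupp x (L : Eu d →ₗ[ℝ] Eu d)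
    simp only [ContinuousLinearMap.coe_coe] at h0
    rw [siteMean_sub, siteMean_sub, siteMean_add, h0, hζ.siteMean_const hsupp,
      hζ.siteMean_const hsupp, zero_add, hL, meanDefect, meanDiff]
  rw [← key]
  exact hζ.norm_siteMean_le hsupp x fun ξ hξ => hu.norm_second_diff_le hcu hc x hξ ρ ς

/-- Opposite bonds cancel the third derivative in the averaged second differences. -/
theorem MemWInftyLoc.norm_meanDefect_add_le (hu : MemWInftyLoc 4 u) (hcu : Continuous u)
    (hc : 0 < c) (hζ : IsNodalBasis ζ) (hsupp : Function.support ζ ⊆ Metric.closedBall 0 c)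
    (x : Eu d) (ρ ς : LatStar d) :
    ‖meanDefect ζ c u x ρ ς + meanDefect ζ c u x (negDir ρ) (negDir ς)‖
      ≤ 2 * (locNorm c u x 4 ρ ς * (bondScale c ρ ς ^ 2 * ‖dirVec ρ‖ * ‖dirVec ς‖)) := by
  have h1 := hu.norm_meanDefect_sub_le hcu hc hζ hsupp x ρ ς
  have h2 := hu.norm_meanDefect_sub_le hcu hc hζ hsupp x (negDir ρ) (negDir ς)
  rw [locNorm_negDir, bondScale_negDir, norm_dirVec_negDir, norm_dirVec_negDir, dirVec_negDir,
    dirVec_negDir] at h2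
  set U3 := fderiv ℝ (fderiv ℝ (fderiv ℝ u)) x with hU3
  have e : U3 ((1 / 2 : ℝ) • -dirVec ς - (1 / 2 : ℝ) • -dirVec ρ) (-dirVec ρ) (-dirVec ς)
      = -U3 ((1 / 2 : ℝ) • dirVec ς - (1 / 2 : ℝ) • dirVec ρ) (dirVec ρ) (dirVec ς) := by
    have : (1 / 2 : ℝ) • -dirVec ς - (1 / 2 : ℝ) • -dirVec ρ
      = -((1 / 2 : ℝ) • dirVec ς - (1 / 2 : ℝ) • dirVec ρ) := by module
    rw [this]
    simp only [map_neg, neg_apply, neg_neg]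
  rw [e] at h2
  have h3 := (norm_add_le _ _).trans (add_le_add h1 h2)
  rw [sub_neg_eq_add, sub_add_add_cancel] at h3
  linarith

theorem partialV_negDir_two (hV : IsSiteEnergy κ k V) (hκ : 0 < κ) (hk : 4 ≤ k)
    {A : Eu d →L[ℝ] Eu d} (hA : homStencil A ∈ stencilBall d κ) (ς ρ : LatStar d)
    (w : Fin 2 → Eu d) :
    partialV V κ ![negDir ς, negDir ρ] (homStencil A) w
      = partialV V κ ![ς, ρ] (homStencil A) w := by
  have h := hV.partialV_negDir hκ (j := 2) (by omega) ![ς, ρ] hA w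
  rw [even_two.neg_one_pow, one_mul] at h
  rw [← h]
  congr 2
  ext i
  fin_cases i <;> rfl

theorem partialV_negDir_three (hV : IsSiteEnergy κ k V) (hκ : 0 < κ) (hk : 4 ≤ k)
    {A : Eu d →L[ℝ] Eu d} (hA : homStencil A ∈ stencilBall d κ) (τ ς ρ : LatStar d)
    (w : Fin 3 → Eu d) :
    partialV V κ ![negDir τ, negDir ς, negDir ρ] (homStencil A) w
      = -partialV V κ ![τ, ς, ρ] (homStencil A) w := by
  have h := hV.partialV_negDir hκ (j := 3) (by omega) ![τ, ς, ρ] hA w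
  rw [Odd.neg_one_pow (by decide), neg_one_mul] at h
  rw [← h]
  congr 2
  ext i
  fin_cases i <;> rfl

theorem partialV_two_add (ρ : Fin 2 → LatStar d) (g : Stencil d) (a b v : Eu d) :
    partialV V κ ρ g ![a + b, v] = partialV V κ ρ g ![a, v] + partialV V κ ρ g ![b, v] :=
  congrArg (fun L : ContinuousMultilinearMap ℝ (fun _ : Fin 1 => Eu d) ℝ => L ![v])
    (map_add (partialV V κ ρ g).curryLeft a b)

/-- A crude bound, used only for the convergence of series. -/
theorem MemWInftyLoc.norm_stencilDev_le_two_mul (hu : MemWInftyLoc 4 u) (hcu : Continuous u)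
    (hκ : 0 < κ) (hK : MemK κ u) (x p : Eu d) (ς : LatStar d) :
    ‖stencilDev u x p ς‖ ≤ 2 * κ * ‖dirVec ς‖ := by
  have h1 := hu.norm_sub_le hcu hκ hK (x + p) (x + p + dirVec ς)
  rw [add_sub_cancel_left] at h1
  have h2 := (fderiv ℝ u x).le_of_opNorm_le (hu.norm_fderiv_le hcu hκ hK x) (dirVec ς)
  refine (_root_.norm_sub_le _ _).trans ?_
  linarith

theorem IsSiteEnergy.summable_partialV_two (hV : IsSiteEnergy κ k V) (hk : 4 ≤ k) {F : Stencil d}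
    (hF : F ∈ stencilBall d κ) {a : LatStar d × LatStar d → Eu d} {A : ℝ}
    (ha : ∀ q, ‖a q‖ ≤ A * (‖dirVec q.1‖ * ‖dirVec q.2‖)) (v : Eu d) :
    Summable fun q : LatStar d × LatStar d => partialV V κ ![q.2, q.1] F ![a q, v] := by
  have hs := hV.summable_mul (j := 2) (by omega) (by omega)
    (e := fun p : LatStar d × LatStar d => ![p.2, p.1])
    (fun a b h => Prod.ext (by simpa using congrFun h 1) (by simpa using congrFun h 0))
    (y := fun q => ‖a q‖ * ‖v‖) (A * ‖v‖) (fun p => by positivity)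
    (fun q => by
      simp only [Fin.prod_univ_two, Matrix.cons_val_zero, Matrix.cons_val_one]
      calc ‖a q‖ * ‖v‖ ≤ (A * (‖dirVec q.1‖ * ‖dirVec q.2‖)) * ‖v‖ := by gcongr; exact ha q
        _ = _ := by ring)
  refine Summable.of_norm_bounded hs fun q => ?_
  simpa [Fin.prod_univ_two] using
    hV.abs_partialV_le (j := 2) (by omega) (by omega) ![q.2, q.1] hF ![a q, v]

/-- The contribution of first order in the deformation is controlled by fourth derivatives. -/
theorem MemWInftyLoc.enorm_tsum_first_le (hu : MemWInftyLoc 4 u) (hcu : Continuous u)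
    (hV : IsSiteEnergy κ k V) (hκ : 0 < κ) (hk : 4 ≤ k) (hK : MemK κ u)
    (hc : 0 < c) (hζ : IsNodalBasis ζ) (hsupp : Function.support ζ ⊆ Metric.closedBall 0 c)
    (x v : Eu d)
    (hs : Summable fun q : LatStar d × LatStar d => partialV V κ ![q.2, q.1]
      (homStencil (fderiv ℝ u x)) ![meanDefect ζ c u x q.1 q.2, v]) :
    ‖∑' q : LatStar d × LatStar d, partialV V κ ![q.2, q.1] (homStencil (fderiv ℝ u x))
        ![meanDefect ζ c u x q.1 q.2, v]‖ₑ
      ≤ ∑' q : LatStar d × LatStar d, ENNReal.ofReal (partialSup V κ ![q.2, q.1] *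
        (locNorm c u x 4 q.1 q.2 * (bondScale c q.1 q.2 ^ 2 * ‖dirVec q.1‖ * ‖dirVec q.2‖)
          * ‖v‖)) := by
  have hF := homStencil_mem (hu.norm_fderiv_le hcu hκ hK x)
  refine enorm_tsum_le_of_symm hs ((negDirEquiv d).prodCongr (negDirEquiv d)) fun q => ?_
  obtain ⟨ρ, ς⟩ := q
  change |_ + partialV V κ ![negDir ς, negDir ρ] _
    ![meanDefect ζ c u x (negDir ρ) (negDir ς), v]| ≤ _
  rw [partialV_negDir_two hV hκ hk hF, ← partialV_two_add]
  refine (hV.abs_partialV_le (by omega) (by omega) _ hF _).trans ?_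
  simp only [Fin.prod_univ_two, Matrix.cons_val_zero, Matrix.cons_val_one]
  have h := hu.norm_meanDefect_add_le hcu hc hζ hsupp x ρ ς
  have h0 := partialSup_nonneg (V := V) (κ := κ) ![ς, ρ]
  calc _ ≤ partialSup V κ ![ς, ρ] * (2 * (locNorm c u x 4 ρ ς *
        (bondScale c ρ ς ^ 2 * ‖dirVec ρ‖ * ‖dirVec ς‖)) * ‖v‖) := by gcongr
    _ = _ := by ring

end FirstOrder

/-! ### The term of second order -/

section SecondOrder

variable {d : ℕ} {ζ : Eu d → ℝ} {c κ : ℝ} {k : ℕ} {V : Stencil d → EReal} {u : Eu d → Eu d}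

/-- The bilinear form `(a, b) ↦ M(a, b, v)` of a trilinear form `M`. -/
def trilinearFix {E : Type*} [NormedAddCommGroup E] [NormedSpace ℝ E]
    (M : ContinuousMultilinearMap ℝ (fun _ : Fin 3 => E) ℝ) (v : E) : E →ₗ[ℝ] E →ₗ[ℝ] ℝ :=
  LinearMap.mk₂ ℝ (fun a b => M ![a, b, v])
    (fun a a' b => congrArg (fun L : ContinuousMultilinearMap ℝ (fun _ : Fin 2 => E) ℝ => L ![b, v])
      (map_add M.curryLeft a a'))
    (fun t a b => congrArg (fun L : ContinuousMultilinearMap ℝ (fun _ : Fin 2 => E) ℝ => L ![b, v])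
      (map_smul M.curryLeft t a))
    (fun a b b' => congrArg (fun L : ContinuousMultilinearMap ℝ (fun _ : Fin 1 => E) ℝ => L ![v])
      (map_add (M.curryLeft a).curryLeft b b'))
    (fun t a b => congrArg (fun L : ContinuousMultilinearMap ℝ (fun _ : Fin 1 => E) ℝ => L ![v])
      (map_smul (M.curryLeft a).curryLeft t b))

theorem abs_bilin_sub_le {E : Type*} [NormedAddCommGroup E] [NormedSpace ℝ E]
    (B : E →ₗ[ℝ] E →ₗ[ℝ] ℝ) {N : ℝ} (hN : 0 ≤ N) (hB : ∀ a b, |B a b| ≤ N * (‖a‖ * ‖b‖))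
    {a a' b b' : E} {α α' β β' : ℝ} (h1 : ‖a - a'‖ ≤ α) (h2 : ‖b‖ ≤ β') (h3 : ‖a'‖ ≤ α')
    (h4 : ‖b - b'‖ ≤ β) : |B a b - B a' b'| ≤ N * (α * β' + α' * β) := by
  have e : B a b - B a' b' = B (a - a') b + B a' (b - b') := by
    simp only [map_sub, LinearMap.sub_apply]
    ring
  rw [e]
  refine (abs_add_le _ _).trans ((add_le_add (hB _ _) (hB _ _)).trans ?_)
  rw [mul_add]
  have hα := (norm_nonneg _).trans h1
  have hα' := (norm_nonneg _).trans h3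
  gcongr

/-- In the symmetrised difference of a quadratic function along a bond the constant and the
quadratic parts cancel. -/
theorem quadratic_symm_diff {E : Type*} [AddCommGroup E] [Module ℝ E] (B : E →ₗ[ℝ] E →ₗ[ℝ] ℝ)
    (P Q : E →ₗ[ℝ] E) (y r a b : E) :
    B (P y + a) (Q y + b) - B (P (y - r) + a) (Q (y - r) + b)
        - (B (P (-y) + a) (Q (-y) + b) - B (P (-(y + r)) + a) (Q (-(y + r)) + b))
      = 2 * (B (P y) (Q r) + B (P r) (Q y)) := by
  simp only [map_add, map_sub, map_neg, LinearMap.add_apply, LinearMap.sub_apply,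
    LinearMap.neg_apply]
  ring

/-- The second-order form of `V_ρ`, evaluated on the deviations of the bonds `τ` and `ς` at the
point `x + p`. -/
def bondForm (V : Stencil d → EReal) (κ : ℝ) (u : Eu d → Eu d) (x v : Eu d)
    (q : LatStar d × LatStar d × LatStar d) (p : Eu d) : ℝ :=
  partialV V κ ![q.2.1, q.2.2, q.1] (homStencil (fderiv ℝ u x))
    ![stencilDev u x p q.2.1, stencilDev u x p q.2.2, v]

/-- The difference of `bondForm` along the bond `ρ`, averaged over the sites. -/
def meanBondForm (ζ : Eu d → ℝ) (c : ℝ) (V : Stencil d → EReal) (κ : ℝ) (u : Eu d → Eu d)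
    (x v : Eu d) (q : LatStar d × LatStar d × LatStar d) : ℝ :=
  siteMean ζ c x fun ξ => bondForm V κ u x v q (latVec ξ - x)
    - bondForm V κ u x v q (latVec ξ - x - dirVec q.1)

/-- The bound for the symmetrised second-order term. -/
def secondBound (c κ : ℝ) (V : Stencil d → EReal) (u : Eu d → Eu d) (x v : Eu d)
    (q : LatStar d × LatStar d × LatStar d) : ℝ :=
  partialSup V κ ![q.2.1, q.2.2, q.1] * ‖v‖ *
    (locNorm c u x 3 q.1 q.2.1 * (bondScale c q.1 q.2.1 ^ 2 * ‖dirVec q.2.1‖)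
        * (locNorm c u x 2 q.1 q.2.2 * (bondScale c q.1 q.2.2 * ‖dirVec q.2.2‖))
      + locNorm c u x 2 q.1 q.2.1 * (bondScale c q.1 q.2.1 * ‖dirVec q.2.1‖)
        * (locNorm c u x 3 q.1 q.2.2 * (bondScale c q.1 q.2.2 ^ 2 * ‖dirVec q.2.2‖)))

/-- Replacing the finite differences by second derivatives in `bondForm`. -/
theorem MemWInftyLoc.abs_bilin_stencilDev_sub_le (hu : MemWInftyLoc 4 u) (hcu : Continuous u)
    (hc : 0 < c) (x : Eu d) {B : Eu d →ₗ[ℝ] Eu d →ₗ[ℝ] ℝ} {N : ℝ} (hN : 0 ≤ N)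
    (hB : ∀ a b, |B a b| ≤ N * (‖a‖ * ‖b‖)) {y : Eu d} (hy : ‖y‖ ≤ c) {t : ℝ}
    (ht : t ∈ Icc (0 : ℝ) 1) (ρ τ ς : LatStar d) {p : Eu d} (hp : p = y + t • -dirVec ρ) :
    |B (stencilDev u x p τ) (stencilDev u x p ς)
        - B (fderiv ℝ (fderiv ℝ u) x (p + (1 / 2 : ℝ) • dirVec τ) (dirVec τ))
          (fderiv ℝ (fderiv ℝ u) x (p + (1 / 2 : ℝ) • dirVec ς) (dirVec ς))|
      ≤ N * (locNorm c u x 3 ρ τ * (bondScale c ρ τ ^ 2 * ‖dirVec τ‖)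
          * (locNorm c u x 2 ρ ς * (bondScale c ρ ς * ‖dirVec ς‖))
        + locNorm c u x 2 ρ τ * (bondScale c ρ τ * ‖dirVec τ‖)
          * (locNorm c u x 3 ρ ς * (bondScale c ρ ς ^ 2 * ‖dirVec ς‖))) := by
  subst hp
  exact abs_bilin_sub_le B hN hB (hu.norm_stencilDev_sub_le hcu hc x hy ht ρ τ)
    (hu.norm_stencilDev_le hcu hc x hy ht ρ ς) (hu.norm_second_term_le hcu hc x hy ht ρ τ)
    (hu.norm_stencilDev_sub_le hcu hc x hy ht ρ ς)

/-- After symmetrisation over opposite bonds the second-order term is, up to errors involving `∇³u`,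
the mean of a linear function of `ξ - x`, which vanishes. -/
theorem MemWInftyLoc.abs_meanBondForm_add_le (hu : MemWInftyLoc 4 u) (hcu : Continuous u)
    (hV : IsSiteEnergy κ k V) (hκ : 0 < κ) (hk : 4 ≤ k) (hK : MemK κ u)
    (hc : 0 < c) (hζ : IsNodalBasis ζ) (hsupp : Function.support ζ ⊆ Metric.closedBall 0 c)
    (x v : Eu d) (ρ τ ς : LatStar d) :
    |meanBondForm ζ c V κ u x v (ρ, τ, ς)
        + meanBondForm ζ c V κ u x v (negDir ρ, negDir τ, negDir ς)|
      ≤ 4 * secondBound c κ V u x v (ρ, τ, ς) := by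
  have hF := homStencil_mem (hu.norm_fderiv_le hcu hκ hK x)
  set M := partialV V κ ![τ, ς, ρ] (homStencil (fderiv ℝ u x)) with hM
  set N := partialSup V κ ![τ, ς, ρ] * ‖v‖ with hN
  have hN0 : 0 ≤ N := mul_nonneg (partialSup_nonneg _) (norm_nonneg _)
  let B := trilinearFix M v
  have hB : ∀ a b, |B a b| ≤ N * (‖a‖ * ‖b‖) := fun a b => by
    refine (hV.abs_partialV_le (by omega) (by omega) ![τ, ς, ρ] hF ![a, b, v]).trans ?_
    simp only [Fin.prod_univ_three, Matrix.cons_val_zero, Matrix.cons_val_one, Matrix.cons_val]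
    exact le_of_eq (by ring)
  let P : Eu d →ₗ[ℝ] Eu d := ((fderiv ℝ (fderiv ℝ u) x).flip (dirVec τ)).toLinearMap
  let Q : Eu d →ₗ[ℝ] Eu d := ((fderiv ℝ (fderiv ℝ u) x).flip (dirVec ς)).toLinearMap
  have hP : ∀ z, fderiv ℝ (fderiv ℝ u) x z (dirVec τ) = P z := fun z => rfl
  have hQ : ∀ z, fderiv ℝ (fderiv ℝ u) x z (dirVec ς) = Q z := fun z => rfl
  set a := P ((1 / 2 : ℝ) • dirVec τ) with ha
  set b := Q ((1 / 2 : ℝ) • dirVec ς) with hb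
  -- the two bond forms at opposite bonds, with opposite signs
  have e1 : ∀ p, bondForm V κ u x v (ρ, τ, ς) p = B (stencilDev u x p τ) (stencilDev u x p ς) :=
    fun p => rfl
  have e2 : ∀ p, bondForm V κ u x v (negDir ρ, negDir τ, negDir ς) p
      = -B (stencilDev u x p (negDir τ)) (stencilDev u x p (negDir ς)) := fun p =>
    partialV_negDir_three hV hκ hk hF τ ς ρ _
  set D := locNorm c u x 3 ρ τ * (bondScale c ρ τ ^ 2 * ‖dirVec τ‖)
          * (locNorm c u x 2 ρ ς * (bondScale c ρ ς * ‖dirVec ς‖))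
        + locNorm c u x 2 ρ τ * (bondScale c ρ τ * ‖dirVec τ‖)
          * (locNorm c u x 3 ρ ς * (bondScale c ρ ς ^ 2 * ‖dirVec ς‖)) with hD
  have b1 : ∀ {y : Eu d}, ‖y‖ ≤ c → ∀ {t : ℝ}, t ∈ Icc (0 : ℝ) 1 → ∀ {p : Eu d},
      p = y + t • -dirVec ρ →
      |B (stencilDev u x p τ) (stencilDev u x p ς) - B (P p + a) (Q p + b)| ≤ N * D :=
    fun hy t ht p hp => by
      have := hu.abs_bilin_stencilDev_sub_le hcu hc x hN0 hB hy ht ρ τ ς hp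
      rwa [hP, hQ, map_add P, map_add Q] at this
  have b2 : ∀ {y : Eu d}, ‖y‖ ≤ c → ∀ {t : ℝ}, t ∈ Icc (0 : ℝ) 1 → ∀ {p : Eu d},
      p = y + t • dirVec ρ →
      |B (stencilDev u x p (negDir τ)) (stencilDev u x p (negDir ς))
        - B (P (-p) + a) (Q (-p) + b)| ≤ N * D :=
    fun hy t ht p hp => by
      have := hu.abs_bilin_stencilDev_sub_le hcu hc x hN0 hB hy ht (negDir ρ) (negDir τ)
        (negDir ς) (p := p) (by rw [hp, dirVec_negDir, neg_neg])
      simp only [locNorm_negDir, bondScale_negDir, dirVec_negDir, norm_neg, map_neg, hP, hQ] at this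
      have e3 : -P (p + (1 / 2 : ℝ) • -dirVec τ) = P (-p) + a := by
        rw [ha, ← map_neg, ← map_add]
        congr 1
        module
      have e4 : -Q (p + (1 / 2 : ℝ) • -dirVec ς) = Q (-p) + b := by
        rw [hb, ← map_neg, ← map_add]
        congr 1
        module
      rwa [← map_neg B, ← map_neg, e3, e4] at this
  -- the part that survives the symmetrisation is linear in `ξ - x`
  have h0 : siteMean ζ c x (fun ξ => 2 * (B (P (latVec ξ - x)) (Q (dirVec ρ))
      + B (P (dirVec ρ)) (Q (latVec ξ - x)))) = 0 :=
    hζ.siteMean_linear hsupp x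
      ((2 : ℝ) • ((B.flip (Q (dirVec ρ))).comp P + (B (P (dirVec ρ))).comp Q))
  have e5 : meanBondForm ζ c V κ u x v (ρ, τ, ς)
        + meanBondForm ζ c V κ u x v (negDir ρ, negDir τ, negDir ς)
      = siteMean ζ c x (fun ξ => bondForm V κ u x v (ρ, τ, ς) (latVec ξ - x)
          - bondForm V κ u x v (ρ, τ, ς) (latVec ξ - x - dirVec ρ)
          + (bondForm V κ u x v (negDir ρ, negDir τ, negDir ς) (latVec ξ - x)
          - bondForm V κ u x v (negDir ρ, negDir τ, negDir ς) (latVec ξ - x - dirVec (negDir ρ)))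
          - 2 * (B (P (latVec ξ - x)) (Q (dirVec ρ))
      + B (P (dirVec ρ)) (Q (latVec ξ - x)))) := by
    rw [siteMean_sub, h0, sub_zero, siteMean_add]
    rfl
  rw [e5, ← Real.norm_eq_abs]
  refine (hζ.norm_siteMean_le hsupp x (A := 4 * (N * D)) fun ξ hξ => ?_)
  set y := latVec ξ - x with hy
  have h1 := b1 hξ (t := 0) (by simp) (p := y) (by simp)
  have h2 := b1 hξ (t := 1) (by simp) (p := y - dirVec ρ) (by simp [sub_eq_add_neg])
  have h3 := b2 hξ (t := 0) (by simp) (p := y) (by simp)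
  have h4 := b2 hξ (t := 1) (by simp) (p := y + dirVec ρ) (by simp)
  rw [e1, e1, e2, e2, dirVec_negDir, sub_neg_eq_add y, ← quadratic_symm_diff B P Q y (dirVec ρ) a b,
    Real.norm_eq_abs]
  rw [abs_le] at h1 h2 h3 h4 ⊢
  constructor <;> linarith [h1.1, h1.2, h2.1, h2.2, h3.1, h3.2, h4.1, h4.2]

/-- The contribution of second order in the deformation. -/
theorem MemWInftyLoc.enorm_tsum_second_le (hu : MemWInftyLoc 4 u) (hcu : Continuous u)
    (hV : IsSiteEnergy κ k V) (hκ : 0 < κ) (hk : 4 ≤ k) (hK : MemK κ u)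
    (hc : 0 < c) (hζ : IsNodalBasis ζ) (hsupp : Function.support ζ ⊆ Metric.closedBall 0 c)
    (x v : Eu d) (hs : Summable (meanBondForm ζ c V κ u x v)) :
    ‖(∑' q, meanBondForm ζ c V κ u x v q) / 2‖ₑ
      ≤ ∑' q, ENNReal.ofReal (secondBound c κ V u x v q) := by
  rw [← tsum_div_const]
  refine enorm_tsum_le_of_symm (hs.div_const 2) ((negDirEquiv d).prodCongr
    ((negDirEquiv d).prodCongr (negDirEquiv d))) fun q => ?_
  obtain ⟨ρ, τ, ς⟩ := q
  have h := hu.abs_meanBondForm_add_le hcu hV hκ hk hK hc hζ hsupp x v ρ τ ς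
  change |_ + meanBondForm ζ c V κ u x v (negDir ρ, negDir τ, negDir ς) / 2| ≤ _
  rw [← add_div, abs_div, abs_two]
  linarith

end SecondOrder

/-! ### Expansion of the atomistic force -/

section Expansion

variable {d : ℕ} {ζ : Eu d → ℝ} {c κ : ℝ} {k : ℕ} {V : Stencil d → EReal} {u : Eu d → Eu d}

/-- The bound for the remainder of third order, for the bond `ρ` at one of its two sites. -/
def thirdBound (c κ : ℝ) (V : Stencil d → EReal) (u : Eu d → Eu d) (x v : Eu d) (ρ : LatStar d)
    (p : LatStar d × LatStar d × LatStar d) : ℝ :=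
  partialSup V κ ![p.1, p.2.1, p.2.2, ρ] *
    (locNorm c u x 2 ρ p.1 * (bondScale c ρ p.1 * ‖dirVec p.1‖)
      * (locNorm c u x 2 ρ p.2.1 * (bondScale c ρ p.2.1 * ‖dirVec p.2.1‖))
      * (locNorm c u x 2 ρ p.2.2 * (bondScale c ρ p.2.2 * ‖dirVec p.2.2‖)) * ‖v‖)

theorem bondScale_nonneg (hc : 0 < c) (ρ ς : LatStar d) : 0 ≤ bondScale c ρ ς := by
  unfold bondScale
  positivity

theorem MemWInftyLoc.entry_diffStencil_sub (hu : MemWInftyLoc 4 u) (hcu : Continuous u)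
    (hκ : 0 < κ) (hK : MemK κ u) (x : Eu d) (η : ZLat d) (ς : LatStar d) :
    (diffStencil u η - homStencil (fderiv ℝ u x)).entry ς = stencilDev u x (latVec η - x) ς := by
  rw [Stencil.entry_sub, hu.entry_diffStencil hcu hκ hK, entry_homStencil, stencilDev,
    add_sub_cancel]

/-- The error of the second-order expansion of `V_ρ(Du(η))[v]` at the homogeneous stencil
`∇u(x) · Λ_*`. -/
def siteError (V : Stencil d → EReal) (κ : ℝ) (u : Eu d → Eu d) (x v : Eu d) (ρ : LatStar d)
    (η : ZLat d) : ℝ :=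
  partialV V κ ![ρ] (diffStencil u η) ![v] - partialV V κ ![ρ] (homStencil (fderiv ℝ u x)) ![v]
    - (∑' ς, partialV V κ ![ς, ρ] (homStencil (fderiv ℝ u x)) ![stencilDev u x (latVec η - x) ς, v])
    - (∑' p : LatStar d × LatStar d, bondForm V κ u x v (ρ, p) (latVec η - x)) / 2

theorem MemWInftyLoc.enorm_siteError_le (hu : MemWInftyLoc 4 u) (hcu : Continuous u)
    (hV : IsSiteEnergy κ k V) (hκ : 0 < κ) (hk : 4 ≤ k) (hK : MemK κ u) (hc : 0 < c)
    (x v : Eu d) {y : Eu d} (hy : ‖y‖ ≤ c) {t : ℝ} (ht : t ∈ Icc (0 : ℝ) 1) (ρ : LatStar d)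
    {η : ZLat d} (hη : latVec η - x = y + t • -dirVec ρ) :
    ‖siteError V κ u x v ρ η‖ₑ ≤ ∑' p, ENNReal.ofReal (thirdBound c κ V u x v ρ p) := by
  have hF := homStencil_mem (hu.norm_fderiv_le hcu hκ hK x)
  have h := hV.abs_taylor_two_le ![ρ] ![v] hκ (by omega) hF (hu.diffStencil_mem hcu hκ hK η)
  have hs := hV.summable_remTwo ![ρ] ![v] (by omega)
    (diffStencil u η - homStencil (fderiv ℝ u x))
  simp only [hu.entry_diffStencil_sub hcu hκ hK] at h
  change |siteError V κ u x v ρ η| ≤ _ at h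
  rw [← ofReal_norm, Real.norm_eq_abs]
  refine (ENNReal.ofReal_le_ofReal h).trans ?_
  rw [ENNReal.ofReal_tsum_of_nonneg (fun p => remTwo_nonneg _ _ _ p) hs]
  refine ENNReal.tsum_le_tsum fun p => ENNReal.ofReal_le_ofReal ?_
  rw [remTwo, thirdBound]
  simp only [hu.entry_diffStencil_sub hcu hκ hK, hη, Finset.univ_unique, Finset.prod_singleton,
    Matrix.cons_val_fin_one]
  have hb := fun ς => hu.norm_stencilDev_le hcu hc x hy ht ρ ς
  have h0 := partialSup_nonneg (V := V) (κ := κ) ![p.1, p.2.1, p.2.2, ρ]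
  have hl := fun ς => locNorm_nonneg (c := c) (u := u) x 2 ρ ς
  have hR := fun ς => bondScale_nonneg hc ρ ς
  have hb' := fun ς => mul_nonneg (hl ς) (mul_nonneg (hR ς) (norm_nonneg (dirVec ς)))
  refine mul_le_mul_of_nonneg_left ?_ h0
  refine mul_le_mul_of_nonneg_right ?_ (norm_nonneg v)
  exact mul_le_mul (mul_le_mul (hb _) (hb _) (norm_nonneg _) (hb' _)) (hb _) (norm_nonneg _)
    (mul_nonneg (hb' _) (hb' _))

/-- The contribution of the bond `ρ` to the divergence of the atomistic stress. -/
def bondForce (ζ : Eu d → ℝ) (c : ℝ) (V : Stencil d → EReal) (κ : ℝ) (u : Eu d → Eu d)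
    (x v : Eu d) (ρ : LatStar d) : ℝ :=
  siteMean ζ c x fun ξ => partialV V κ ![ρ] (diffStencil u ξ) ![v]
    - partialV V κ ![ρ] (diffStencil u (ξ - ρ.1)) ![v]

theorem MemWInftyLoc.summable_first_dev (hu : MemWInftyLoc 4 u) (hcu : Continuous u)
    (hV : IsSiteEnergy κ k V) (hκ : 0 < κ) (hk : 4 ≤ k) (hK : MemK κ u) (x v : Eu d)
    (ρ : LatStar d) (η : ZLat d) :
    Summable fun ς => partialV V κ ![ς, ρ] (homStencil (fderiv ℝ u x))
      ![stencilDev u x (latVec η - x) ς, v] := by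
  have hF := homStencil_mem (hu.norm_fderiv_le hcu hκ hK x)
  refine Summable.of_norm_bounded (hV.summable_first ![ρ] ![v] (by omega)
    (diffStencil u η - homStencil (fderiv ℝ u x))) fun ς => ?_
  rw [← hu.entry_diffStencil_sub hcu hκ hK]
  exact hV.abs_first_le ![ρ] ![v] (by omega) hF _ ς

theorem MemWInftyLoc.summable_bondForm (hu : MemWInftyLoc 4 u) (hcu : Continuous u)
    (hV : IsSiteEnergy κ k V) (hκ : 0 < κ) (hk : 4 ≤ k) (hK : MemK κ u) (x v : Eu d)
    (ρ : LatStar d) (η : ZLat d) :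
    Summable fun p => bondForm V κ u x v (ρ, p) (latVec η - x) := by
  have hF := homStencil_mem (hu.norm_fderiv_le hcu hκ hK x)
  refine Summable.of_norm_bounded (hV.summable_remOne ![ρ] ![v] (by omega)
    (diffStencil u η - homStencil (fderiv ℝ u x))) fun p => ?_
  rw [bondForm, ← hu.entry_diffStencil_sub hcu hκ hK, ← hu.entry_diffStencil_sub hcu hκ hK]
  exact hV.abs_second_le ![ρ] ![v] (by omega) hF _ p

theorem latVec_sub_val_sub (ξ : ZLat d) (ρ : LatStar d) (x : Eu d) :
    latVec (ξ - ρ.1) - x = latVec ξ - x - dirVec ρ := by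
  rw [latVec_sub, dirVec]
  abel

/-- The form `a ↦ M(a, v)` of a bilinear form `M`. -/
def bilinearFix (M : ContinuousMultilinearMap ℝ (fun _ : Fin 2 => Eu d) ℝ) (v : Eu d) :
    Eu d →ₗ[ℝ] ℝ where
  toFun a := M ![a, v]
  map_add' a b := congrArg (fun L : ContinuousMultilinearMap ℝ (fun _ : Fin 1 => Eu d) ℝ => L ![v])
    (map_add M.curryLeft a b)
  map_smul' t a := congrArg (fun L : ContinuousMultilinearMap ℝ (fun _ : Fin 1 => Eu d) ℝ => L ![v])
    (map_smul M.curryLeft t a)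

/-- The averaged errors of the expansions at `ξ` and `ξ - ρ`: the terms of order zero cancel, and
averaging commutes with the sums over bonds. -/
theorem MemWInftyLoc.siteMean_siteError (hu : MemWInftyLoc 4 u) (hcu : Continuous u)
    (hV : IsSiteEnergy κ k V) (hκ : 0 < κ) (hk : 4 ≤ k) (hK : MemK κ u) (x v : Eu d)
    (ρ : LatStar d) :
    siteMean ζ c x (fun ξ => siteError V κ u x v ρ ξ - siteError V κ u x v ρ (ξ - ρ.1))
      = bondForce ζ c V κ u x v ρ
        - (∑' ς, partialV V κ ![ς, ρ] (homStencil (fderiv ℝ u x)) ![meanDiff ζ c u x ρ ς, v])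
        - (∑' p, meanBondForm ζ c V κ u x v (ρ, p)) / 2 := by
  set F := homStencil (fderiv ℝ u x) with hF
  have s1 := fun η => hu.summable_first_dev hcu hV hκ hk hK x v ρ η
  have s2 := fun η => hu.summable_bondForm hcu hV hκ hk hK x v ρ η
  have e1 : ∑' ς, partialV V κ ![ς, ρ] F ![meanDiff ζ c u x ρ ς, v]
      = siteMean ζ c x fun ξ =>
        (∑' ς, partialV V κ ![ς, ρ] F ![stencilDev u x (latVec ξ - x) ς, v])
        - ∑' ς, partialV V κ ![ς, ρ] F ![stencilDev u x (latVec (ξ - ρ.1) - x) ς, v] := by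
    refine Eq.trans ?_ (congrArg (siteMean ζ c x)
      (funext fun ξ => (s1 ξ).tsum_sub (s1 (ξ - ρ.1))))
    rw [siteMean_tsum x fun ξ => (s1 ξ).sub (s1 (ξ - ρ.1))]
    refine tsum_congr fun ς => ?_
    simp only [latVec_sub_val_sub]
    refine (map_siteMean (bilinearFix (partialV V κ ![ς, ρ] F) v) x _).trans ?_
    simp only [map_sub]
    rfl
  have e2 : (∑' p, meanBondForm ζ c V κ u x v (ρ, p)) / 2 = siteMean ζ c x fun ξ =>
        (∑' p : LatStar d × LatStar d, bondForm V κ u x v (ρ, p) (latVec ξ - x)) / 2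
        - (∑' p : LatStar d × LatStar d, bondForm V κ u x v (ρ, p) (latVec (ξ - ρ.1) - x)) / 2 := by
    simp only [← tsum_div_const]
    refine Eq.trans ?_ (congrArg (siteMean ζ c x)
      (funext fun ξ => ((s2 ξ).div_const 2).tsum_sub ((s2 (ξ - ρ.1)).div_const 2)))
    rw [siteMean_tsum x fun ξ => ((s2 ξ).div_const 2).sub ((s2 (ξ - ρ.1)).div_const 2)]
    refine tsum_congr fun p => ?_
    simp only [latVec_sub_val_sub, ← sub_div, meanBondForm, siteMean, Finset.sum_div, smul_eq_mul,
      mul_div_assoc]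
  rw [e1, e2, bondForce, ← siteMean_sub, ← siteMean_sub]
  congr 1
  funext ξ
  simp only [siteError]
  ring

theorem MemWInftyLoc.enorm_siteMean_siteError_le (hu : MemWInftyLoc 4 u) (hcu : Continuous u)
    (hV : IsSiteEnergy κ k V) (hκ : 0 < κ) (hk : 4 ≤ k) (hK : MemK κ u) (hc : 0 < c)
    (hζ : IsNodalBasis ζ) (hsupp : Function.support ζ ⊆ Metric.closedBall 0 c) (x v : Eu d)
    (ρ : LatStar d) :
    ‖siteMean ζ c x (fun ξ => siteError V κ u x v ρ ξ - siteError V κ u x v ρ (ξ - ρ.1))‖ₑ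
      ≤ 2 * ∑' p, ENNReal.ofReal (thirdBound c κ V u x v ρ p) := by
  refine hζ.enorm_siteMean_le hsupp x fun ξ hξ => ?_
  rw [two_mul]
  refine (enorm_sub_le).trans (add_le_add ?_ ?_)
  · exact hu.enorm_siteError_le hcu hV hκ hk hK hc x v hξ (t := 0) (by simp) ρ (by simp)
  · exact hu.enorm_siteError_le hcu hV hκ hk hK hc x v hξ (t := 1) (by simp) ρ
      (by rw [latVec_sub_val_sub, one_smul, sub_eq_add_neg])

theorem MemWInftyLoc.norm_meanDiff_le (hu : MemWInftyLoc 4 u) (hcu : Continuous u)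
    (hκ : 0 < κ) (hK : MemK κ u)
    (hζ : IsNodalBasis ζ) (hsupp : Function.support ζ ⊆ Metric.closedBall 0 c) (x : Eu d)
    (ρ ς : LatStar d) :
    ‖meanDiff ζ c u x ρ ς‖ ≤ 4 * κ * (‖dirVec ρ‖ * ‖dirVec ς‖) := by
  have h : ‖meanDiff ζ c u x ρ ς‖ ≤ 4 * κ * ‖dirVec ς‖ :=
    hζ.norm_siteMean_le hsupp x fun ξ _ => by
      have h1 := hu.norm_stencilDev_le_two_mul hcu hκ hK x (latVec ξ - x) ς
      have h2 := hu.norm_stencilDev_le_two_mul hcu hκ hK x (latVec ξ - x - dirVec ρ) ς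
      refine (_root_.norm_sub_le _ _).trans ?_
      linarith
  refine h.trans ?_
  gcongr
  exact le_mul_of_one_le_left (norm_nonneg _) (one_le_norm_dirVec ρ)

theorem MemWInftyLoc.summable_meanBondForm (hu : MemWInftyLoc 4 u) (hcu : Continuous u)
    (hV : IsSiteEnergy κ k V) (hκ : 0 < κ) (hk : 4 ≤ k) (hK : MemK κ u)
    (hζ : IsNodalBasis ζ) (hsupp : Function.support ζ ⊆ Metric.closedBall 0 c) (x v : Eu d) :
    Summable (meanBondForm ζ c V κ u x v) := by
  have hF := homStencil_mem (hu.norm_fderiv_le hcu hκ hK x)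
  have hs := hV.summable_mul (j := 3) (by omega) (by omega)
    (e := fun q : LatStar d × LatStar d × LatStar d => ![q.2.1, q.2.2, q.1])
    (fun a b h => Prod.ext (by simpa using congrFun h 2)
      (Prod.ext (by simpa using congrFun h 0) (by simpa using congrFun h 1)))
    (y := fun q => 2 * ((2 * κ * ‖dirVec q.2.1‖) * (2 * κ * ‖dirVec q.2.2‖) * ‖v‖))
    (8 * κ ^ 2 * ‖v‖) (fun p => by positivity)
    (fun q => by
      simp only [Fin.prod_univ_three, Matrix.cons_val_zero, Matrix.cons_val_one, Matrix.cons_val]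
      calc _ = 8 * κ ^ 2 * ‖v‖ * (‖dirVec q.2.1‖ * ‖dirVec q.2.2‖) := by ring
        _ ≤ _ := by
          refine mul_le_mul_of_nonneg_left ?_ (by positivity)
          exact le_mul_of_one_le_right (by positivity) (one_le_norm_dirVec _))
  refine Summable.of_norm_bounded hs fun q => ?_
  have hb : ∀ p, |bondForm V κ u x v q p| ≤ partialSup V κ ![q.2.1, q.2.2, q.1]
      * ((2 * κ * ‖dirVec q.2.1‖) * (2 * κ * ‖dirVec q.2.2‖) * ‖v‖) := fun p => by
    refine (hV.abs_partialV_le (j := 3) (by omega) (by omega) _ hF _).trans ?_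
    simp only [Fin.prod_univ_three, Matrix.cons_val_zero, Matrix.cons_val_one, Matrix.cons_val]
    have h0 := partialSup_nonneg (V := V) (κ := κ) ![q.2.1, q.2.2, q.1]
    gcongr <;> exact hu.norm_stencilDev_le_two_mul hcu hκ hK x _ _
  refine hζ.norm_siteMean_le hsupp x fun ξ _ => ?_
  refine (_root_.norm_sub_le _ _).trans ?_
  have h1 := hb (latVec ξ - x)
  have h2 := hb (latVec ξ - x - dirVec q.1)
  rw [← Real.norm_eq_abs] at h1 h2
  linarith

theorem MemWInftyLoc.summable_bondForce (hu : MemWInftyLoc 4 u) (hcu : Continuous u)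
    (hV : IsSiteEnergy κ k V) (hκ : 0 < κ) (hk : 4 ≤ k) (hK : MemK κ u)
    (hζ : IsNodalBasis ζ) (hsupp : Function.support ζ ⊆ Metric.closedBall 0 c) (x v : Eu d) :
    Summable (bondForce ζ c V κ u x v) := by
  have hs := hV.summable_mul (j := 1) (by omega) (by omega)
    (e := fun ρ : LatStar d => ![ρ]) (fun a b h => by simpa using congrFun h 0)
    (y := fun _ => 2 * ‖v‖) (2 * ‖v‖) (fun _ => by positivity)
    (fun ρ => by
      simp only [Finset.univ_unique, Finset.prod_singleton, Matrix.cons_val_fin_one]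
      exact le_mul_of_one_le_right (by positivity) (one_le_norm_dirVec _))
  refine Summable.of_norm_bounded hs fun ρ => ?_
  have hb : ∀ ξ, ‖partialV V κ ![ρ] (diffStencil u ξ) ![v]‖ ≤ partialSup V κ ![ρ] * ‖v‖ :=
    fun ξ => by
      refine (hV.abs_partialV_le (j := 1) (by omega) (by omega) _
        (hu.diffStencil_mem hcu hκ hK ξ) _).trans (le_of_eq ?_)
      simp only [Finset.univ_unique, Finset.prod_singleton, Matrix.cons_val_fin_one]
  refine hζ.norm_siteMean_le hsupp x fun ξ _ => (_root_.norm_sub_le _ _).trans ?_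
  linarith [hb ξ, hb (ξ - ρ.1)]

/-- The total atomistic force density compared with its Cauchy--Born value. -/
theorem MemWInftyLoc.enorm_tsum_bondForce_sub_le (hu : MemWInftyLoc 4 u) (hcu : Continuous u)
    (hV : IsSiteEnergy κ k V) (hκ : 0 < κ) (hk : 4 ≤ k) (hK : MemK κ u) (hc : 0 < c)
    (hζ : IsNodalBasis ζ) (hsupp : Function.support ζ ⊆ Metric.closedBall 0 c) (x v : Eu d) :
    ‖(∑' ρ, bondForce ζ c V κ u x v ρ) - ∑' q : LatStar d × LatStar d,
        partialV V κ ![q.2, q.1] (homStencil (fderiv ℝ u x))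
          ![fderiv ℝ (fderiv ℝ u) x (dirVec q.1) (dirVec q.2), v]‖ₑ
      ≤ (∑' q : LatStar d × LatStar d, ENNReal.ofReal (partialSup V κ ![q.2, q.1] *
        (locNorm c u x 4 q.1 q.2 * (bondScale c q.1 q.2 ^ 2 * ‖dirVec q.1‖ * ‖dirVec q.2‖)
          * ‖v‖)))
        + (∑' q, ENNReal.ofReal (secondBound c κ V u x v q))
        + 2 * ∑' ρ, ∑' p, ENNReal.ofReal (thirdBound c κ V u x v ρ p) := by
  have hF := homStencil_mem (hu.norm_fderiv_le hcu hκ hK x)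
  have hU : ∀ q : LatStar d × LatStar d,
      ‖fderiv ℝ (fderiv ℝ u) x (dirVec q.1) (dirVec q.2)‖
        ≤ ‖fderiv ℝ (fderiv ℝ u) x‖ * (‖dirVec q.1‖ * ‖dirVec q.2‖) := fun q => by
    rw [← mul_assoc]
    exact ContinuousLinearMap.le_opNorm₂ _ _ _
  have hD : ∀ q : LatStar d × LatStar d, ‖meanDiff ζ c u x q.1 q.2‖
      ≤ 4 * κ * (‖dirVec q.1‖ * ‖dirVec q.2‖) := fun q =>
    hu.norm_meanDiff_le hcu hκ hK hζ hsupp x q.1 q.2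
  have sD := hV.summable_partialV_two hk hF hD v
  have sU := hV.summable_partialV_two hk hF hU v
  have e1 : ∀ q : LatStar d × LatStar d,
      partialV V κ ![q.2, q.1] (homStencil (fderiv ℝ u x)) ![meanDefect ζ c u x q.1 q.2, v]
      = partialV V κ ![q.2, q.1] (homStencil (fderiv ℝ u x)) ![meanDiff ζ c u x q.1 q.2, v]
        - partialV V κ ![q.2, q.1] (homStencil (fderiv ℝ u x))
          ![fderiv ℝ (fderiv ℝ u) x (dirVec q.1) (dirVec q.2), v] := fun q =>
    map_sub (bilinearFix (partialV V κ ![q.2, q.1] (homStencil (fderiv ℝ u x))) v) _ _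
  have s1 : Summable fun q : LatStar d × LatStar d =>
      partialV V κ ![q.2, q.1] (homStencil (fderiv ℝ u x)) ![meanDefect ζ c u x q.1 q.2, v] := by
    simp only [e1]
    exact sD.sub sU
  have s2 := hu.summable_meanBondForm hcu hV hκ hk hK hζ hsupp x v
  have s3 := hu.summable_bondForce hcu hV hκ hk hK hζ hsupp x v
  have key : (∑' ρ, bondForce ζ c V κ u x v ρ) - ∑' q : LatStar d × LatStar d,
        partialV V κ ![q.2, q.1] (homStencil (fderiv ℝ u x))
          ![fderiv ℝ (fderiv ℝ u) x (dirVec q.1) (dirVec q.2), v]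
      = (∑' q : LatStar d × LatStar d, partialV V κ ![q.2, q.1] (homStencil (fderiv ℝ u x))
          ![meanDefect ζ c u x q.1 q.2, v])
        + (∑' q, meanBondForm ζ c V κ u x v q) / 2
        + ∑' ρ, siteMean ζ c x
          (fun ξ => siteError V κ u x v ρ ξ - siteError V κ u x v ρ (ξ - ρ.1)) := by
    simp only [hu.siteMean_siteError hcu hV hκ hk hK x v, e1]
    rw [sD.tsum_sub sU, (s3.sub sD.prod).tsum_sub (s2.prod.div_const 2), s3.tsum_sub sD.prod,
      tsum_div_const, ← sD.tsum_prod, ← s2.tsum_prod]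
    ring
  rw [key]
  refine (enorm_add_le _ _).trans (add_le_add ((enorm_add_le _ _).trans (add_le_add ?_ ?_)) ?_)
  · exact hu.enorm_tsum_first_le hcu hV hκ hk hK hc hζ hsupp x v s1
  · exact hu.enorm_tsum_second_le hcu hV hκ hk hK hc hζ hsupp x v s2
  · refine enorm_tsum_le_tsum_enorm.trans ?_
    rw [← ENNReal.tsum_mul_left]
    exact ENNReal.tsum_le_tsum fun ρ =>
      hu.enorm_siteMean_siteError_le hcu hV hκ hk hK hc hζ hsupp x v ρ

end Expansion

/-! ### Comparison with the weights `m_d^{(∞)}` -/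

section Weights

variable {d : ℕ} {ζ : Eu d → ℝ} {c κ : ℝ} {k : ℕ} {V : Stencil d → EReal} {u : Eu d → Eu d}

/-- The weight for `p = ∞`: the exponent `1 / ((j - 1) p)` is zero, and the factor `|ρ_1|` of
`m(ρ)` is cancelled by the denominator. -/
theorem IsSiteEnergy.mDyn_top_eq (hV : IsSiteEnergy κ k V) {n : ℕ} (hn : n + 2 ≤ k)
    (ρ : Fin (n + 2) → LatStar d) :
    mDyn V κ ∞ ρ = ENNReal.ofReal (partialSup V κ ρ *
      ((∏ i : Fin (n + 1), ‖dirVec (ρ i.succ)‖) * (∑ i, ‖dirVec (ρ i)‖) ^ 3)) := by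
  have h0 : (((n + 1 : ℕ) : ℝ≥0∞) * (∞ : ℝ≥0∞))⁻¹.toReal = 0 := by
    rw [ENNReal.mul_top (by exact_mod_cast n.succ_ne_zero), ENNReal.inv_top, ENNReal.toReal_zero]
  rw [mDyn, h0, Real.rpow_zero, mul_one, hV.mBound_eq (by omega) hn, ← ENNReal.ofReal_mul
    (mul_nonneg (partialSup_nonneg _) (prod_norm_dirVec_pos _).le), Fin.prod_univ_succ]
  have := norm_dirVec_pos (ρ 0)
  congr 1
  field_simp

theorem IsSiteEnergy.mDyn_top_two (hV : IsSiteEnergy κ k V) (hk : 4 ≤ k) (ρ ς : LatStar d) :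
    mDyn V κ ∞ ![ρ, ς] = ENNReal.ofReal (partialSup V κ ![ρ, ς] *
      (‖dirVec ς‖ * (‖dirVec ρ‖ + ‖dirVec ς‖) ^ 3)) :=
  (hV.mDyn_top_eq (n := 0) (by omega) ![ρ, ς]).trans
    (congrArg (fun t => ENNReal.ofReal (partialSup V κ ![ρ, ς] * t))
      (congrArg₂ (fun a b : ℝ => a * b ^ 3)
        (Fin.prod_univ_one fun i : Fin 1 => ‖dirVec (![ρ, ς] i.succ)‖)
        (Fin.sum_univ_two fun i : Fin 2 => ‖dirVec (![ρ, ς] i)‖)))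

theorem IsSiteEnergy.mDyn_top_three (hV : IsSiteEnergy κ k V) (hk : 4 ≤ k) (ρ τ ς : LatStar d) :
    mDyn V κ ∞ ![ρ, τ, ς] = ENNReal.ofReal (partialSup V κ ![ρ, τ, ς] *
      (‖dirVec τ‖ * ‖dirVec ς‖ * (‖dirVec ρ‖ + ‖dirVec τ‖ + ‖dirVec ς‖) ^ 3)) :=
  (hV.mDyn_top_eq (n := 1) (by omega) ![ρ, τ, ς]).trans
    (congrArg (fun t => ENNReal.ofReal (partialSup V κ ![ρ, τ, ς] * t))
      (congrArg₂ (fun a b : ℝ => a * b ^ 3)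
        (Fin.prod_univ_two fun i : Fin 2 => ‖dirVec (![ρ, τ, ς] i.succ)‖)
        (Fin.sum_univ_three fun i : Fin 3 => ‖dirVec (![ρ, τ, ς] i)‖)))

theorem IsSiteEnergy.mDyn_top_four (hV : IsSiteEnergy κ k V) (hk : 4 ≤ k)
    (ρ σ τ ς : LatStar d) :
    mDyn V κ ∞ ![ρ, σ, τ, ς] = ENNReal.ofReal (partialSup V κ ![ρ, σ, τ, ς] *
      (‖dirVec σ‖ * ‖dirVec τ‖ * ‖dirVec ς‖ *
        (‖dirVec ρ‖ + ‖dirVec σ‖ + ‖dirVec τ‖ + ‖dirVec ς‖) ^ 3)) :=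
  (hV.mDyn_top_eq (n := 2) (by omega) ![ρ, σ, τ, ς]).trans
    (congrArg (fun t => ENNReal.ofReal (partialSup V κ ![ρ, σ, τ, ς] * t))
      (congrArg₂ (fun a b : ℝ => a * b ^ 3)
        (Fin.prod_univ_three fun i : Fin 3 => ‖dirVec (![ρ, σ, τ, ς] i.succ)‖)
        (Fin.sum_univ_four fun i : Fin 4 => ‖dirVec (![ρ, σ, τ, ς] i)‖)))

theorem MemWInftyLoc.ofReal_locNorm (hu : MemWInftyLoc 4 u) (x : Eu d) {j : ℕ} (hj : j ≤ 4)
    (ρ ς : LatStar d) :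
    ENNReal.ofReal (locNorm c u x j ρ ς) = linftyDeriv j u (x +ᵥ nuSet c ρ ς) :=
  ENNReal.ofReal_toReal (hu.linftyDeriv_ne_top hj (isCompact_vadd_nuSet x ρ ς))

/-- Lattice directions have length at least one, so that the constant `c` is absorbed. -/
theorem bondScale_le (hc : 0 < c) {ρ ς : LatStar d} {S : ℝ} (h : ‖dirVec ρ‖ + ‖dirVec ς‖ ≤ S) :
    bondScale c ρ ς ≤ (c + 1) * S := by
  have h1 : c ≤ c * S := le_mul_of_one_le_right hc.le
    (by linarith [one_le_norm_dirVec ρ, norm_nonneg (dirVec ς)])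
  unfold bondScale
  linarith

/-- The factor `bondScale² |ρ|` of the first-order bound is at most `(c + 1)³ |ρ|³`, with `|ρ|` on
the right the total length of the bonds; likewise in the next two lemmas. -/
theorem MemWInftyLoc.ofReal_two_le (hu : MemWInftyLoc 4 u) (hV : IsSiteEnergy κ k V) (hκ : 0 < κ)
    (hk : 4 ≤ k) (hc : 0 < c) (x : Eu d) (ρ ς : LatStar d) :
    ENNReal.ofReal (partialSup V κ ![ς, ρ] *
        (locNorm c u x 4 ρ ς * (bondScale c ρ ς ^ 2 * ‖dirVec ρ‖ * ‖dirVec ς‖)))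
      ≤ ENNReal.ofReal ((c + 1) ^ 3) * (mDyn V κ ∞ ![ρ, ς] *
        linftyDeriv 4 u (x +ᵥ nuSet c ρ ς)) := by
  set S := ‖dirVec ρ‖ + ‖dirVec ς‖ with hS
  have h1 := one_le_norm_dirVec ρ
  have hR := bondScale_le hc (ρ := ρ) (ς := ς) le_rfl
  have hR0 := bondScale_nonneg hc ρ ς
  have hN := hV.partialSup_two_le hκ hk ς ρ
  have hN0 := partialSup_nonneg (V := V) (κ := κ) ![ρ, ς]
  have hl := locNorm_nonneg (c := c) (u := u) x 4 ρ ς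
  rw [hV.mDyn_top_two hk, ← hu.ofReal_locNorm x le_rfl,
    ← ENNReal.ofReal_mul (mul_nonneg hN0 (by positivity)), ← ENNReal.ofReal_mul (by positivity)]
  refine ENNReal.ofReal_le_ofReal ?_
  have hρS : ‖dirVec ρ‖ ≤ (c + 1) * S := by
    have := norm_nonneg (dirVec ς)
    nlinarith
  calc _ ≤ partialSup V κ ![ρ, ς] * (locNorm c u x 4 ρ ς *
        (((c + 1) * S) ^ 2 * ((c + 1) * S) * ‖dirVec ς‖)) := by gcongr
    _ = _ := by ring

theorem MemWInftyLoc.ofReal_three_le (hu : MemWInftyLoc 4 u) (hV : IsSiteEnergy κ k V)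
    (hk : 4 ≤ k) (hc : 0 < c) (x : Eu d) (ρ τ ς : LatStar d) {N : ℝ}
    (hN : N ≤ partialSup V κ ![ρ, τ, ς]) :
    ENNReal.ofReal (N * (locNorm c u x 3 ρ τ * (bondScale c ρ τ ^ 2 * ‖dirVec τ‖)
        * (locNorm c u x 2 ρ ς * (bondScale c ρ ς * ‖dirVec ς‖))))
      ≤ ENNReal.ofReal ((c + 1) ^ 3) * (mDyn V κ ∞ ![ρ, τ, ς] *
        (linftyDeriv 3 u (x +ᵥ nuSet c ρ τ) * linftyDeriv 2 u (x +ᵥ nuSet c ρ ς))) := by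
  set S := ‖dirVec ρ‖ + ‖dirVec τ‖ + ‖dirVec ς‖ with hS
  have hR1 := bondScale_le hc (ρ := ρ) (ς := τ) (S := S) (by linarith [norm_nonneg (dirVec ς)])
  have hR2 := bondScale_le hc (ρ := ρ) (ς := ς) (S := S) (by linarith [norm_nonneg (dirVec τ)])
  have hR10 := bondScale_nonneg hc ρ τ
  have hR20 := bondScale_nonneg hc ρ ς
  have hN0 := partialSup_nonneg (V := V) (κ := κ) ![ρ, τ, ς]
  have hl1 := locNorm_nonneg (c := c) (u := u) x 3 ρ τ
  have hl2 := locNorm_nonneg (c := c) (u := u) x 2 ρ ς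
  rw [hV.mDyn_top_three hk, ← hu.ofReal_locNorm x (j := 3) (by norm_num),
    ← hu.ofReal_locNorm x (j := 2) (by norm_num), ← ENNReal.ofReal_mul hl1,
    ← ENNReal.ofReal_mul (mul_nonneg hN0 (by positivity)), ← ENNReal.ofReal_mul (by positivity)]
  refine ENNReal.ofReal_le_ofReal ?_
  calc _ ≤ partialSup V κ ![ρ, τ, ς] * (locNorm c u x 3 ρ τ * (((c + 1) * S) ^ 2 * ‖dirVec τ‖)
        * (locNorm c u x 2 ρ ς * (((c + 1) * S) * ‖dirVec ς‖))) := by gcongr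
    _ = _ := by ring

theorem MemWInftyLoc.ofReal_thirdBound_le (hu : MemWInftyLoc 4 u) (hV : IsSiteEnergy κ k V)
    (hκ : 0 < κ) (hk : 4 ≤ k) (hc : 0 < c) (x : Eu d) {v : Eu d} (hv : ‖v‖ = 1)
    (ρ σ τ ς : LatStar d) :
    ENNReal.ofReal (thirdBound c κ V u x v ρ (σ, τ, ς))
      ≤ ENNReal.ofReal ((c + 1) ^ 3) * (mDyn V κ ∞ ![ρ, σ, τ, ς] *
        (linftyDeriv 2 u (x +ᵥ nuSet c ρ σ) * linftyDeriv 2 u (x +ᵥ nuSet c ρ τ) *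
          linftyDeriv 2 u (x +ᵥ nuSet c ρ ς))) := by
  set S := ‖dirVec ρ‖ + ‖dirVec σ‖ + ‖dirVec τ‖ + ‖dirVec ς‖ with hS
  have n1 := norm_nonneg (dirVec σ)
  have n2 := norm_nonneg (dirVec τ)
  have n3 := norm_nonneg (dirVec ς)
  have hR1 := bondScale_le hc (ρ := ρ) (ς := σ) (S := S) (by linarith)
  have hR2 := bondScale_le hc (ρ := ρ) (ς := τ) (S := S) (by linarith)
  have hR3 := bondScale_le hc (ρ := ρ) (ς := ς) (S := S) (by linarith)
  have hR10 := bondScale_nonneg hc ρ σ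
  have hR20 := bondScale_nonneg hc ρ τ
  have hR30 := bondScale_nonneg hc ρ ς
  have hN := hV.partialSup_four_le hκ hk σ τ ς ρ
  have hN0 := partialSup_nonneg (V := V) (κ := κ) ![ρ, σ, τ, ς]
  have hl := fun ς => locNorm_nonneg (c := c) (u := u) x 2 ρ ς
  have hl1 := hl σ
  have hl2 := hl τ
  have hl3 := hl ς
  rw [hV.mDyn_top_four hk]
  simp only [← hu.ofReal_locNorm x (j := 2) (by norm_num)]
  rw [← ENNReal.ofReal_mul hl1, ← ENNReal.ofReal_mul (mul_nonneg hl1 hl2),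
    ← ENNReal.ofReal_mul (mul_nonneg hN0 (by positivity)), ← ENNReal.ofReal_mul (by positivity)]
  refine ENNReal.ofReal_le_ofReal ?_
  simp only [thirdBound, hv, mul_one]
  calc _ ≤ partialSup V κ ![ρ, σ, τ, ς] * (locNorm c u x 2 ρ σ * ((c + 1) * S * ‖dirVec σ‖)
        * (locNorm c u x 2 ρ τ * ((c + 1) * S * ‖dirVec τ‖))
        * (locNorm c u x 2 ρ ς * ((c + 1) * S * ‖dirVec ς‖))) := by gcongr
    _ = _ := by ring

/-- The right-hand side of the consistency estimate, without the constant. -/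
def consistencyBound (c κ : ℝ) (V : Stencil d → EReal) (u : Eu d → Eu d) (x : Eu d) : ℝ≥0∞ :=
  (∑' ρ : Fin 4 → LatStar d, mDyn V κ ∞ ρ *
      ∏ j : Fin 3, linftyDeriv 2 u (x +ᵥ nuSet c (ρ 0) (ρ j.succ)))
    + (∑' ρ : Fin 3 → LatStar d, mDyn V κ ∞ ρ *
      (linftyDeriv 3 u (x +ᵥ nuSet c (ρ 0) (ρ 1)) *
        linftyDeriv 2 u (x +ᵥ nuSet c (ρ 0) (ρ 2))))
    + ∑' ρ : Fin 2 → LatStar d, mDyn V κ ∞ ρ *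
      linftyDeriv 4 u (x +ᵥ nuSet c (ρ 0) (ρ 1))

/-- The estimate for one component of the divergence. The factor `2` counts the two sites of a bond
in the third-order term and the two orders of the bonds `τ`, `ς` in the second-order term. -/
theorem MemWInftyLoc.enorm_component_le (hu : MemWInftyLoc 4 u) (hcu : Continuous u)
    (hV : IsSiteEnergy κ k V) (hκ : 0 < κ) (hk : 4 ≤ k) (hK : MemK κ u) (hc : 0 < c)
    (hζ : IsNodalBasis ζ) (hsupp : Function.support ζ ⊆ Metric.closedBall 0 c) (x : Eu d)
    {v : Eu d} (hv : ‖v‖ = 1) :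
    ‖(∑' ρ, bondForce ζ c V κ u x v ρ) - ∑' q : LatStar d × LatStar d,
        partialV V κ ![q.2, q.1] (homStencil (fderiv ℝ u x))
          ![fderiv ℝ (fderiv ℝ u) x (dirVec q.1) (dirVec q.2), v]‖ₑ
      ≤ 2 * ENNReal.ofReal ((c + 1) ^ 3) * consistencyBound c κ V u x := by
  set A := ENNReal.ofReal ((c + 1) ^ 3) with hA
  set T2 : (Fin 2 → LatStar d) → ℝ≥0∞ := fun ρ => mDyn V κ ∞ ρ *
      linftyDeriv 4 u (x +ᵥ nuSet c (ρ 0) (ρ 1)) with hT2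
  set T3 : (Fin 3 → LatStar d) → ℝ≥0∞ := fun ρ => mDyn V κ ∞ ρ *
      (linftyDeriv 3 u (x +ᵥ nuSet c (ρ 0) (ρ 1)) *
        linftyDeriv 2 u (x +ᵥ nuSet c (ρ 0) (ρ 2))) with hT3
  set T4 : (Fin 4 → LatStar d) → ℝ≥0∞ := fun ρ => mDyn V κ ∞ ρ *
      ∏ j : Fin 3, linftyDeriv 2 u (x +ᵥ nuSet c (ρ 0) (ρ j.succ)) with hT4
  have b2 : ∑' q : LatStar d × LatStar d, ENNReal.ofReal (partialSup V κ ![q.2, q.1] *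
        (locNorm c u x 4 q.1 q.2 * (bondScale c q.1 q.2 ^ 2 * ‖dirVec q.1‖ * ‖dirVec q.2‖)
          * ‖v‖)) ≤ A * ∑' ρ, T2 ρ := by
    rw [← ENNReal.tsum_mul_left]
    refine (ENNReal.tsum_le_tsum fun q => ?_).trans (ENNReal.tsum_comp_le_tsum_of_injective
      (f := fun q : LatStar d × LatStar d => ![q.1, q.2]) (fun a b h =>
        Prod.ext (by simpa using congrFun h 0) (by simpa using congrFun h 1)) fun ρ => A * T2 ρ)
    rw [hv, mul_one]
    exact hu.ofReal_two_le hV hκ hk hc x q.1 q.2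
  have b3 : ∑' q, ENNReal.ofReal (secondBound c κ V u x v q) ≤ 2 * (A * ∑' ρ, T3 ρ) := by
    rw [two_mul, ← ENNReal.tsum_mul_left]
    refine le_trans ?_ (add_le_add
      (ENNReal.tsum_comp_le_tsum_of_injective
        (f := fun q : LatStar d × LatStar d × LatStar d => ![q.1, q.2.1, q.2.2]) (fun a b h =>
        Prod.ext (by simpa using congrFun h 0)
          (Prod.ext (by simpa using congrFun h 1) (by simpa using congrFun h 2)))
        fun ρ => A * T3 ρ)
      (ENNReal.tsum_comp_le_tsum_of_injective
        (f := fun q : LatStar d × LatStar d × LatStar d => ![q.1, q.2.2, q.2.1]) (fun a b h =>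
        Prod.ext (by simpa using congrFun h 0)
          (Prod.ext (by simpa using congrFun h 2) (by simpa using congrFun h 1)))
        fun ρ => A * T3 ρ))
    rw [← ENNReal.tsum_add]
    refine ENNReal.tsum_le_tsum fun q => ?_
    rw [secondBound, hv, mul_one, mul_add]
    refine ENNReal.ofReal_add_le.trans (add_le_add
      (hu.ofReal_three_le hV hk hc x q.1 q.2.1 q.2.2 (hV.partialSup_three_le hκ hk _ _ _)) ?_)
    rw [mul_comm (locNorm c u x 2 q.1 q.2.1 * _)]
    exact hu.ofReal_three_le hV hk hc x q.1 q.2.2 q.2.1 (hV.partialSup_three_le' hκ hk _ _ _)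
  have b4 : ∑' ρ, ∑' p, ENNReal.ofReal (thirdBound c κ V u x v ρ p) ≤ A * ∑' ρ, T4 ρ := by
    rw [← ENNReal.tsum_mul_left, ← ENNReal.tsum_prod (f := fun ρ p =>
      ENNReal.ofReal (thirdBound c κ V u x v ρ p))]
    refine le_trans ?_ (ENNReal.tsum_comp_le_tsum_of_injective
      (f := fun q : LatStar d × LatStar d × LatStar d × LatStar d =>
        ![q.1, q.2.1, q.2.2.1, q.2.2.2]) (fun a b h =>
        Prod.ext (by simpa using congrFun h 0) (Prod.ext (by simpa using congrFun h 1)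
          (Prod.ext (by simpa using congrFun h 2) (by simpa using congrFun h 3))))
        fun ρ => A * T4 ρ)
    refine ENNReal.tsum_le_tsum fun q =>
      (hu.ofReal_thirdBound_le hV hκ hk hc x hv q.1 q.2.1 q.2.2.1 q.2.2.2).trans (le_of_eq ?_)
    exact congrArg (fun t => A * (_ * t)) (Fin.prod_univ_three fun j : Fin 3 => linftyDeriv 2 u
      (x +ᵥ nuSet c q.1 (![q.1, q.2.1, q.2.2.1, q.2.2.2] j.succ))).symm
  refine (hu.enorm_tsum_bondForce_sub_le hcu hV hκ hk hK hc hζ hsupp x v).trans ?_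
  change _ ≤ 2 * A * ((∑' ρ, T4 ρ) + (∑' ρ, T3 ρ) + ∑' ρ, T2 ρ)
  calc _ ≤ A * (∑' ρ, T2 ρ) + 2 * (A * ∑' ρ, T3 ρ) + 2 * (A * ∑' ρ, T4 ρ) := by gcongr
    _ ≤ 2 * (A * ∑' ρ, T2 ρ) + 2 * (A * ∑' ρ, T3 ρ) + 2 * (A * ∑' ρ, T4 ρ) := by
      have h : A * ∑' ρ, T2 ρ ≤ 2 * (A * ∑' ρ, T2 ρ) := by
        rw [two_mul]
        exact le_self_add
      exact add_le_add (add_le_add h le_rfl) le_rfl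
    _ = _ := by ring

end Weights

/-! ### The two divergences -/

section Divergence

variable {d : ℕ} {ζ : Eu d → ℝ} {c κ : ℝ} {k : ℕ} {V : Stencil d → EReal} {u : Eu d → Eu d}

/-- The continuous representative of the divergence of the atomistic stress. -/
def atomDiv (ζ : Eu d → ℝ) (c : ℝ) (V : Stencil d → EReal) (κ : ℝ) (u : Eu d → Eu d) (x : Eu d) :
    Eu d :=
  WithLp.toLp 2 fun i => ∑' ρ, bondForce ζ c V κ u x (EuclideanSpace.single i 1) ρ

theorem continuous_toLp_of_forall {f : Eu d → Fin d → ℝ} (h : ∀ i, Continuous fun x => f x i) :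
    Continuous fun x => (WithLp.toLp 2 (f x) : Eu d) :=
  (PiLp.continuous_toLp 2 _).comp (continuous_pi h)

theorem phiDeriv_eq (ξ : ZLat d) (ρ : LatStar d) (i : Fin d) :
    phiDeriv V κ u ξ ρ i
      = partialV V κ ![ρ] (diffStencil u ξ) ![EuclideanSpace.single i 1] := by
  have e : (fun _ : Fin 1 => ρ) = ![ρ] := by
    funext j
    rw [Matrix.cons_val_fin_one]
  rw [phiDeriv, e]
  congr 1
  funext j
  rw [Matrix.cons_val_fin_one]

/-- The bond forces `V_ρ(Du(ξ))` are bounded by the weights, so `isWeakDiv_latticeStress` applies to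
each row of `S^a`. -/
theorem MemWInftyLoc.isWeakDiv_atomStress (hu : MemWInftyLoc 4 u) (hcu : Continuous u)
    (hV : IsSiteEnergy κ k V) (hκ : 0 < κ) (hk : 4 ≤ k) (hK : MemK κ u)
    (hζ : IsNodalBasis ζ) (hsupp : Function.support ζ ⊆ Metric.closedBall 0 c) :
    Continuous (atomDiv ζ c V κ u) ∧ IsWeakDiv (atomStress ζ V κ u) (atomDiv ζ c V κ u) := by
  have key := fun i : Fin d => isWeakDiv_latticeStress hζ hsupp
    (a := fun ρ ξ => phiDeriv V κ u ξ ρ i) (b := fun ρ => partialSup V κ ![ρ])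
    (S := fun x α => atomStress ζ V κ u x i α)
    (f := fun x => ∑' ρ, bondForce ζ c V κ u x (EuclideanSpace.single i 1) ρ)
    (fun ρ ξ => by
      rw [phiDeriv_eq]
      refine (hV.abs_partialV_le (j := 1) (by omega) (by omega) _
        (hu.diffStencil_mem hcu hκ hK ξ) _).trans (le_of_eq ?_)
      simp)
    (hV.summable_mul (j := 1) (by omega) (by omega) (e := fun ρ : LatStar d => ![ρ])
      (fun a b h => by simpa using congrFun h 0) 1 (fun _ => norm_nonneg _) (fun ρ => by simp))
    (fun x α => rfl)
    (fun x => by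
      refine tsum_congr fun ρ => ?_
      rw [latSum_sub_dirVec, latSum_eq_sum hsupp, latSum_eq_sum hsupp, ← Finset.sum_sub_distrib]
      simp only [bondForce, siteMean, phiDeriv_eq, smul_eq_mul]
      exact Finset.sum_congr rfl fun ξ _ => by ring)
  have hcont : Continuous (atomDiv ζ c V κ u) := continuous_toLp_of_forall fun i => (key i).2.1
  exact ⟨hcont, fun i α => ((key i).1 α).locallyIntegrable, hcont.locallyIntegrable,
    fun φ hφ hφc i => (key i).2.2 φ hφ hφc⟩

theorem MemWInftyLoc.isWeakDiv_cbStress (hu : MemWInftyLoc 4 u) (hcu : Continuous u)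
    (hV : IsSiteEnergy κ k V) (hκ : 0 < κ) (hk : 4 ≤ k) (hK : MemK κ u) :
    Continuous (fun x => (WithLp.toLp 2 fun i => cbDiv V κ u i x : Eu d)) ∧
      IsWeakDiv (cbStress V κ u) (fun x => (WithLp.toLp 2 fun i => cbDiv V κ u i x : Eu d)) := by
  have hcont := continuous_toLp_of_forall (f := fun x i => cbDiv V κ u i x)
    fun i => hu.continuous_cbDiv hcu hV hκ hk hK i
  refine ⟨hcont, fun i α => ?_, hcont.locallyIntegrable,
    fun φ hφ hφc i => hu.integral_cbStress hcu hV hκ hk hK hφ hφc i⟩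
  have h : Continuous (cbStressC V κ u i α) := continuous_iff_continuousAt.2 fun x =>
    (hu.hasFDerivAt_cbStressC hcu hV hκ hk hK i α x).choose_spec.1.continuousAt
  exact h.locallyIntegrable.congr (hu.cbStress_ae hcu hV hκ hk hK i α).symm

theorem enorm_le_sum_enorm (w : Eu d) : ‖w‖ₑ ≤ ∑ i, ‖w i‖ₑ := by
  rw [eq_sum_smul_single w]
  refine (enorm_sum_le _ _).trans (Finset.sum_le_sum fun i _ => ?_)
  rw [← eq_sum_smul_single w, enorm_smul, ← ofReal_norm (EuclideanSpace.single i (1 : ℝ)),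
    PiLp.norm_single]
  simp

end Divergence

end

theorem mainTheorem4 (d : ℕ) (ζ : Eu d → ℝ) (hζ : IsNodalBasis ζ)
    (c : ℝ) (hc : 0 < c) (hsupp : Function.support ζ ⊆ Metric.closedBall 0 c) :
    ∃ C : ℝ≥0, ∀ (κ : ℝ), 0 < κ → ∀ (k : ℕ), 4 ≤ k →
      ∀ V : Stencil d → EReal, IsSiteEnergy κ k V →
      ∀ u : Eu d → Eu d, Continuous u → MemWInftyLoc 4 u → MemK κ u →
      ∃ divSa divSc : Eu d → Eu d,
        Continuous divSa ∧ IsWeakDiv (atomStress ζ V κ u) divSa ∧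
        Continuous divSc ∧ IsWeakDiv (cbStress V κ u) divSc ∧
        ∀ x : Eu d, ‖divSa x - divSc x‖ₑ ≤ C *
          ((∑' ρ : Fin 4 → LatStar d, mDyn V κ ∞ ρ *
              ∏ j : Fin 3, linftyDeriv 2 u (x +ᵥ nuSet c (ρ 0) (ρ j.succ)))
            + (∑' ρ : Fin 3 → LatStar d, mDyn V κ ∞ ρ *
              (linftyDeriv 3 u (x +ᵥ nuSet c (ρ 0) (ρ 1)) *
                linftyDeriv 2 u (x +ᵥ nuSet c (ρ 0) (ρ 2))))
            + ∑' ρ : Fin 2 → LatStar d, mDyn V κ ∞ ρ *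
              linftyDeriv 4 u (x +ᵥ nuSet c (ρ 0) (ρ 1))) := by
  -- the factor `d` comes from adding up the components of the divergence
  refine ⟨d * (2 * ((c + 1) ^ 3).toNNReal), fun κ hκ k hk V hV u hcu hu hK => ?_⟩
  obtain ⟨h1, h2⟩ := hu.isWeakDiv_atomStress hcu hV hκ hk hK hζ hsupp
  obtain ⟨h3, h4⟩ := hu.isWeakDiv_cbStress hcu hV hκ hk hK
  refine ⟨_, _, h1, h2, h3, h4, fun x => ?_⟩
  change _ ≤ _ * consistencyBound c κ V u x
  refine (enorm_le_sum_enorm _).trans ?_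
  have hi : ∀ i : Fin d, ‖(atomDiv ζ c V κ u x
      - (WithLp.toLp 2 fun i => cbDiv V κ u i x : Eu d)) i‖ₑ
      ≤ 2 * ENNReal.ofReal ((c + 1) ^ 3) * consistencyBound c κ V u x := fun i => by
    have := hu.enorm_component_le hcu hV hκ hk hK hc hζ hsupp x
      (v := EuclideanSpace.single i 1) (by simp)
    rw [← hu.cbDiv_eq_tsum hcu hV hκ hk hK i x] at this
    exact this
  refine (Finset.sum_le_sum fun i _ => hi i).trans (le_of_eq ?_)
  rw [Finset.sum_const, Finset.card_univ, Fintype.card_fin, nsmul_eq_mul]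
  push_cast
  rw [ENNReal.ofReal]
  ring
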